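/- **Setting.** Let $K$ be a field of characteristic $0$, let $q^{1/4},t^{1/4}\in K$ be algebraically independent over $\mathbb{Q}$, let $N\in\mathbb{Z}$, and let $u,v,w\in K$ be nonzero (for instance indeterminates, possibly specialized by a relation between them). Write $\delta(z)=\sum_{n\in\mathbb{Z}}z^n$ and $$g(z)=\frac{G^+(z)}{G^-(z)},\qquad G^\pm(z)=(1-q^{\pm1}z)(1-t^{\mp1}z)(1-q^{\mp1}t^{\pm1}z).$$ **The algebra.** $\mathcal{U}$ is the unital associative $K$-algebra generated by the modes of $x^\pm(z)=\sum_{n\in\mathbb{Z}}x^\pm_nz^{-n}$, $\psi^\pm(z)=\sum_{n\ge0}\psi^\pm_{\pm n}z^{\mp n}$ and by central mutually inverse elements $\gamma^{\pm1/2}$, with relations $$\psi^\pm(z)\psi^\pm(w)=\psi^\pm(w)\psi^\pm(z),\qquad \psi^+(z)\psi^-(w)=\frac{g(\gamma w/z)}{g(\gamma^{-1}w/z)}\psi^-(w)\psi^+(z),$$ $$\psi^+(z)x^\pm(w)=g(\gamma^{\mp1/2}w/z)^{\mp1}x^\pm(w)\psi^+(z),\qquad \psi^-(z)x^\pm(w)=g(\gamma^{\mp1/2}z/w)^{\pm1}x^\pm(w)\psi^-(z),$$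 $$[x^+(z),x^-(w)]=\frac{(1-q)(1-1/t)}{1-q/t}\Big(\delta(\gamma^{-1}z/w)\psi^+(\gamma^{1/2}w)-\delta(\gamma z/w)\psi^-(\gamma^{-1/2}w)\Big),$$ $$G^\mp(z/w)x^\pm(z)x^\pm(w)=G^\pm(z/w)x^\pm(w)x^\pm(z).$$ With $\gamma_{(1)}^{1/2}=\gamma^{1/2}\otimes1$ and $\gamma_{(2)}^{1/2}=1\otimes\gamma^{1/2}$, the coproduct is $\Delta(\gamma^{\pm1/2})=\gamma^{\pm1/2}\otimes\gamma^{\pm1/2}$, $$\Delta(x^+(z))=x^+(z)\otimes1+\psi^-(\gamma_{(1)}^{1/2}z)\otimes x^+(\gamma_{(1)}z),\qquad \Delta(x^-(z))=x^-(\gamma_{(2)}z)\otimes\psi^+(\gamma_{(2)}^{1/2}z)+1\otimes x^-(z),$$ $$\Delta(\psi^\pm(z))=\psi^\pm(\gamma_{(2)}^{\pm1/2}z)\otimes\psi^\pm(\gamma_{(1)}^{\mp1/2}z).$$ **Horizontal modules.** Let $\mathcal{F}=K[p_1,p_2,\dots]$ with $\deg p_n=n$, and for $n>0$ let $a_{-n}$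 be multiplication by $p_n$ and $a_n=n\frac{1-q^n}{1-t^n}\frac{\partial}{\partial p_n}$. Let $\widehat{\mathcal{F}}$ be the product of the homogeneous components of $\mathcal{F}$. Put $$\eta(z)=\exp\Big(\sum_{n\ge1}\tfrac{1-t^{-n}}{n}a_{-n}z^n\Big)\exp\Big(-\sum_{n\ge1}\tfrac{1-t^n}{n}a_nz^{-n}\Big),$$ $$\xi(z)=\exp\Big(-\sum_{n\ge1}\tfrac{1-t^{-n}}{n}q^{-n/2}t^{n/2}a_{-n}z^n\Big)\exp\Big(\sum_{n\ge1}\tfrac{1-t^n}{n}q^{-n/2}t^{n/2}a_nz^{-n}\Big),$$ $$\varphi^+(z)=\exp\Big(-\sum_{n\ge1}\tfrac{1-t^n}{n}(1-t^nq^{-n})q^{n/4}t^{-n/4}a_nz^{-n}\Big),$$ $$\varphi^-(z)=\exp\Big(\sum_{n\ge1}\tfrac{1-t^{-n}}{n}(1-t^nq^{-n})q^{n/4}t^{-n/4}a_{-n}z^n\Big).$$ For $M\in\mathbb{Z}$ and $s\in K^\times$, $\mathcal{F}^{(1,M)}_s$ is $\mathcal{F}$ with $\gamma^{1/2}=(t/q)^{1/4}$,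 $x^+(z)=s\,z^{-M}q^{-M/2}t^{M/2}\eta(z)$, $x^-(z)=s^{-1}z^{M}q^{M/2}t^{-M/2}\xi(z)$, $\psi^\pm(z)=(q^{1/2}t^{-1/2})^{\pm M}\varphi^\pm(z)$. The same modes act on $\widehat{\mathcal{F}}$. **Vertical module.** For a partition $\lambda$ let $\lambda'$ be its conjugate, $n(\lambda)=\sum_{i\ge1}(i-1)\lambda_i$, and $$c_\lambda=\prod_{(i,j)\in\lambda}(1-q^{\lambda_i-j}t^{\lambda'_j-i+1}),\qquad c'_\lambda=\prod_{(i,j)\in\lambda}(1-q^{\lambda_i-j+1}t^{\lambda'_j-i}),\qquad f_\lambda=(-1)^{|\lambda|}q^{n(\lambda')+|\lambda|/2}t^{-n(\lambda)-|\lambda|/2},$$ $$A^+_{\lambda,i}=(1-t)\prod_{j=1}^{i-1}\frac{(1-q^{\lambda_i-\lambda_j}t^{-i+j+1})(1-q^{\lambda_i-\lambda_j+1}t^{-i+j-1})}{(1-q^{\lambda_i-\lambda_j}t^{-i+j})(1-q^{\lambda_i-\lambda_j+1}t^{-i+j})},$$ $$A^-_{\lambda,i}=(1-t^{-1})\frac{1-q^{\lambda_{i+1}-\lambda_i}}{1-q^{\lambda_{i+1}-\lambda_i+1}t^{-1}}\prod_{j=i+1}^{\infty}\frac{(1-q^{\lambda_j-\lambda_i+1}t^{-j+i-1})(1-q^{\lambda_{j+1}-\lambda_i}t^{-j+i})}{(1-q^{\lambda_{j+1}-\lambda_i+1}t^{-j+i-1})(1-q^{\lambda_j-\lambda_i}t^{-j+i})},$$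 $$B^+_\lambda(z)=\frac{1-q^{\lambda_1-1}tz}{1-q^{\lambda_1}z}\prod_{i=1}^\infty\frac{(1-q^{\lambda_i}t^{-i}z)(1-q^{\lambda_{i+1}-1}t^{-i+1}z)}{(1-q^{\lambda_{i+1}}t^{-i}z)(1-q^{\lambda_i-1}t^{-i+1}z)},$$ and let $B^-_\lambda(z)$ be $B^+_\lambda(z)$ with $q,t$ replaced by $q^{-1},t^{-1}$. The module $\mathcal{F}^{(0,1)}_u$ has a basis $(P_\lambda)$ indexed by the partitions (the Macdonald functions), and we put $Q_\lambda=(c_\lambda/c'_\lambda)P_\lambda$; writing $\lambda\pm\mathbf{1}_i$ for $\lambda$ with a box added to or removed from row $i$ (terms that are not partitions are omitted), the action is $\gamma^{1/2}=1$, $$x^+(z)P_\lambda=\sum_{i=1}^{\ell(\lambda)+1}A^+_{\lambda,i}\,\delta(q^{\lambda_i}t^{-i+1}u/z)P_{\lambda+\mathbf{1}_i},\qquad x^-(z)P_\lambda=q^{1/2}t^{-1/2}\sum_{i=1}^{\ell(\lambda)}A^-_{\lambda,i}\,\delta(q^{\lambda_i-1}t^{-i+1}u/z)P_{\lambda-\mathbf{1}_i},$$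 $$\psi^+(z)P_\lambda=q^{1/2}t^{-1/2}B^+_\lambda(u/z)P_\lambda,\qquad \psi^-(z)P_\lambda=q^{-1/2}t^{1/2}B^-_\lambda(z/u)P_\lambda.$$ **Dual intertwiner.** Let $\mathcal{F}^{(1,N)}_v\widehat\otimes\mathcal{F}^{(0,1)}_u$ be the space of all formal sums $\sum_\lambda\tau_\lambda\otimes Q_\lambda$ with $\tau_\lambda\in\widehat{\mathcal{F}}$; the generators of $\mathcal{U}$ act on it through $\Delta$. A normalized dual intertwiner is a $K$-linear map $$\Phi^*:\mathcal{F}^{(1,N+1)}_w\to\mathcal{F}^{(1,N)}_v\,\widehat\otimes\,\mathcal{F}^{(0,1)}_u,\qquad \Phi^*(\alpha)=\sum_\lambda\Phi^*_\lambda(\alpha)\otimes Q_\lambda,$$ such that $\Delta(a)\Phi^*=\Phi^*a$ for all $a\in\mathcal{U}$ (where $a$ acts on both sides by one and the same, arbitrary, expression of $a$ in the generators) and $\Phi^*_\emptyset(1)=1+(\text{terms of positive degree})$. **Theorem.** If a normalized dual intertwiner $\Phi^*$ exists, then $w=-vu$. Conversely, if $w=-vu$, then there is exactly one normalized dual intertwiner,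 and its components are, for every partition $\lambda$, $$\Phi^*_\lambda=(q^{-1}v)^{-|\lambda|}(-u)^{N|\lambda|}f_\lambda^{N}\cdot\frac{q^{n(\lambda')}}{c_\lambda}:\widetilde\Phi^*_\emptyset(u)\,\xi_\lambda(u):\ ,$$ where $:\ :$ denotes normal ordering (all $a_{-n}$, $n>0$, to the left of all $a_n$), $\xi_\lambda(u)=\,:\prod_{i=1}^{\ell(\lambda)}\prod_{j=1}^{\lambda_i}\xi(q^{j-1}t^{-i+1}u):$ and $$\widetilde\Phi^*_\emptyset(u)=\exp\Big(\sum_{n\ge1}\frac1n\frac{1}{1-q^n}q^{-n/2}t^{n/2}a_{-n}u^n\Big)\exp\Big(\sum_{n\ge1}\frac1n\frac{q^n}{1-q^n}q^{-n/2}t^{n/2}a_nu^{-n}\Big).$$ -/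

import Mathlib

namespace Toroidal

noncomputable section

open Finset

/-! ## The algebra generated by the Drinfeld currents -/

/-- The modes of the Drinfeld currents: `x^±_n` (`n ∈ ℤ`), `ψ^+_n` and `ψ^-_{-n}` (`n ∈ ℕ`), and
`γ^{±1/2}`. The currents are `x^±(z) = ∑ x^±_n z^{-n}`, `ψ^+(z) = ∑_{n ≥ 0} ψ^+_n z^{-n}` and
`ψ^-(z) = ∑_{n ≥ 0} ψ^-_{-n} z^n`. -/
inductive Gen : Type
  | gamma : Gen
  | gammaInv : Gen
  | xp (n : ℤ) : Gen
  | xm (n : ℤ) : Gen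
  /-- `psip n` is `ψ^+_n` -/
  | psip (n : ℕ) : Gen
  /-- `psim n` is `ψ^-_{-n}` -/
  | psim (n : ℕ) : Gen

/-- `G^+(z) = (1 - q z)(1 - t⁻¹ z)(1 - q⁻¹ t z)`; `G^-(z)` is obtained by inverting `q` and `t`. -/
def GPlus {K : Type*} [Field K] (q t : K) : PowerSeries K :=
  (1 - PowerSeries.C q * PowerSeries.X) * (1 - PowerSeries.C t⁻¹ * PowerSeries.X) *
    (1 - PowerSeries.C (q⁻¹ * t) * PowerSeries.X)

def GMinus {K : Type*} [Field K] (q t : K) : PowerSeries K := GPlus q⁻¹ t⁻¹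

/-- `g(z) = G^+(z) / G^-(z)` -/
def gSeries {K : Type*} [Field K] (q t : K) : PowerSeries K := GPlus q t * (GMinus q t)⁻¹

def gen (K : Type*) [Field K] (a : Gen) : FreeAlgebra K Gen := FreeAlgebra.ι K a

/-- `γ^{k/2}` for `k ∈ ℤ` -/
def gammaHalf (K : Type*) [Field K] : ℤ → FreeAlgebra K Gen
  | Int.ofNat n => gen K Gen.gamma ^ n
  | Int.negSucc n => gen K Gen.gammaInv ^ (n + 1)

/-- The coefficient of `(w/z)^k` in `g(γ w/z) / g(γ⁻¹ w/z)`. -/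
def gRatio {K : Type*} [Field K] (q t : K) (k : ℕ) : FreeAlgebra K Gen :=
  ∑ i ∈ range (k + 1),
    (PowerSeries.coeff i (gSeries q t) * PowerSeries.coeff (k - i) (gSeries q t)⁻¹) •
      gammaHalf K (2 * i - 2 * (k - i : ℕ))

/-- `ψ^+_n` for `n ∈ ℤ`, which is zero for `n < 0`. -/
def psipZ (K : Type*) [Field K] (n : ℤ) : FreeAlgebra K Gen :=
  if 0 ≤ n then gen K (Gen.psip n.toNat) else 0

/-- `ψ^-_n` for `n ∈ ℤ`, which is zero for `n > 0`. -/
def psimZ (K : Type*) [Field K] (n : ℤ) : FreeAlgebra K Gen :=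
  if n ≤ 0 then gen K (Gen.psim (-n).toNat) else 0

/-- The defining relations of `𝒰`, written in modes: each one is the coefficient of a monomial
`z^{-m} w^{-n}` in a relation between currents. -/
inductive Rel {K : Type*} [Field K] (q t : K) : FreeAlgebra K Gen → FreeAlgebra K Gen → Prop
  | gamma_mul : Rel q t (gen K Gen.gamma * gen K Gen.gammaInv) 1
  | gamma_mul' : Rel q t (gen K Gen.gammaInv * gen K Gen.gamma) 1
  | gamma_central (a : Gen) :
      Rel q t (gen K Gen.gamma * gen K a) (gen K a * gen K Gen.gamma)
  | psip_psip (m n : ℕ) :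
      Rel q t (gen K (Gen.psip m) * gen K (Gen.psip n)) (gen K (Gen.psip n) * gen K (Gen.psip m))
  | psim_psim (m n : ℕ) :
      Rel q t (gen K (Gen.psim m) * gen K (Gen.psim n)) (gen K (Gen.psim n) * gen K (Gen.psim m))
  /-- `ψ^+(z) ψ^-(w) = g(γ w/z) g(γ⁻¹ w/z)⁻¹ ψ^-(w) ψ^+(z)` -/
  | psip_psim (m n : ℕ) :
      Rel q t (gen K (Gen.psip m) * gen K (Gen.psim n))
        (∑ k ∈ range (min m n + 1),
          gRatio q t k * gen K (Gen.psim (n - k)) * gen K (Gen.psip (m - k)))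
  /-- `ψ^+(z) x^+(w) = g(γ^{-1/2} w/z)⁻¹ x^+(w) ψ^+(z)` -/
  | psip_xp (m : ℕ) (n : ℤ) :
      Rel q t (gen K (Gen.psip m) * gen K (Gen.xp n))
        (∑ k ∈ range (m + 1), PowerSeries.coeff k (gSeries q t)⁻¹ •
          (gammaHalf K (-k) * gen K (Gen.xp (n + k)) * gen K (Gen.psip (m - k))))
  /-- `ψ^+(z) x^-(w) = g(γ^{1/2} w/z) x^-(w) ψ^+(z)` -/
  | psip_xm (m : ℕ) (n : ℤ) :
      Rel q t (gen K (Gen.psip m) * gen K (Gen.xm n))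
        (∑ k ∈ range (m + 1), PowerSeries.coeff k (gSeries q t) •
          (gammaHalf K k * gen K (Gen.xm (n + k)) * gen K (Gen.psip (m - k))))
  /-- `ψ^-(z) x^+(w) = g(γ^{-1/2} z/w) x^+(w) ψ^-(z)` -/
  | psim_xp (m : ℕ) (n : ℤ) :
      Rel q t (gen K (Gen.psim m) * gen K (Gen.xp n))
        (∑ k ∈ range (m + 1), PowerSeries.coeff k (gSeries q t) •
          (gammaHalf K (-k) * gen K (Gen.xp (n - k)) * gen K (Gen.psim (m - k))))
  /-- `ψ^-(z) x^-(w) = g(γ^{1/2} z/w)⁻¹ x^-(w) ψ^-(z)` -/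
  | psim_xm (m : ℕ) (n : ℤ) :
      Rel q t (gen K (Gen.psim m) * gen K (Gen.xm n))
        (∑ k ∈ range (m + 1), PowerSeries.coeff k (gSeries q t)⁻¹ •
          (gammaHalf K k * gen K (Gen.xm (n - k)) * gen K (Gen.psim (m - k))))
  /-- `[x^+(z), x^-(w)] = (1-q)(1-1/t)/(1-q/t) ·
  (δ(γ⁻¹ z/w) ψ^+(γ^{1/2} w) - δ(γ z/w) ψ^-(γ^{-1/2} w))` -/
  | xp_xm (m n : ℤ) :
      Rel q t (gen K (Gen.xp m) * gen K (Gen.xm n) - gen K (Gen.xm n) * gen K (Gen.xp m))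
        (((1 - q) * (1 - 1 / t) / (1 - q / t)) •
          (gammaHalf K (m - n) * psipZ K (m + n) - gammaHalf K (n - m) * psimZ K (m + n)))
  /-- `G^-(z/w) x^+(z) x^+(w) = G^+(z/w) x^+(w) x^+(z)` -/
  | xp_xp (m n : ℤ) :
      Rel q t
        (∑ k ∈ range 4, PowerSeries.coeff k (GMinus q t) •
          (gen K (Gen.xp (m + k)) * gen K (Gen.xp (n - k))))
        (∑ k ∈ range 4, PowerSeries.coeff k (GPlus q t) •
          (gen K (Gen.xp (n - k)) * gen K (Gen.xp (m + k))))
  /-- `G^+(z/w) x^-(z) x^-(w) = G^-(z/w) x^-(w) x^-(z)` -/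
  | xm_xm (m n : ℤ) :
      Rel q t
        (∑ k ∈ range 4, PowerSeries.coeff k (GPlus q t) •
          (gen K (Gen.xm (m + k)) * gen K (Gen.xm (n - k))))
        (∑ k ∈ range 4, PowerSeries.coeff k (GMinus q t) •
          (gen K (Gen.xm (n - k)) * gen K (Gen.xm (m + k))))

/-- The algebra `𝒰`. -/
abbrev U {K : Type*} [Field K] (q t : K) : Type _ := RingQuot (Rel q t)

/-! ## Partitions

Rows and columns are numbered from `0`: the `i`-th part (`i ≥ 1`) of `lam` is
`lam.rowLen (i - 1)`, and `lam.colLen 0` is the length of `lam`. -/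

/-- `lam + 1_i`, if this is a partition. -/
def addBox (lam : YoungDiagram) (i : ℕ) : Option YoungDiagram :=
  open Classical in
  if h : IsLowerSet (↑(insert (i, lam.rowLen i) lam.cells) : Set (ℕ × ℕ)) then
    some ⟨insert (i, lam.rowLen i) lam.cells, h⟩
  else none

/-- `lam - 1_i`, if this is a partition. -/
def removeBox (lam : YoungDiagram) (i : ℕ) : Option YoungDiagram :=
  open Classical in
  if h : 0 < lam.rowLen i ∧
      IsLowerSet (↑(lam.cells.erase (i, lam.rowLen i - 1)) : Set (ℕ × ℕ)) then
    some ⟨lam.cells.erase (i, lam.rowLen i - 1), h.2⟩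
  else none

/-- The partitions that differ from `lam` by at most one box. -/
def neighbours (lam : YoungDiagram) : Finset YoungDiagram :=
  open Classical in
  insert lam (eraseNone ((range (lam.colLen 0 + 1)).image (addBox lam) ∪
    (range (lam.colLen 0)).image (removeBox lam)))

/-- `n(lam) = ∑_{i ≥ 1} (i - 1) lam_i` -/
def nStat (lam : YoungDiagram) : ℕ := ∑ i ∈ range (lam.colLen 0), i * lam.rowLen i

/-- arm length of a box `(i, j)` of `lam` -/
def arm (lam : YoungDiagram) (s : ℕ × ℕ) : ℕ := lam.rowLen s.1 - (s.2 + 1)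

/-- leg length of a box `(i, j)` of `lam` -/
def leg (lam : YoungDiagram) (s : ℕ × ℕ) : ℕ := lam.colLen s.2 - (s.1 + 1)

def cLam {K : Type*} [Field K] (q t : K) (lam : YoungDiagram) : K :=
  ∏ s ∈ lam.cells, (1 - q ^ arm lam s * t ^ (leg lam s + 1))

def cLam' {K : Type*} [Field K] (q t : K) (lam : YoungDiagram) : K :=
  ∏ s ∈ lam.cells, (1 - q ^ (arm lam s + 1) * t ^ leg lam s)

/-- The framing factor
`f_lam = (-1)^{|lam|} q^{n(lam') + |lam|/2} t^{-n(lam) - |lam|/2}`, where `q = q4^4`, `t = t4^4`. -/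
def framing {K : Type*} [Field K] (q4 t4 : K) (lam : YoungDiagram) : K :=
  (-1) ^ lam.card * q4 ^ (4 * nStat lam.transpose + 2 * lam.card) *
    (t4 ^ (4 * nStat lam + 2 * lam.card))⁻¹

/-! ## The vertical Fock module of level `(0,1)` -/

/-- The Fock space with its basis `(P_lam)` indexed by partitions: `Finsupp.single lam 1` is
`P_lam`. -/
abbrev VFock (K : Type*) [Field K] : Type _ := YoungDiagram →₀ K

/-- `P_mu` for a partition `mu`; zero for `none`. -/
def basisP (K : Type*) [Field K] : Option YoungDiagram → VFock K
  | none => 0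
  | some mu => Finsupp.single mu 1

/-- `A^+_{lam,i+1}` -/
def APlus {K : Type*} [Field K] (q t : K) (lam : YoungDiagram) (i : ℕ) : K :=
  (1 - t) * ∏ j ∈ range i,
    ((1 - q ^ ((lam.rowLen i : ℤ) - lam.rowLen j) * t ^ (-(i : ℤ) + j + 1)) *
      (1 - q ^ ((lam.rowLen i : ℤ) - lam.rowLen j + 1) * t ^ (-(i : ℤ) + j - 1))) /
    ((1 - q ^ ((lam.rowLen i : ℤ) - lam.rowLen j) * t ^ (-(i : ℤ) + j)) *
      (1 - q ^ ((lam.rowLen i : ℤ) - lam.rowLen j + 1) * t ^ (-(i : ℤ) + j)))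

/-- `A^-_{lam,i+1}`. The factors of the infinite product with `j` beyond the length of `lam` are
equal to one. -/
def AMinus {K : Type*} [Field K] (q t : K) (lam : YoungDiagram) (i : ℕ) : K :=
  (1 - t⁻¹) *
    ((1 - q ^ ((lam.rowLen (i + 1) : ℤ) - lam.rowLen i)) /
      (1 - q ^ ((lam.rowLen (i + 1) : ℤ) - lam.rowLen i + 1) * t⁻¹)) *
    ∏ j ∈ Ico (i + 1) (lam.colLen 0),
      ((1 - q ^ ((lam.rowLen j : ℤ) - lam.rowLen i + 1) * t ^ (-(j : ℤ) + i - 1)) *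
        (1 - q ^ ((lam.rowLen (j + 1) : ℤ) - lam.rowLen i) * t ^ (-(j : ℤ) + i))) /
      ((1 - q ^ ((lam.rowLen (j + 1) : ℤ) - lam.rowLen i + 1) * t ^ (-(j : ℤ) + i - 1)) *
        (1 - q ^ ((lam.rowLen j : ℤ) - lam.rowLen i) * t ^ (-(j : ℤ) + i)))

/-- The power series `1 - a z`. -/
def oneSub {K : Type*} [Field K] (a : K) : PowerSeries K :=
  1 - PowerSeries.C a * PowerSeries.X

/-- `B^+_lam(z)`. The factors of the infinite product beyond the length of `lam` are equal to
one. -/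
def BPlus {K : Type*} [Field K] (q t : K) (lam : YoungDiagram) : PowerSeries K :=
  oneSub (q ^ ((lam.rowLen 0 : ℤ) - 1) * t) * (oneSub (q ^ lam.rowLen 0))⁻¹ *
    ∏ i ∈ range (lam.colLen 0),
      (oneSub (q ^ lam.rowLen i * t ^ (-(i : ℤ) - 1)) *
        oneSub (q ^ ((lam.rowLen (i + 1) : ℤ) - 1) * t ^ (-(i : ℤ)))) *
      (oneSub (q ^ lam.rowLen (i + 1) * t ^ (-(i : ℤ) - 1)) *
        oneSub (q ^ ((lam.rowLen i : ℤ) - 1) * t ^ (-(i : ℤ))))⁻¹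

/-- `B^-_lam(z)`: every power of `q` and `t` in `B^+_lam(z)` is inverted. -/
def BMinus {K : Type*} [Field K] (q t : K) (lam : YoungDiagram) : PowerSeries K :=
  BPlus q⁻¹ t⁻¹ lam

/-- The action of the generators on the module of level `(0,1)` with spectral parameter `u`. The
coefficient of `z^{-n}` in `δ(a/z)` is `a^n`. -/
def vertical {K : Type*} [Field K] (q4 t4 u : K) : Gen → Module.End K (VFock K)
  | Gen.gamma => 1
  | Gen.gammaInv => 1
  | Gen.xp n => Finsupp.linearCombination K fun lam =>
      ∑ i ∈ range (lam.colLen 0 + 1),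
        (APlus (q4 ^ 4) (t4 ^ 4) lam i *
          ((q4 ^ 4) ^ lam.rowLen i * (t4 ^ 4) ^ (-(i : ℤ)) * u) ^ n) • basisP K (addBox lam i)
  | Gen.xm n => Finsupp.linearCombination K fun lam =>
      (q4 ^ 2 / t4 ^ 2) • ∑ i ∈ range (lam.colLen 0),
        (AMinus (q4 ^ 4) (t4 ^ 4) lam i *
          ((q4 ^ 4) ^ ((lam.rowLen i : ℤ) - 1) * (t4 ^ 4) ^ (-(i : ℤ)) * u) ^ n) •
            basisP K (removeBox lam i)
  | Gen.psip n => Finsupp.linearCombination K fun lam =>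
      (q4 ^ 2 / t4 ^ 2 * (PowerSeries.coeff n (BPlus (q4 ^ 4) (t4 ^ 4) lam) * u ^ n)) •
        basisP K (some lam)
  | Gen.psim n => Finsupp.linearCombination K fun lam =>
      (t4 ^ 2 / q4 ^ 2 * (PowerSeries.coeff n (BMinus (q4 ^ 4) (t4 ^ 4) lam) * u⁻¹ ^ n)) •
        basisP K (some lam)

/-! ## The horizontal Fock space and vertex operators -/

/-- The Fock space, identified with the symmetric functions: polynomials in the power sums
`p_n`, `n ≥ 1`. -/
abbrev Fock (K : Type*) [Field K] : Type _ := MvPolynomial ℕ+ K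

/-- The completion of the Fock space with respect to the degree (`deg p_n = n`): the product of
the homogeneous components, that is, the formal power series in the `p_n`. -/
abbrev FockHat (K : Type*) [Field K] : Type _ := MvPowerSeries ℕ+ K

/-- The element of the completed Fock space with coefficients `f`. -/
def ofCoeffs {K : Type*} [Field K] (f : (ℕ+ →₀ ℕ) → K) : FockHat K := f

/-- The linear map to the completed Fock space whose coefficients are given by `f`. -/
def ofCoeffsLin {K V : Type*} [Field K] [AddCommGroup V] [Module K V]
    (f : (ℕ+ →₀ ℕ) → V →ₗ[K] K) : V →ₗ[K] FockHat K where
  toFun x := ofCoeffs fun m => f m x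
  map_add' x y := funext fun m => map_add (f m) x y
  map_smul' r x := funext fun m => map_smul (f m) r x

/-- The degree of a monomial in the `p_n`. -/
def wt (m : ℕ+ →₀ ℕ) : ℕ := m.sum fun n e => (n : ℕ) * e

/-- The Heisenberg generators on the Fock space: `a_{-n} = p_n`,
`a_n = n (1 - q^n)/(1 - t^n) ∂/∂p_n` for `n > 0`, and `a_0 = 1`. -/
def heis {K : Type*} [Field K] (q t : K) : ℤ → Module.End K (Fock K)
  | Int.ofNat 0 => 1
  | Int.ofNat (n + 1) =>
      (((n + 1 : ℕ) : K) * ((1 - q ^ (n + 1)) / (1 - t ^ (n + 1)))) •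
        (MvPolynomial.pderiv n.succPNat : Derivation K (Fock K) (Fock K)).toLinearMap
  | Int.negSucc n => LinearMap.mulLeft K (MvPolynomial.X n.succPNat)

/-- The Heisenberg generators on the completed Fock space. -/
def heisHat {K : Type*} [Field K] (q t : K) : ℤ → Module.End K (FockHat K)
  | Int.ofNat 0 => 1
  | Int.ofNat (n + 1) =>
      (((n + 1 : ℕ) : K) * ((1 - q ^ (n + 1)) / (1 - t ^ (n + 1)))) •
        (MvPowerSeries.pderiv K n.succPNat : Derivation K (FockHat K) (FockHat K)).toLinearMap
  | Int.negSucc n => LinearMap.mulLeft K (MvPowerSeries.X n.succPNat)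

/-- The exponential `∑_r f^r / r!` of a power series `f` without constant term, with coefficients
in a possibly noncommutative `K`-algebra. -/
def expSeries (K : Type*) [Field K] {R : Type*} [Ring R] [Algebra K R] (f : PowerSeries R) :
    PowerSeries R :=
  PowerSeries.mk fun k =>
    ∑ r ∈ range (k + 1), ((r.factorial : K)⁻¹) • PowerSeries.coeff k (f ^ r)

/-- The series `exp (∑_{n ≥ 1} c_n a_{-n} s^n)` in a formal variable `s`. -/
def creation {K V : Type*} [Field K] [AddCommGroup V] [Module K V] (a : ℤ → Module.End K V)
    (c : ℕ → K) : PowerSeries (Module.End K V) :=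
  expSeries K (PowerSeries.mk fun n => if n = 0 then 0 else c n • a (-(n : ℤ)))

/-- The series `exp (∑_{n ≥ 1} d_n a_n s^n)` in a formal variable `s`. -/
def annihilation {K V : Type*} [Field K] [AddCommGroup V] [Module K V] (a : ℤ → Module.End K V)
    (d : ℕ → K) : PowerSeries (Module.End K V) :=
  expSeries K (PowerSeries.mk fun n => if n = 0 then 0 else d n • a n)

/-- The `k`-th coefficient of a power series for `k ∈ ℤ`, which is zero for `k < 0`. -/
def coeffZ {R : Type*} [Ring R] (k : ℤ) (f : PowerSeries R) : R :=
  if 0 ≤ k then PowerSeries.coeff k.toNat f else 0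

/-- A pair of sequences `(c, d)` stands for the normally ordered exponential
`exp (∑_{n ≥ 1} c_n a_{-n}) exp (∑_{n ≥ 1} d_n a_n)`, or for the current
`exp (∑_{n ≥ 1} c_n a_{-n} z^n) exp (∑_{n ≥ 1} d_n a_n z^{-n})`. The normally ordered product of
such operators corresponds to the sum of the pairs. The entries with index `0` are not used. -/
abbrev Exponents (K : Type*) [Field K] : Type _ := (ℕ → K) × (ℕ → K)

/-- The value of the current with exponents `e` at `z = x`. -/
def Exponents.evalAt {K : Type*} [Field K] (e : Exponents K) (x : K) : Exponents K :=
  (fun n => e.1 n * x ^ n, fun n => e.2 n * x⁻¹ ^ n)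

/-- The coefficient of `z^k` of the current with exponents `e`, as an operator on the Fock space.
On a monomial of degree `d`, the lowering terms of degree `j > d` vanish. -/
def modeF {K : Type*} [Field K] (q t : K) (e : Exponents K) (k : ℤ) : Module.End K (Fock K) :=
  (MvPolynomial.basisMonomials ℕ+ K).constr K fun m =>
    ∑ j ∈ range (wt m + 1),
      coeffZ (k + j) (creation (heis q t) e.1)
        (PowerSeries.coeff j (annihilation (heis q t) e.2) (MvPolynomial.monomial m 1))

/-- The coefficient of `z^k` of the current with exponents `e`, as an operator on the completed
Fock space. The raising terms of degree `i` only contribute to monomials of degree at least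
`i`. -/
def modeHat {K : Type*} [Field K] (q t : K) (e : Exponents K) (k : ℤ) :
    Module.End K (FockHat K) :=
  ofCoeffsLin fun m =>
    ∑ i ∈ range (wt m + 1),
      (MvPowerSeries.coeff m : FockHat K →ₗ[K] K) ∘ₗ
        (PowerSeries.coeff i (creation (heisHat q t) e.1)) ∘ₗ
          (coeffZ (i - k) (annihilation (heisHat q t) e.2))

/-- The normally ordered exponential with exponents `e`, as an operator from the Fock space to the
completed Fock space. -/
def normalExp {K : Type*} [Field K] (q t : K) (e : Exponents K) : Fock K →ₗ[K] FockHat K :=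
  (MvPolynomial.basisMonomials ℕ+ K).constr K fun m => ofCoeffs fun m' =>
    ∑ i ∈ range (wt m' + 1), ∑ j ∈ range (wt m + 1),
      MvPowerSeries.coeff m'
        (PowerSeries.coeff i (creation (heisHat q t) e.1)
          ((PowerSeries.coeff j (annihilation (heis q t) e.2)
            (MvPolynomial.monomial m 1) : Fock K) : FockHat K))

/-- `η(z)` -/
def eta {K : Type*} [Field K] (t4 : K) : Exponents K :=
  (fun n => (1 - (t4 ^ 4)⁻¹ ^ n) / n, fun n => -((1 - (t4 ^ 4) ^ n) / n))

/-- `ξ(z)`; here `q^{-n/2} t^{n/2} = (t4^2 / q4^2)^n`. -/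
def xi {K : Type*} [Field K] (q4 t4 : K) : Exponents K :=
  (fun n => -((1 - (t4 ^ 4)⁻¹ ^ n) / n * (t4 ^ 2 / q4 ^ 2) ^ n),
    fun n => (1 - (t4 ^ 4) ^ n) / n * (t4 ^ 2 / q4 ^ 2) ^ n)

/-- `φ^+(z)`; here `q^{n/4} t^{-n/4} = (q4 / t4)^n`. -/
def phiPlus {K : Type*} [Field K] (q4 t4 : K) : Exponents K :=
  (0, fun n => -((1 - (t4 ^ 4) ^ n) / n * (1 - (t4 ^ 4 / q4 ^ 4) ^ n) * (q4 / t4) ^ n))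

/-- `φ^-(z)` -/
def phiMinus {K : Type*} [Field K] (q4 t4 : K) : Exponents K :=
  (fun n => (1 - (t4 ^ 4)⁻¹ ^ n) / n * (1 - (t4 ^ 4 / q4 ^ 4) ^ n) * (q4 / t4) ^ n, 0)

/-- The action of the generators on the module of level `(1,N)` with spectral parameter `u`, in
terms of the modes of currents on `V` (the Fock space or its completion):
`x^+(z) = u z^{-N} q^{-N/2} t^{N/2} η(z)`, `x^-(z) = u⁻¹ z^N q^{N/2} t^{-N/2} ξ(z)`,
`ψ^+(z) = q^{N/2} t^{-N/2} φ^+(z)`, `ψ^-(z) = q^{-N/2} t^{N/2} φ^-(z)`. -/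
def horizontal {K V : Type*} [Field K] [AddCommGroup V] [Module K V]
    (mode : Exponents K → ℤ → Module.End K V) (q4 t4 : K) (N : ℤ) (u : K) :
    Gen → Module.End K V
  | Gen.gamma => (t4 / q4) • 1
  | Gen.gammaInv => (q4 / t4) • 1
  | Gen.xp n => (u * (t4 ^ 2 / q4 ^ 2) ^ N) • mode (eta t4) (N - n)
  | Gen.xm n => (u⁻¹ * (q4 ^ 2 / t4 ^ 2) ^ N) • mode (xi q4 t4) (-N - n)
  | Gen.psip n => ((q4 ^ 2 / t4 ^ 2) ^ N) • mode (phiPlus q4 t4) (-n)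
  | Gen.psim n => ((t4 ^ 2 / q4 ^ 2) ^ N) • mode (phiMinus q4 t4) n

/-! ## The completed tensor product and the coproduct -/

/-- The completion of (horizontal Fock space) `⊗` (vertical Fock space): the function `τ` stands
for the formal sum `∑_lam τ(lam) ⊗ P_lam`. -/
abbrev TensorHat (K : Type*) [Field K] : Type _ := YoungDiagram → FockHat K

/-- The operator `A ⊗ B` on the completed tensor product, for an operator `B` such that `B P_lam`
is a combination of `P_mu` with `mu` a neighbour of `lam` (which holds for all generators). -/
def tens {K : Type*} [Field K] (A : Module.End K (FockHat K)) (B : Module.End K (VFock K)) :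
    Module.End K (TensorHat K) :=
  LinearMap.pi fun mu : YoungDiagram =>
    ∑ lam ∈ neighbours mu, (B (Finsupp.single lam 1) mu) • (A ∘ₗ LinearMap.proj lam)

/-- The infinite sum `∑_{k ≥ 0} O_k` of operators on the completed tensor product, where `O_k`
with `k ≥ bound m` does not contribute to the coefficients of the monomial `m`. -/
def sumOp {K : Type*} [Field K] (bound : (ℕ+ →₀ ℕ) → ℕ)
    (O : ℕ → Module.End K (TensorHat K)) : Module.End K (TensorHat K) :=
  LinearMap.pi fun mu : YoungDiagram => ofCoeffsLin fun m =>
    ∑ k ∈ range (bound m),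
      (MvPowerSeries.coeff m : FockHat K →ₗ[K] K) ∘ₗ (LinearMap.proj mu) ∘ₗ (O k)

/-- The action of the generators, through the coproduct
`Δ(γ^{±1/2}) = γ^{±1/2} ⊗ γ^{±1/2}`,
`Δ(x^+(z)) = x^+(z) ⊗ 1 + ψ^-(γ₁^{1/2} z) ⊗ x^+(γ₁ z)`,
`Δ(x^-(z)) = x^-(γ₂ z) ⊗ ψ^+(γ₂^{1/2} z) + 1 ⊗ x^-(z)`,
`Δ(ψ^±(z)) = ψ^±(γ₂^{±1/2} z) ⊗ ψ^±(γ₁^{∓1/2} z)`,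
on the completed tensor product of the module of level `(1,N)` with spectral parameter `v` and the
module of level `(0,1)` with spectral parameter `u`. Here `γ^{1/2}` is the scalar `t4/q4` on the
first factor and `1` on the second. The operator `ψ^-_{-k}` raises the degree by `k`, and
`x^-_{n-k}` raises it by `k - n - N`. -/
def coproductAction {K : Type*} [Field K] (q4 t4 : K) (N : ℤ) (v u : K) :
    Gen → Module.End K (TensorHat K) :=
  let H : Gen → Module.End K (FockHat K) := horizontal (modeHat (q4 ^ 4) (t4 ^ 4)) q4 t4 N v
  let W : Gen → Module.End K (VFock K) := vertical q4 t4 u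
  fun
  | Gen.gamma => tens (H Gen.gamma) (W Gen.gamma)
  | Gen.gammaInv => tens (H Gen.gammaInv) (W Gen.gammaInv)
  | Gen.xp n => tens (H (Gen.xp n)) 1 +
      sumOp (fun m => wt m + 1) fun k =>
        ((t4 / q4) ^ (-2 * n - k : ℤ)) • tens (H (Gen.psim k)) (W (Gen.xp (n + k)))
  | Gen.xm n =>
      sumOp (fun m => (wt m + n + N + 1 : ℤ).toNat)
        (fun k => tens (H (Gen.xm (n - k))) (W (Gen.psip k))) +
      tens 1 (W (Gen.xm n))
  | Gen.psip n => ∑ k ∈ range (n + 1),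
      ((t4 / q4) ^ k) • tens (H (Gen.psip (n - k))) (W (Gen.psip k))
  | Gen.psim n => ∑ k ∈ range (n + 1),
      ((t4 / q4) ^ k) • tens (H (Gen.psim (n - k))) (W (Gen.psim k))

/-! ## The dual intertwiner -/

/-- `Φ` from the module of level `(1,N+1)` with parameter `w` to the completed tensor product of
the module of level `(1,N)` with parameter `v` and the module of level `(0,1)` with parameter `u`
satisfies `Δ(a) Φ = Φ a` for all `a ∈ 𝒰`; an element of `𝒰` acts as any of its expressions
`x` in the generators. -/
def IsDualIntertwiner {K : Type*} [Field K] (q4 t4 : K) (N : ℤ) (u v w : K)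
    (Phi : Fock K →ₗ[K] TensorHat K) : Prop :=
  ∀ (a : U (q4 ^ 4) (t4 ^ 4)) (x : FreeAlgebra K Gen),
    RingQuot.mkAlgHom K (Rel (q4 ^ 4) (t4 ^ 4)) x = a →
    ∀ alpha : Fock K,
      FreeAlgebra.lift K (coproductAction q4 t4 N v u) x (Phi alpha) =
        Phi (FreeAlgebra.lift K
          (horizontal (modeF (q4 ^ 4) (t4 ^ 4)) q4 t4 (N + 1) w) x alpha)

/-- The component `Φ_lam` in `Φ(α) = ∑_lam Φ_lam(α) ⊗ Q_lam`, where
`Q_lam = (c_lam / c'_lam) P_lam`. -/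
def component {K : Type*} [Field K] (q4 t4 : K) (Phi : Fock K →ₗ[K] TensorHat K)
    (lam : YoungDiagram) : Fock K →ₗ[K] FockHat K :=
  (cLam' (q4 ^ 4) (t4 ^ 4) lam / cLam (q4 ^ 4) (t4 ^ 4) lam) • (LinearMap.proj lam ∘ₗ Phi)

/-- A dual intertwiner with `Φ_∅(1) = 1 + (terms of positive degree)`. -/
def IsNormalizedDualIntertwiner {K : Type*} [Field K] (q4 t4 : K) (N : ℤ) (u v w : K)
    (Phi : Fock K →ₗ[K] TensorHat K) : Prop :=
  IsDualIntertwiner q4 t4 N u v w Phi ∧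
    MvPowerSeries.constantCoeff (component q4 t4 Phi ⊥ (1 : Fock K)) = 1

/-- The exponents of `Φ̃*_∅(u)`. -/
def phiStarEmpty {K : Type*} [Field K] (q4 t4 u : K) : Exponents K :=
  (fun n => 1 / n * (1 / (1 - (q4 ^ 4) ^ n)) * (t4 ^ 2 / q4 ^ 2) ^ n * u ^ n,
    fun n => 1 / n * ((q4 ^ 4) ^ n / (1 - (q4 ^ 4) ^ n)) * (t4 ^ 2 / q4 ^ 2) ^ n * u⁻¹ ^ n)

/-- The exponents of `ξ_lam(u) = :∏_{(i,j) ∈ lam} ξ(q^{j-1} t^{-i+1} u):`. -/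
def xiLam {K : Type*} [Field K] (q4 t4 u : K) (lam : YoungDiagram) : Exponents K :=
  ∑ s ∈ lam.cells, (xi q4 t4).evalAt ((q4 ^ 4) ^ s.2 * (t4 ^ 4)⁻¹ ^ s.1 * u)

/-- `Φ̃*_lam(u) = (q^{n(lam')} / c_lam) :Φ̃*_∅(u) ξ_lam(u):` -/
def phiStarTilde {K : Type*} [Field K] (q4 t4 u : K) (lam : YoungDiagram) :
    Fock K →ₗ[K] FockHat K :=
  ((q4 ^ 4) ^ nStat lam.transpose / cLam (q4 ^ 4) (t4 ^ 4) lam) •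
    normalExp (q4 ^ 4) (t4 ^ 4) (phiStarEmpty q4 t4 u + xiLam q4 t4 u lam)

/-- `t*(lam,u,v,N) = (q⁻¹ v)^{-|lam|} (-u)^{N |lam|} f_lam^N` -/
def tStar {K : Type*} [Field K] (q4 t4 u v : K) (N : ℤ) (lam : YoungDiagram) : K :=
  ((q4 ^ 4)⁻¹ * v) ^ (-(lam.card : ℤ)) * (-u) ^ (N * lam.card) * framing q4 t4 lam ^ N

end

end Toroidal

/-! Every operator involved is a vertex operator, and such an operator is determined by its
commutators with the Heisenberg modes together with its vacuum expectation values: a family of maps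
from the Fock space to its completion that has prescribed commutators with all a_n and vanishing
constants ⟨X_k 1⟩ is zero (`IsVertex.eq_zero`). Each intertwining relation therefore reduces to an
identity between scalar series, the contractions (`vev_modeHat_normalExp`, `vev_normalExp_modeF`).

These contractions are rational functions. Number rows from 0 and put a_k = q^{λ_k} t^{-k}, b_k =
a_k / t. A geometric summation over the boxes (`boxSum_eq`) turns the exponents of Φ*_λ into
differences of power sums of the a_k and the b_k. Hence the contraction with η is Y(x) = ∏(1 - a_k
x) / ∏(1 - b_k x), the contraction with ξ is 1/Y, and ψ^+ acts on P_λ, up to a constant, through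
Y(tx/q) / Y(x) (`BPlus_eq`). The ψ^± relations become cancellations. For x^±, the products of a
current with Φ*_λ in the two orders are, up to a monomial, the expansions of one rational function
at 0 and at ∞, and these differ by delta functions supported at the poles, which are the corners of
λ (`ySeries_delta`, `yInv_delta`). Since ∏ a_k = ∏ b_k, the function Y behaves like -x at infinity;
this one sign and this one power of x are the source of w = -vu and of the step from N to N + 1.

The delta terms agree with the terms of the coproduct that add or remove boxes. First, φ^-(γ^{-1/2}
y) = :η(γ^{-1} y) ξ(y): (`phiMinus_evalAt`), and multiplication by ξ(y) at the content of a box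
passes from Φ*_λ to Φ*_μ. Secondly, up to a sign and a power of q, the residues are the matrix
coefficients A^± multiplied by a ratio of hook products c' (`IsAdd.APlus_mul`, `IsAdd.AMinus_mul`).
The remaining monomials are absorbed by the prefactor of Φ*_λ (`IsAdd.intertwinerCoeff_mul`).

For uniqueness, taking logarithms of the ψ^± relations yields the commutators of each component with
the Heisenberg modes (`IsDualIntertwiner.heisHat_pos`, `IsDualIntertwiner.heisHat_neg`). So the
normalization fixes the component at ∅. No box can be removed from ∅, whence the relation for one
mode of x^+ there forces w = -vu. The relations for x^- determine the components at the partitions λ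
+ 1_i from the component at λ, by a Vandermonde argument on the distinct positions of the rows
(`eq_zero_of_apply_bot`). -/

namespace Toroidal

noncomputable section

set_option linter.unusedSectionVars false

open Finset

/-! ### Exponentials of power series with noncommuting coefficients. -/

section ExpSeries

variable {K R : Type*} [Field K] [CharZero K] [Ring R] [Algebra K R]

theorem coeff_pow_eq_zero {f : PowerSeries R} (h0 : PowerSeries.coeff 0 f = 0) :
    ∀ {r k : ℕ}, k < r → PowerSeries.coeff k (f ^ r) = 0
  | 0, _, h => absurd h (Nat.not_lt_zero _)
  | r + 1, k, h => by
    rw [pow_succ, PowerSeries.coeff_mul]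
    refine sum_eq_zero fun p hp => ?_
    rw [HasAntidiagonal.mem_antidiagonal] at hp
    rcases lt_or_ge p.1 r with h1 | h1
    · rw [coeff_pow_eq_zero h0 h1, zero_mul]
    · rw [show p.2 = 0 by omega, h0, mul_zero]

/-- The power `f ^ r` has order at least `r`, so the truncation in `expSeries` may be replaced by
any larger one; sums with different truncations then become comparable. -/
theorem coeff_expSeries {f : PowerSeries R} (h0 : PowerSeries.coeff 0 f = 0) {k B : ℕ}
    (hB : k < B) : PowerSeries.coeff k (expSeries K f) =
      ∑ r ∈ range B, ((r.factorial : K)⁻¹) • PowerSeries.coeff k (f ^ r) := by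
  rw [expSeries, PowerSeries.coeff_mk]
  refine sum_subset (range_subset_range.2 hB) fun r _ hr => ?_
  rw [coeff_pow_eq_zero h0 (by simpa using hr), smul_zero]

theorem expSeries_coeff_zero (f : PowerSeries R) : PowerSeries.coeff 0 (expSeries K f) = 1 := by
  simp [expSeries]

theorem coeff_smul' (a : K) (f : PowerSeries R) (k : ℕ) :
    PowerSeries.coeff k (a • f) = a • PowerSeries.coeff k f := rfl

/-- The commutator of `x` and `f` is a scalar multiple of a power of the formal variable, hence
central, so taking commutators with `x` acts on powers of `f` as a derivation. -/
theorem lie_pow {f : PowerSeries R} {x : R} {a : K} {n : ℕ}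
    (h : PowerSeries.C x * f - f * PowerSeries.C x = a • PowerSeries.X ^ n) (r : ℕ) :
    PowerSeries.C x * f ^ (r + 1) - f ^ (r + 1) * PowerSeries.C x =
      ((r + 1 : K) * a) • (PowerSeries.X ^ n * f ^ r) := by
  induction r with
  | zero => simpa using h
  | succ r ih =>
    have hX : f * PowerSeries.X ^ n = PowerSeries.X ^ n * f :=
      ((PowerSeries.commute_X f).pow_right n).eq
    have e : PowerSeries.C x * f ^ (r + 1 + 1) - f ^ (r + 1 + 1) * PowerSeries.C x =
        (PowerSeries.C x * f - f * PowerSeries.C x) * f ^ (r + 1) +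
          f * (PowerSeries.C x * f ^ (r + 1) - f ^ (r + 1) * PowerSeries.C x) := by
      rw [pow_succ' f (r + 1)]; noncomm_ring
    rw [e, h, ih, smul_mul_assoc, mul_smul_comm, ← mul_assoc f, hX, mul_assoc, ← pow_succ',
      ← add_smul]
    push_cast
    ring_nf

/-- If `f` has scalar commutator `a s^n` with `x`, then `[x, exp f] = a s^n exp f`. -/
theorem lie_expSeries {f : PowerSeries R} (h0 : PowerSeries.coeff 0 f = 0) {x : R} {a : K} {n : ℕ}
    (hn : 0 < n)
    (h : ∀ m, x * PowerSeries.coeff m f - PowerSeries.coeff m f * x =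
      if m = n then a • (1 : R) else 0) (k : ℕ) :
    x * PowerSeries.coeff k (expSeries K f) - PowerSeries.coeff k (expSeries K f) * x =
      if n ≤ k then a • PowerSeries.coeff (k - n) (expSeries K f) else 0 := by
  have h' : PowerSeries.C x * f - f * PowerSeries.C x = a • PowerSeries.X ^ n := by
    ext m
    rw [map_sub, PowerSeries.coeff_C_mul, PowerSeries.coeff_mul_C, h, coeff_smul',
      PowerSeries.coeff_X_pow]
    split_ifs <;> simp
  have key : ∀ r : ℕ, x * PowerSeries.coeff k (f ^ (r + 1)) - PowerSeries.coeff k (f ^ (r + 1)) * x =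
      ((r + 1 : K) * a) • (if n ≤ k then PowerSeries.coeff (k - n) (f ^ r) else 0) := by
    intro r
    rw [← PowerSeries.coeff_C_mul, ← PowerSeries.coeff_mul_C, ← map_sub, lie_pow h', coeff_smul',
      PowerSeries.coeff_X_pow_mul']
  rw [coeff_expSeries h0 (show k < k + 1 + 1 by omega), mul_sum, sum_mul, ← sum_sub_distrib,
    sum_range_succ']
  simp_rw [mul_smul_comm, smul_mul_assoc, ← smul_sub]
  rw [show x * PowerSeries.coeff k (f ^ 0) - PowerSeries.coeff k (f ^ 0) * x = 0 by
    rw [pow_zero, PowerSeries.coeff_one]; split_ifs <;> simp, smul_zero, add_zero]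
  simp_rw [key]
  split_ifs with hk
  · rw [coeff_expSeries h0 (show k - n < k + 1 by omega), smul_sum]
    refine sum_congr rfl fun r _ => ?_
    rw [smul_smul, smul_smul]
    congr 1
    rw [Nat.factorial_succ]
    have : (r.factorial : K) ≠ 0 := Nat.cast_ne_zero.2 r.factorial_ne_zero
    have : (r + 1 : K) ≠ 0 := by exact_mod_cast r.succ_ne_zero
    push_cast
    field_simp
  · simp

/-- On a joint eigenvector the exponential can be computed with scalars. It is applied to the image
of the vacuum under a normally ordered exponential, an eigenvector of every a_n with n > 0. -/
theorem expSeries_apply_eigen {V : Type*} [AddCommGroup V] [Module K V]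
    {f : PowerSeries (Module.End K V)} {l : PowerSeries K} {v : V}
    (h : ∀ m, PowerSeries.coeff m f v = PowerSeries.coeff m l • v) (k : ℕ) :
    PowerSeries.coeff k (expSeries K f) v = PowerSeries.coeff k (expSeries K l) • v := by
  have key : ∀ r k : ℕ, PowerSeries.coeff k (f ^ r) v = PowerSeries.coeff k (l ^ r) • v := by
    intro r
    induction r with
    | zero =>
      intro k
      rw [pow_zero, pow_zero, PowerSeries.coeff_one, PowerSeries.coeff_one]
      split_ifs <;> simp
    | succ r ih =>
      intro k
      rw [pow_succ, pow_succ, PowerSeries.coeff_mul, PowerSeries.coeff_mul, sum_smul,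
        LinearMap.sum_apply]
      refine sum_congr rfl fun p _ => ?_
      rw [Module.End.mul_apply, h, map_smul, ih, smul_smul, mul_comm]
  rw [expSeries, expSeries, PowerSeries.coeff_mk, PowerSeries.coeff_mk, LinearMap.sum_apply,
    sum_smul]
  refine sum_congr rfl fun r _ => ?_
  rw [LinearMap.smul_apply, key, smul_eq_mul, smul_smul]

/-- The transpose of `expSeries_apply_eigen`: the constant term after a normally ordered exponential
is an eigenfunctional for every a_{-n}. -/
theorem expSeries_comp_eigen {V W : Type*} [AddCommGroup V] [Module K V] [AddCommGroup W]
    [Module K W] {f : PowerSeries (Module.End K V)} {l : PowerSeries K} {φ : V →ₗ[K] W}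
    (h : ∀ m v, φ (PowerSeries.coeff m f v) = PowerSeries.coeff m l • φ v) (k : ℕ) (v : V) :
    φ (PowerSeries.coeff k (expSeries K f) v) = PowerSeries.coeff k (expSeries K l) • φ v := by
  have key : ∀ (r k : ℕ) v, φ (PowerSeries.coeff k (f ^ r) v) = PowerSeries.coeff k (l ^ r) • φ v := by
    intro r
    induction r with
    | zero =>
      intro k v
      rw [pow_zero, pow_zero, PowerSeries.coeff_one, PowerSeries.coeff_one]
      split_ifs <;> simp
    | succ r ih =>
      intro k v
      rw [pow_succ, pow_succ, PowerSeries.coeff_mul, PowerSeries.coeff_mul, sum_smul,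
        LinearMap.sum_apply, map_sum]
      refine sum_congr rfl fun p _ => ?_
      rw [Module.End.mul_apply, ih, h, smul_smul]
  rw [expSeries, expSeries, PowerSeries.coeff_mk, PowerSeries.coeff_mk, LinearMap.sum_apply,
    sum_smul, map_sum]
  refine sum_congr rfl fun r _ => ?_
  rw [LinearMap.smul_apply, map_smul, key, smul_eq_mul, smul_smul]

/-- The Euler derivation `s d/ds`. -/
def euler (f : PowerSeries R) : PowerSeries R := PowerSeries.mk fun k => k • PowerSeries.coeff k f

theorem coeff_euler (f : PowerSeries R) (k : ℕ) :
    PowerSeries.coeff k (euler f) = k • PowerSeries.coeff k f := PowerSeries.coeff_mk _ _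

theorem euler_add (f g : PowerSeries R) : euler (f + g) = euler f + euler g := by
  ext k; simp [coeff_euler]

theorem euler_mul (f g : PowerSeries R) : euler (f * g) = euler f * g + f * euler g := by
  ext k
  rw [coeff_euler, map_add, PowerSeries.coeff_mul, PowerSeries.coeff_mul, PowerSeries.coeff_mul,
    smul_sum, ← sum_add_distrib]
  refine sum_congr rfl fun p hp => ?_
  rw [HasAntidiagonal.mem_antidiagonal] at hp
  rw [coeff_euler, coeff_euler, ← hp, add_smul, smul_mul_assoc, mul_smul_comm]

/-- It suffices that `f` commutes with its own derivative, so that exponents with operator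
coefficients are covered. -/
theorem euler_pow {f : PowerSeries R} (h : f * euler f = euler f * f) (r : ℕ) :
    euler (f ^ (r + 1)) = (r + 1) • (euler f * f ^ r) := by
  induction r with
  | zero => simp
  | succ r ih =>
    rw [pow_succ' f (r + 1), euler_mul, ih, mul_smul_comm, ← mul_assoc f, h, mul_assoc,
      ← pow_succ', ← succ_nsmul']

theorem euler_expSeries {f : PowerSeries R} (h0 : PowerSeries.coeff 0 f = 0)
    (h : f * euler f = euler f * f) :
    euler (expSeries K f) = euler f * expSeries K f := by
  ext k
  rw [coeff_euler, coeff_expSeries h0 (show k < k + 1 + 1 by omega), smul_sum, sum_range_succ',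
    PowerSeries.coeff_mul]
  have h2 : ∀ p ∈ antidiagonal k, PowerSeries.coeff p.1 (euler f) *
      PowerSeries.coeff p.2 (expSeries K f) = ∑ r ∈ range (k + 1), ((r.factorial : K)⁻¹) •
        (PowerSeries.coeff p.1 (euler f) * PowerSeries.coeff p.2 (f ^ r)) := by
    intro p hp
    rw [HasAntidiagonal.mem_antidiagonal] at hp
    rw [coeff_expSeries h0 (show p.2 < k + 1 by omega), mul_sum]
    exact sum_congr rfl fun r _ => mul_smul_comm _ _ _
  rw [sum_congr rfl h2, sum_comm, pow_zero, PowerSeries.coeff_one]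
  rw [show k • (((Nat.factorial 0 : K)⁻¹) • if k = 0 then (1 : R) else 0) = 0 by
    split_ifs with hk <;> simp [hk], add_zero]
  refine sum_congr rfl fun r _ => ?_
  rw [← smul_sum, ← PowerSeries.coeff_mul, smul_comm, ← coeff_euler, euler_pow h, map_nsmul,
    ← Nat.cast_smul_eq_nsmul K, smul_smul, Nat.factorial_succ]
  congr 1
  have : (r.factorial : K) ≠ 0 := Nat.cast_ne_zero.2 r.factorial_ne_zero
  have : (r + 1 : K) ≠ 0 := by exact_mod_cast r.succ_ne_zero
  push_cast
  field_simp

/-- As `g` has no constant term, the equation expresses k E_k through earlier coefficients, and k is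
invertible in characteristic 0. Identities between exponentials are proved by checking this
first-order equation for both sides. -/
theorem euler_ode_unique (K : Type*) {R : Type*} [Field K] [CharZero K] [Ring R] [Algebra K R]
    {g E E' : PowerSeries R} (hg : PowerSeries.coeff 0 g = 0)
    (h : euler E = g * E) (h' : euler E' = g * E')
    (h0 : PowerSeries.coeff 0 E = PowerSeries.coeff 0 E') : E = E' := by
  ext k
  induction k using Nat.strong_induction_on with
  | _ k ih =>
    rcases Nat.eq_zero_or_pos k with rfl | hk
    · exact h0
    have hk' : (k : K) ≠ 0 := Nat.cast_ne_zero.2 hk.ne'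
    have e : (k : K) • PowerSeries.coeff k E = (k : K) • PowerSeries.coeff k E' := by
      rw [Nat.cast_smul_eq_nsmul, Nat.cast_smul_eq_nsmul, ← coeff_euler, ← coeff_euler, h, h',
        PowerSeries.coeff_mul, PowerSeries.coeff_mul]
      refine sum_congr rfl fun p hp => ?_
      rw [HasAntidiagonal.mem_antidiagonal] at hp
      rcases Nat.eq_zero_or_pos p.1 with h1 | h1
      · rw [h1, hg, zero_mul, zero_mul]
      · rw [ih p.2 (by omega)]
    simpa [smul_smul, hk'] using congrArg (fun x => (k : K)⁻¹ • x) e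

end ExpSeries

/-! ### Exponentials and logarithms of scalar series. -/

section Scalar

variable {K : Type*} [Field K] [CharZero K]

/-- Both sides solve the first-order equation with coefficient `euler f + euler g` and have constant
term 1. -/
theorem expSeries_add {f g : PowerSeries K} (hf : PowerSeries.coeff 0 f = 0)
    (hg : PowerSeries.coeff 0 g = 0) :
    expSeries K (f + g) = expSeries K f * expSeries K g := by
  refine euler_ode_unique K (g := euler f + euler g)
    (by rw [map_add, coeff_euler, coeff_euler, zero_smul, zero_smul, add_zero]) ?_ ?_ ?_
  · rw [euler_expSeries (by rw [map_add, hf, hg, add_zero]) (mul_comm _ _), euler_add]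
  · rw [euler_mul, euler_expSeries hf (mul_comm _ _), euler_expSeries hg (mul_comm _ _)]
    ring
  · rw [expSeries_coeff_zero, PowerSeries.coeff_mul]
    simp only [HasAntidiagonal.antidiagonal_zero, sum_singleton, expSeries_coeff_zero, mul_one]

theorem expSeries_zero {R : Type*} [Ring R] [Algebra K R] :
    expSeries K (0 : PowerSeries R) = 1 := by
  refine euler_ode_unique K (g := 0) (by simp) ?_ ?_ ?_
  · rw [euler_expSeries (by simp) (by simp), show euler (0 : PowerSeries R) = 0 by
      ext k; simp [coeff_euler]]
  · ext k
    by_cases hk : k = 0 <;> simp [coeff_euler, PowerSeries.coeff_one, hk]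
  · simp [expSeries_coeff_zero]

/-- `∑_{n ≥ 1} a^n s^n / n = - log (1 - a s)` -/
def negLog (a : K) : PowerSeries K := PowerSeries.mk fun n => if n = 0 then 0 else a ^ n / n

theorem coeff_negLog (a : K) (n : ℕ) :
    PowerSeries.coeff n (negLog a) = if n = 0 then 0 else a ^ n / n := PowerSeries.coeff_mk _ _

theorem constantCoeff_oneSub (a : K) : PowerSeries.constantCoeff (oneSub a) = 1 := by
  simp [oneSub]

theorem oneSub_mul_inv (a : K) : oneSub a * (oneSub a)⁻¹ = 1 :=
  PowerSeries.mul_inv_cancel _ (by simp [constantCoeff_oneSub])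

theorem oneSub_inv (a : K) : (oneSub a)⁻¹ = PowerSeries.mk fun n => a ^ n := by
  rw [eq_comm, PowerSeries.eq_inv_iff_mul_eq_one (by simp [constantCoeff_oneSub])]
  ext k
  rw [oneSub, mul_sub, mul_one, ← mul_assoc, map_sub, PowerSeries.coeff_mk, PowerSeries.coeff_one]
  cases k with
  | zero => simp
  | succ k =>
    rw [PowerSeries.coeff_succ_mul_X, PowerSeries.coeff_mul_C, PowerSeries.coeff_mk]
    simp [pow_succ]

theorem expSeries_negLog (a : K) : expSeries K (negLog a) = (oneSub a)⁻¹ := by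
  refine euler_ode_unique K (g := euler (negLog a)) (by simp [coeff_euler])
    (euler_expSeries (by simp [coeff_negLog]) (mul_comm _ _)) ?_ ?_
  · rw [oneSub_inv]
    ext k
    rw [PowerSeries.coeff_mul, coeff_euler, PowerSeries.coeff_mk, Nat.sum_antidiagonal_eq_sum_range_succ
      (fun i j => PowerSeries.coeff i (euler (negLog a)) * PowerSeries.coeff j (PowerSeries.mk fun n => a ^ n)),
      sum_range_succ']
    rw [coeff_euler, zero_smul, zero_mul, add_zero]
    -- The factor i + 1 from `euler` cancels the denominator of the logarithm, so each of the k
    -- remaining terms equals a^{i+1} a^{k-i-1} = a^k.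
    rw [sum_congr rfl (g := fun _ => a ^ k)]
    · simp
    · intro i hi
      rw [mem_range] at hi
      have : ((i : K) + 1) ≠ 0 := by exact_mod_cast i.succ_ne_zero
      rw [coeff_euler, coeff_negLog, PowerSeries.coeff_mk, if_neg i.succ_ne_zero, nsmul_eq_mul]
      push_cast
      rw [mul_div_cancel₀ _ this, ← pow_add]
      congr 1; omega
  · rw [expSeries_coeff_zero, oneSub_inv, PowerSeries.coeff_mk, pow_zero]

theorem expSeries_neg_negLog (a : K) : expSeries K (-negLog a) = oneSub a := by
  have h0 : PowerSeries.coeff 0 (negLog a) = 0 := by rw [coeff_negLog, if_pos rfl]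
  have h := expSeries_add (f := -negLog a) (g := negLog a) (by rw [map_neg, h0, neg_zero]) h0
  rw [neg_add_cancel, expSeries_zero, expSeries_negLog] at h
  have := congrArg (· * oneSub a) h
  simp only [one_mul, mul_assoc] at this
  rw [mul_comm (oneSub a)⁻¹, oneSub_mul_inv, mul_one] at this
  exact this.symm

end Scalar

theorem coeffZ_natCast {R : Type*} [Ring R] (k : ℕ) (f : PowerSeries R) :
    coeffZ (k : ℤ) f = PowerSeries.coeff k f := by
  simp [coeffZ]

theorem coeffZ_of_neg {R : Type*} [Ring R] {k : ℤ} (hk : k < 0) (f : PowerSeries R) :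
    coeffZ k f = 0 := if_neg (by omega)

/-! ### Commutators of Heisenberg generators with creating and annihilating exponentials. -/

section Abstract

variable {K : Type*} [Field K] [CharZero K]

/-- The value `κ_n` of the commutator `[a_n, a_{-n}]`. -/
def kap (q t : K) (n : ℕ) : K := (n : K) * ((1 - q ^ n) / (1 - t ^ n))

variable {V : Type*} [AddCommGroup V] [Module K V]

/-- The operators `a_n`, `n ≠ 0`, satisfy the relations of the Heisenberg algebra. -/
structure IsHeis (q t : K) (a : ℤ → Module.End K V) : Prop where
  pos (m n : ℕ+) : a m * a n = a n * a m
  neg (m n : ℕ+) : a (-m) * a (-n) = a (-n) * a (-m)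
  lie (m n : ℕ+) : a m * a (-n) - a (-n) * a m = if n = m then kap q t m • 1 else 0

/-- The coefficients of `exp (∑ c_n a_{-n} s^n)`. -/
def cre (a : ℤ → Module.End K V) (c : ℕ → K) (k : ℤ) : Module.End K V := coeffZ k (creation a c)

/-- The coefficients of `exp (∑ d_n a_n s^n)`. -/
def ann (a : ℤ → Module.End K V) (d : ℕ → K) (k : ℤ) : Module.End K V :=
  coeffZ k (annihilation a d)

theorem cre_natCast (a : ℤ → Module.End K V) (c : ℕ → K) (k : ℕ) :
    cre a c k = PowerSeries.coeff k (creation a c) := coeffZ_natCast _ _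

theorem ann_natCast (a : ℤ → Module.End K V) (c : ℕ → K) (k : ℕ) :
    ann a c k = PowerSeries.coeff k (annihilation a c) := coeffZ_natCast _ _

theorem cre_of_neg (a : ℤ → Module.End K V) (c : ℕ → K) {k : ℤ} (hk : k < 0) : cre a c k = 0 :=
  coeffZ_of_neg hk _

theorem ann_of_neg (a : ℤ → Module.End K V) (c : ℕ → K) {k : ℤ} (hk : k < 0) : ann a c k = 0 :=
  coeffZ_of_neg hk _

theorem cre_zero (a : ℤ → Module.End K V) (c : ℕ → K) : cre a c 0 = 1 := by
  rw [← Nat.cast_zero, cre_natCast]; exact expSeries_coeff_zero _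

theorem ann_zero (a : ℤ → Module.End K V) (c : ℕ → K) : ann a c 0 = 1 := by
  rw [← Nat.cast_zero, ann_natCast]; exact expSeries_coeff_zero _

/-- With integer indices the case distinction n ≤ k of `lie_expSeries` disappears, since
coefficients of negative index are zero. -/
theorem lie_coeffZ_expSeries {f : PowerSeries (Module.End K V)} (h0 : PowerSeries.coeff 0 f = 0)
    {x : Module.End K V} {a : K} (n : ℕ+)
    (h : ∀ m : ℕ+, x * PowerSeries.coeff m f - PowerSeries.coeff m f * x =
      if m = n then a • (1 : Module.End K V) else 0) (k : ℤ) :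
    x * coeffZ k (expSeries K f) - coeffZ k (expSeries K f) * x =
      a • coeffZ (k - n) (expSeries K f) := by
  have h' : ∀ m : ℕ, x * PowerSeries.coeff m f - PowerSeries.coeff m f * x =
      if m = n then a • (1 : Module.End K V) else 0 := by
    intro m
    rcases Nat.eq_zero_or_pos m with rfl | hm
    · rw [h0, mul_zero, zero_mul, sub_zero, if_neg n.pos.ne]
    · lift m to ℕ+ using hm
      simpa only [PNat.coe_inj] using h m
  rcases lt_or_ge k 0 with hk | hk
  · rw [coeffZ_of_neg hk, coeffZ_of_neg (by have := n.pos; omega), mul_zero, zero_mul, sub_zero,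
      smul_zero]
  · lift k to ℕ using hk
    rw [coeffZ_natCast, lie_expSeries h0 n.pos h']
    split_ifs with hk
    · rw [← coeffZ_natCast, Nat.cast_sub hk]
    · rw [coeffZ_of_neg (by omega), smul_zero]

variable {q t : K} {a : ℤ → Module.End K V}

theorem IsHeis.pos_mul_cre (h : IsHeis q t a) (c : ℕ → K) (n : ℕ+) (k : ℤ) :
    a n * cre a c k = cre a c k * a n + (kap q t n * c n) • cre a c (k - n) := by
  rw [← sub_eq_iff_eq_add']
  refine lie_coeffZ_expSeries (by simp) n (fun m => ?_) k
  rw [PowerSeries.coeff_mk, if_neg m.ne_zero, mul_smul_comm, smul_mul_assoc, ← smul_sub, h.lie]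
  split_ifs with hm
  · rw [smul_smul, hm, mul_comm]
  · rw [smul_zero]

theorem IsHeis.neg_mul_cre (h : IsHeis q t a) (c : ℕ → K) (n : ℕ+) (k : ℤ) :
    a (-n) * cre a c k = cre a c k * a (-n) := by
  rw [← sub_eq_zero]
  refine (lie_coeffZ_expSeries (a := 0) (by simp) n (fun m => ?_) k).trans (zero_smul _ _)
  rw [PowerSeries.coeff_mk, if_neg m.ne_zero, mul_smul_comm, smul_mul_assoc, ← smul_sub, h.neg]
  simp

theorem IsHeis.neg_mul_ann (h : IsHeis q t a) (d : ℕ → K) (n : ℕ+) (k : ℤ) :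
    a (-n) * ann a d k = ann a d k * a (-n) + (-(kap q t n * d n)) • ann a d (k - n) := by
  rw [← sub_eq_iff_eq_add']
  refine lie_coeffZ_expSeries (by simp) n (fun m => ?_) k
  rw [PowerSeries.coeff_mk, if_neg m.ne_zero, mul_smul_comm, smul_mul_assoc, ← smul_sub,
    ← neg_sub, h.lie]
  by_cases hm : m = n
  · rw [if_pos hm, if_pos hm.symm, hm, smul_neg, smul_smul, neg_smul, mul_comm]
  · rw [if_neg hm, if_neg (Ne.symm hm), neg_zero, smul_zero]

theorem IsHeis.pos_mul_ann (h : IsHeis q t a) (d : ℕ → K) (n : ℕ+) (k : ℤ) :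
    a n * ann a d k = ann a d k * a n := by
  rw [← sub_eq_zero]
  refine (lie_coeffZ_expSeries (a := 0) (by simp) n (fun m => ?_) k).trans (zero_smul _ _)
  rw [PowerSeries.coeff_mk, if_neg m.ne_zero, mul_smul_comm, smul_mul_assoc, ← smul_sub, h.pos]
  simp

/-- If the coefficients of `f` shift a filtration by multiples of `e`, then so do those of
`exp f`. -/
theorem expSeries_filtration {f : PowerSeries (Module.End K V)} (P : ℤ → Submodule K V) (e : ℤ)
    (h : ∀ (m : ℕ) d v, v ∈ P d → PowerSeries.coeff m f v ∈ P (d + e * m)) (k : ℕ) (d : ℤ) {v : V}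
    (hv : v ∈ P d) : PowerSeries.coeff k (expSeries K f) v ∈ P (d + e * k) := by
  have key : ∀ (r k : ℕ) (d : ℤ) (v : V), v ∈ P d →
      PowerSeries.coeff k (f ^ r) v ∈ P (d + e * k) := by
    intro r
    induction r with
    | zero =>
      intro k d v hv
      rw [pow_zero, PowerSeries.coeff_one]
      split_ifs with hk
      · simpa [hk] using hv
      · exact zero_mem _
    | succ r ih =>
      intro k d v hv
      rw [pow_succ, PowerSeries.coeff_mul, LinearMap.sum_apply]
      refine sum_mem fun p hp => ?_
      rw [HasAntidiagonal.mem_antidiagonal] at hp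
      have := ih p.1 _ _ (h p.2 d v hv)
      rwa [show d + e * (p.2 : ℤ) + e * (p.1 : ℤ) = d + e * k by rw [← hp]; push_cast; ring] at this
  rw [expSeries, PowerSeries.coeff_mk, LinearMap.sum_apply]
  exact sum_mem fun r _ => Submodule.smul_mem _ _ (key r k d v hv)

end Abstract

/-! ### The Heisenberg algebra on the Fock space and on its completion, and degree bounds. -/

section Concrete

variable {K : Type*} [Field K] [CharZero K] {q t : K}

theorem heis_pos (q t : K) (n : ℕ+) : heis q t n =
    kap q t n • (MvPolynomial.pderiv n : Derivation K (Fock K) (Fock K)).toLinearMap := by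
  obtain ⟨k, rfl⟩ : ∃ k : ℕ, k.succPNat = n := ⟨_, PNat.succPNat_natPred n⟩
  rfl

theorem heis_neg (q t : K) (n : ℕ+) :
    heis q t (-n) = LinearMap.mulLeft K (MvPolynomial.X n) := by
  obtain ⟨k, rfl⟩ : ∃ k : ℕ, k.succPNat = n := ⟨_, PNat.succPNat_natPred n⟩
  rfl

theorem heisHat_pos (q t : K) (n : ℕ+) : heisHat q t n =
    kap q t n • (MvPowerSeries.pderiv K n : Derivation K (FockHat K) (FockHat K)).toLinearMap := by
  obtain ⟨k, rfl⟩ : ∃ k : ℕ, k.succPNat = n := ⟨_, PNat.succPNat_natPred n⟩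
  rfl

theorem heisHat_neg (q t : K) (n : ℕ+) :
    heisHat q t (-n) = LinearMap.mulLeft K (MvPowerSeries.X n) := by
  obtain ⟨k, rfl⟩ : ∃ k : ℕ, k.succPNat = n := ⟨_, PNat.succPNat_natPred n⟩
  rfl

theorem heisHat_coe_pos (n : ℕ+) (f : Fock K) :
    heisHat q t n (f : FockHat K) = (heis q t n f : Fock K) := by
  rw [heisHat_pos, heis_pos]
  simp [MvPowerSeries.pderiv_coe]

theorem heisHat_coe_neg (n : ℕ+) (f : Fock K) :
    heisHat q t (-n) (f : FockHat K) = (heis q t (-n) f : Fock K) := by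
  rw [heisHat_neg, heis_neg]
  simp

theorem pderiv_X_hat (m n : ℕ+) :
    MvPowerSeries.pderiv K m (MvPowerSeries.X n : FockHat K) = if n = m then 1 else 0 := by
  rw [← MvPolynomial.coe_X, MvPowerSeries.pderiv_coe, MvPolynomial.pderiv_X]
  split_ifs with h
  · subst h; simp
  · rw [Pi.single_eq_of_ne h]; simp

theorem isHeis_heis (q t : K) : IsHeis q t (heis q t) where
  pos m n := by
    rw [heis_pos, heis_pos]
    refine LinearMap.ext fun f => ?_
    have : MvPolynomial.pderiv m (MvPolynomial.pderiv n f) =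
        MvPolynomial.pderiv n (MvPolynomial.pderiv m f) := by
      ext x
      simp only [MvPolynomial.coeff_pderiv, Finsupp.add_apply, add_assoc,
        add_comm (Finsupp.single n 1)]
      by_cases h : m = n
      · rw [h]
      · rw [Finsupp.single_eq_of_ne h, Finsupp.single_eq_of_ne (Ne.symm h)]
        push_cast
        ring
    simp [this, smul_comm (kap q t m)]
  neg m n := by
    rw [heis_neg, heis_neg]
    refine LinearMap.ext fun f => ?_
    simp [mul_left_comm]
  lie m n := by
    rw [heis_neg, heis_pos]
    refine LinearMap.ext fun f => ?_
    split_ifs with h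
    · subst h
      simp [smul_add]
    · have : MvPolynomial.pderiv m (MvPolynomial.X n : Fock K) = 0 := by
        rw [MvPolynomial.pderiv_X, Pi.single_eq_of_ne h]
      simp [this]

theorem isHeis_heisHat (q t : K) : IsHeis q t (heisHat q t) where
  pos m n := by
    rw [heisHat_pos, heisHat_pos]
    refine LinearMap.ext fun f => ?_
    have : MvPowerSeries.pderiv K m (MvPowerSeries.pderiv K n f) =
        MvPowerSeries.pderiv K n (MvPowerSeries.pderiv K m f) := by
      ext x
      simp only [MvPowerSeries.coeff_pderiv, Finsupp.add_apply, add_assoc,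
        add_comm (Finsupp.single n 1)]
      by_cases h : m = n
      · rw [h]
      · rw [Finsupp.single_eq_of_ne h, Finsupp.single_eq_of_ne (Ne.symm h)]
        push_cast
        ring
    simp [this, smul_comm (kap q t m)]
  neg m n := by
    rw [heisHat_neg, heisHat_neg]
    refine LinearMap.ext fun f => ?_
    simp [mul_left_comm]
  lie m n := by
    rw [heisHat_neg, heisHat_pos]
    refine LinearMap.ext fun f => ?_
    have := pderiv_X_hat (K := K) m n
    split_ifs at this ⊢ with h
    · subst h
      simp [this, smul_add]
    · simp [this]

theorem wt_add (m n : ℕ+ →₀ ℕ) : wt (m + n) = wt m + wt n :=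
  Finsupp.sum_add_index' (by simp) (by intros; ring)

theorem wt_single (n : ℕ+) (k : ℕ) : wt (Finsupp.single n k) = n * k :=
  Finsupp.sum_single_index (by simp)

/-- The elements of the Fock space all of whose monomials have degree less than `d`. -/
def degLT (K : Type*) [Field K] (d : ℤ) : Submodule K (Fock K) where
  carrier := {f | ∀ m, d ≤ wt m → MvPolynomial.coeff m f = 0}
  add_mem' hf hg m hm := by rw [MvPolynomial.coeff_add, hf m hm, hg m hm, add_zero]
  zero_mem' m _ := MvPolynomial.coeff_zero m
  smul_mem' c f hf m hm := by rw [MvPolynomial.coeff_smul, hf m hm, smul_zero]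

/-- The elements of the completed Fock space all of whose monomials have degree at least `d`. -/
def degGE (K : Type*) [Field K] (d : ℤ) : Submodule K (FockHat K) where
  carrier := {f | ∀ m, wt m < d → MvPowerSeries.coeff m f = 0}
  add_mem' hf hg m hm := by rw [map_add, hf m hm, hg m hm, add_zero]
  zero_mem' m _ := map_zero _
  smul_mem' c f hf m hm := by rw [map_smul, hf m hm, smul_zero]

theorem degLT_mono {d d' : ℤ} (h : d ≤ d') {f : Fock K} (hf : f ∈ degLT K d) : f ∈ degLT K d' :=
  fun m hm => hf m (h.trans hm)

theorem exists_mem_degLT (f : Fock K) : ∃ B : ℕ, f ∈ degLT K B := by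
  refine ⟨f.support.sup wt + 1, fun m hm => ?_⟩
  by_contra h
  have := Finset.le_sup (f := wt) (MvPolynomial.mem_support_iff.2 h)
  omega

theorem monomial_mem_degLT (m : ℕ+ →₀ ℕ) {B : ℕ} (h : wt m < B) :
    (MvPolynomial.monomial m 1 : Fock K) ∈ degLT K B := by
  intro m' hm'
  rw [MvPolynomial.coeff_monomial, if_neg]
  rintro rfl
  omega

theorem eq_zero_of_mem_degLT {f : Fock K} {d : ℤ} (hd : d ≤ 0) (hf : f ∈ degLT K d) : f = 0 := by
  ext m
  exact hf m (by omega)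

theorem heis_pos_mem_degLT (n : ℕ+) {d : ℤ} {f : Fock K} (hf : f ∈ degLT K d) :
    heis q t n f ∈ degLT K (d - n) := by
  intro m hm
  rw [heis_pos]
  rw [LinearMap.smul_apply, MvPolynomial.coeff_smul, Derivation.coeFn_coe,
    MvPolynomial.coeff_pderiv, hf, zero_mul, smul_zero]
  rw [wt_add, wt_single]
  push_cast
  omega

theorem heis_neg_mem_degLT (n : ℕ+) {d : ℤ} {f : Fock K} (hf : f ∈ degLT K d) :
    heis q t (-n) f ∈ degLT K (d + n) := by
  intro m hm
  rw [heis_neg, LinearMap.mulLeft_apply, mul_comm, MvPolynomial.coeff_mul_X']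
  split_ifs with h
  · refine hf _ ?_
    have h1 : Finsupp.single n 1 ≤ m := by
      rw [Finsupp.single_le_iff]
      exact Nat.one_le_iff_ne_zero.2 (Finsupp.mem_support_iff.1 h)
    have h2 := wt_add (m - Finsupp.single n 1) (Finsupp.single n 1)
    rw [tsub_add_cancel_of_le h1, wt_single] at h2
    omega
  · rfl

theorem ann_mem_degLT (d : ℕ → K) (j : ℕ) {B : ℤ} {f : Fock K} (hf : f ∈ degLT K B) :
    ann (heis q t) d j f ∈ degLT K (B - j) := by
  rw [ann_natCast, show B - (j : ℤ) = B + (-1) * j by ring]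
  refine expSeries_filtration (degLT K) (-1) (fun m B' v hv => ?_) j B hf
  rw [PowerSeries.coeff_mk]
  split_ifs with hm
  · exact zero_mem _
  · refine Submodule.smul_mem _ _ ?_
    have := heis_pos_mem_degLT (q := q) (t := t) ⟨m, Nat.pos_of_ne_zero hm⟩ hv
    rwa [PNat.mk_coe, sub_eq_add_neg, neg_eq_neg_one_mul (m : ℤ)] at this

theorem ann_eq_zero (d : ℕ → K) {j B : ℕ} {f : Fock K} (hf : f ∈ degLT K B) (hj : B ≤ j) :
    ann (heis q t) d j f = 0 :=
  eq_zero_of_mem_degLT (by omega) (ann_mem_degLT d j hf)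

/-- A coefficient of `a_n F`, `n ≠ 0`, is a multiple of a coefficient of `F`. -/
theorem coeff_heisHat_neg (n : ℕ+) (m : ℕ+ →₀ ℕ) (F : FockHat K) :
    MvPowerSeries.coeff m (heisHat q t (-n) F) =
      if Finsupp.single n 1 ≤ m then MvPowerSeries.coeff (m - Finsupp.single n 1) F else 0 := by
  rw [heisHat_neg, LinearMap.mulLeft_apply, MvPowerSeries.X, MvPowerSeries.coeff_monomial_mul]
  simp

theorem coeff_heisHat_pos (n : ℕ+) (m : ℕ+ →₀ ℕ) (F : FockHat K) :
    MvPowerSeries.coeff m (heisHat q t n F) =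
      kap q t n * (m n + 1) * MvPowerSeries.coeff (m + Finsupp.single n 1) F := by
  rw [heisHat_pos]
  simp [MvPowerSeries.coeff_pderiv]
  ring

theorem wt_sub_single {n : ℕ+} {m : ℕ+ →₀ ℕ} (h : Finsupp.single n 1 ≤ m) :
    wt (m - Finsupp.single n 1) + n = wt m := by
  have h2 := wt_add (m - Finsupp.single n 1) (Finsupp.single n 1)
  rw [tsub_add_cancel_of_le h, wt_single] at h2
  omega

theorem heisHat_neg_mem_degGE (n : ℕ+) {d : ℤ} {f : FockHat K} (hf : f ∈ degGE K d) :
    heisHat q t (-n) f ∈ degGE K (d + n) := by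
  intro m hm
  rw [coeff_heisHat_neg]
  split_ifs with h
  · exact hf _ (by have := wt_sub_single h; omega)
  · rfl

/-- A creating term of degree i takes values in degrees at least i. This local finiteness makes sums
of creating terms meaningful on the completion. -/
theorem coeff_cre_eq_zero (c : ℕ → K) {i : ℤ} {m : ℕ+ →₀ ℕ} (hi : wt m < i) (F : FockHat K) :
    MvPowerSeries.coeff m (cre (heisHat q t) c i F) = 0 := by
  lift i to ℕ using by omega
  rw [cre_natCast]
  have hF : F ∈ degGE K 0 := fun m hm => absurd hm (by omega)
  refine expSeries_filtration (degGE K) 1 (fun m B' v hv => ?_) i 0 hF m (by omega)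
  rw [PowerSeries.coeff_mk]
  split_ifs with hm
  · exact zero_mem _
  · refine Submodule.smul_mem _ _ ?_
    have := heisHat_neg_mem_degGE (q := q) (t := t) ⟨m, Nat.pos_of_ne_zero hm⟩ hv
    rw [one_mul]
    exact this

end Concrete

/-- Moving a_n past an exponential shifts its index by n. Terms of negative index vanish, so
lengthening the sum by n leaves no boundary terms. -/
theorem sum_range_shift {M : Type*} [AddCommMonoid M] {g : ℤ → M} (hg : ∀ k < 0, g k = 0)
    (n B : ℕ) : ∑ j ∈ range (n + B), g (j - n) = ∑ j ∈ range B, g j := by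
  rw [sum_range_add, sum_eq_zero, zero_add]
  · exact sum_congr rfl fun j _ => by push_cast; rw [add_sub_cancel_left]
  · intro j hj
    rw [mem_range] at hj
    exact hg _ (by omega)

/-! ### Commutators of Heisenberg generators with modes of currents and with normally ordered
exponentials. -/

section Modes

variable {K : Type*} [Field K] [CharZero K] {q t : K}

theorem coeff_modeHat (e : Exponents K) (k : ℤ) (F : FockHat K) {m : ℕ+ →₀ ℕ} {B : ℕ}
    (hB : wt m < B) : MvPowerSeries.coeff m (modeHat q t e k F) =
      ∑ i ∈ range B, MvPowerSeries.coeff m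
        (cre (heisHat q t) e.1 i (ann (heisHat q t) e.2 (i - k) F)) := by
  have h1 : MvPowerSeries.coeff m (modeHat q t e k F) =
      ∑ i ∈ range (wt m + 1), MvPowerSeries.coeff m
        (cre (heisHat q t) e.1 i (ann (heisHat q t) e.2 (i - k) F)) := by
    change (∑ i ∈ range (wt m + 1), _ : FockHat K →ₗ[K] K) F = _
    rw [LinearMap.sum_apply]
    refine sum_congr rfl fun i _ => ?_
    rw [cre_natCast]
    rfl
  rw [h1]
  refine sum_subset (range_subset_range.2 hB) fun i _ hi => ?_
  rw [mem_range] at hi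
  exact coeff_cre_eq_zero _ (by omega) _

theorem coeff_modeHat_eq_zero (e : Exponents K) {k : ℤ} (F : FockHat K) {m : ℕ+ →₀ ℕ}
    (h : wt m < k) : MvPowerSeries.coeff m (modeHat q t e k F) = 0 := by
  rw [coeff_modeHat e k F (Nat.lt_succ_self _)]
  refine sum_eq_zero fun i hi => ?_
  rw [mem_range] at hi
  rw [ann_of_neg _ _ (by omega), LinearMap.zero_apply, map_zero, map_zero]

theorem coeff_heisHat_pos_modeHat (n : ℕ+) (e : Exponents K) (k : ℤ) (F : FockHat K)
    {m : ℕ+ →₀ ℕ} {B : ℕ} (hB : n + wt m < B) :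
    MvPowerSeries.coeff m (heisHat q t n (modeHat q t e k F)) =
      ∑ i ∈ range B, MvPowerSeries.coeff m (heisHat q t n
        (cre (heisHat q t) e.1 i (ann (heisHat q t) e.2 (i - k) F))) := by
  simp_rw [coeff_heisHat_pos]
  rw [coeff_modeHat e k F (B := B) (by rw [wt_add, wt_single]; omega), mul_sum]

theorem coeff_heisHat_neg_modeHat (n : ℕ+) (e : Exponents K) (k : ℤ) (F : FockHat K)
    {m : ℕ+ →₀ ℕ} {B : ℕ} (hB : wt m < B) :
    MvPowerSeries.coeff m (heisHat q t (-n) (modeHat q t e k F)) =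
      ∑ i ∈ range B, MvPowerSeries.coeff m (heisHat q t (-n)
        (cre (heisHat q t) e.1 i (ann (heisHat q t) e.2 (i - k) F))) := by
  simp_rw [coeff_heisHat_neg]
  split_ifs with h
  · exact coeff_modeHat e k F (by have := wt_sub_single h; omega)
  · simp

/-- The generator a_n passes the annihilating part freely and picks up κ_n c_n from the creating
part, whose degree drops by n. A coefficient of a_n F at m is read off in degree wt m + n, so the
unshifted sums are cut n places later than the shifted one. -/
theorem pos_mul_modeHat (e : Exponents K) (k : ℤ) (n : ℕ+) :
    heisHat q t n * modeHat q t e k =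
      modeHat q t e k * heisHat q t n + (kap q t n * e.1 n) • modeHat q t e (k - n) := by
  refine LinearMap.ext fun F => MvPowerSeries.ext fun m => ?_
  rw [Module.End.mul_apply, LinearMap.add_apply, Module.End.mul_apply, LinearMap.smul_apply,
    map_add, map_smul, coeff_heisHat_pos_modeHat n e k F (B := n + (wt m + 1)) (by omega),
    coeff_modeHat e k _ (B := n + (wt m + 1)) (by omega),
    coeff_modeHat e (k - n) _ (B := wt m + 1) (by omega), smul_sum,
    ← sum_range_shift (g := fun i : ℤ => (kap q t n * e.1 n) • MvPowerSeries.coeff m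
        (cre (heisHat q t) e.1 i (ann (heisHat q t) e.2 (i - (k - n)) F))), ← sum_add_distrib]
  · refine sum_congr rfl fun i _ => ?_
    rw [← Module.End.mul_apply, (isHeis_heisHat q t).pos_mul_cre, LinearMap.add_apply,
      Module.End.mul_apply, ← Module.End.mul_apply _ (ann _ _ _), (isHeis_heisHat q t).pos_mul_ann,
      LinearMap.smul_apply, map_add, map_smul, Module.End.mul_apply,
      show (i : ℤ) - n - (k - n) = i - k by ring]
  · intro i hi
    rw [cre_of_neg _ _ hi, LinearMap.zero_apply, map_zero, smul_zero]

/-- Here only the annihilating part contributes. Its index i - k absorbs the shift by n, so the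
summation over i is unchanged. -/
theorem neg_mul_modeHat (e : Exponents K) (k : ℤ) (n : ℕ+) :
    heisHat q t (-n) * modeHat q t e k =
      modeHat q t e k * heisHat q t (-n) + (-(kap q t n * e.2 n)) • modeHat q t e (k + n) := by
  refine LinearMap.ext fun F => MvPowerSeries.ext fun m => ?_
  rw [Module.End.mul_apply, LinearMap.add_apply, Module.End.mul_apply, LinearMap.smul_apply,
    map_add, map_smul, coeff_heisHat_neg_modeHat n e k F (B := wt m + 1) (by omega),
    coeff_modeHat e k _ (B := wt m + 1) (by omega),
    coeff_modeHat e (k + n) _ (B := wt m + 1) (by omega), smul_sum, ← sum_add_distrib]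
  refine sum_congr rfl fun i _ => ?_
  rw [← Module.End.mul_apply, (isHeis_heisHat q t).neg_mul_cre, Module.End.mul_apply,
    ← Module.End.mul_apply _ (ann _ _ _), (isHeis_heisHat q t).neg_mul_ann, LinearMap.add_apply,
    LinearMap.smul_apply, map_add, map_add, map_smul, map_smul, Module.End.mul_apply,
    show (i : ℤ) - (k + n) = i - k - n by ring]

theorem modeF_apply (e : Exponents K) (k : ℤ) {f : Fock K} {B : ℕ} (hf : f ∈ degLT K B) :
    modeF q t e k f =
      ∑ j ∈ range B, cre (heis q t) e.1 (k + j) (ann (heis q t) e.2 j f) := by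
  have h1 : ∀ m : ℕ+ →₀ ℕ, wt m < B → modeF q t e k (MvPolynomial.monomial m 1) =
      ∑ j ∈ range B, cre (heis q t) e.1 (k + j)
        (ann (heis q t) e.2 j (MvPolynomial.monomial m 1)) := by
    intro m hm
    have h2 : modeF q t e k (MvPolynomial.monomial m 1) =
        ∑ j ∈ range (wt m + 1), cre (heis q t) e.1 (k + j)
          (ann (heis q t) e.2 j (MvPolynomial.monomial m 1)) := by
      have hb := (MvPolynomial.basisMonomials ℕ+ K).constr_basis K (fun m =>
        ∑ j ∈ range (wt m + 1), coeffZ (k + j) (creation (heis q t) e.1)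
          (PowerSeries.coeff j (annihilation (heis q t) e.2) (MvPolynomial.monomial m 1))) m
      rw [MvPolynomial.coe_basisMonomials] at hb
      refine hb.trans (sum_congr rfl fun j _ => ?_)
      rw [ann_natCast]
      rfl
    rw [h2]
    refine sum_subset (range_subset_range.2 hm) fun j _ hj => ?_
    rw [mem_range] at hj
    rw [ann_eq_zero e.2 (monomial_mem_degLT m (Nat.lt_succ_self _)) (by omega), map_zero]
  have h3 : ∀ m ∈ f.support, MvPolynomial.monomial m (f.coeff m) =
      f.coeff m • (MvPolynomial.monomial m 1 : Fock K) := by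
    intro m _
    rw [MvPolynomial.smul_monomial, smul_eq_mul, mul_one]
  rw [f.as_sum, sum_congr rfl h3]
  simp only [map_sum, map_smul]
  rw [sum_comm]
  refine sum_congr rfl fun m hm => ?_
  rw [h1 m, smul_sum]
  by_contra h
  exact MvPolynomial.mem_support_iff.1 hm (hf m (by omega))

theorem pos_mul_modeF (e : Exponents K) (k : ℤ) (n : ℕ+) :
    heis q t n * modeF q t e k =
      modeF q t e k * heis q t n + (kap q t n * e.1 n) • modeF q t e (k - n) := by
  refine LinearMap.ext fun f => ?_
  obtain ⟨B, hB⟩ := exists_mem_degLT f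
  have hB' : heis q t n f ∈ degLT K B :=
    degLT_mono (by have := n.pos; omega) (heis_pos_mem_degLT n hB)
  rw [Module.End.mul_apply, LinearMap.add_apply, Module.End.mul_apply, LinearMap.smul_apply,
    modeF_apply e k hB, modeF_apply e k hB', modeF_apply e _ hB, smul_sum, map_sum,
    ← sum_add_distrib]
  refine sum_congr rfl fun i _ => ?_
  rw [← Module.End.mul_apply, (isHeis_heis q t).pos_mul_cre, LinearMap.add_apply,
    Module.End.mul_apply, ← Module.End.mul_apply _ (ann _ _ _), (isHeis_heis q t).pos_mul_ann,
    LinearMap.smul_apply, Module.End.mul_apply, show k + (i : ℤ) - n = k - n + i by ring]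

theorem neg_mul_modeF (e : Exponents K) (k : ℤ) (n : ℕ+) :
    heis q t (-n) * modeF q t e k =
      modeF q t e k * heis q t (-n) + (-(kap q t n * e.2 n)) • modeF q t e (k + n) := by
  refine LinearMap.ext fun f => ?_
  obtain ⟨B, hB⟩ := exists_mem_degLT f
  -- Multiplication by p_n raises the degree by n, so n more annihilating terms have to be kept.
  have hB' : heis q t (-n) f ∈ degLT K ((n + B : ℕ) : ℤ) :=
    degLT_mono (by push_cast; omega) (heis_neg_mem_degLT n hB)
  have hB'' : f ∈ degLT K ((n + B : ℕ) : ℤ) := degLT_mono (by push_cast; omega) hB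
  rw [Module.End.mul_apply, LinearMap.add_apply, Module.End.mul_apply, LinearMap.smul_apply,
    modeF_apply e k hB'', modeF_apply e k hB', modeF_apply e _ hB, smul_sum, map_sum,
    ← sum_range_shift (g := fun i : ℤ => (-(kap q t n * e.2 n)) •
        (cre (heis q t) e.1 (k + n + i) (ann (heis q t) e.2 i f))), ← sum_add_distrib]
  · refine sum_congr rfl fun i _ => ?_
    rw [← Module.End.mul_apply, (isHeis_heis q t).neg_mul_cre, Module.End.mul_apply,
      ← Module.End.mul_apply _ (ann _ _ _), (isHeis_heis q t).neg_mul_ann, LinearMap.add_apply,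
      LinearMap.smul_apply, map_add, map_smul, Module.End.mul_apply,
      show k + (n : ℤ) + (i - n) = k + i by ring]
  · intro i hi
    rw [ann_of_neg _ _ hi, LinearMap.zero_apply, map_zero, smul_zero]

theorem coeff_normalExp (e : Exponents K) {f : Fock K} {B : ℕ} (hf : f ∈ degLT K B)
    {m : ℕ+ →₀ ℕ} {A : ℕ} (hA : wt m < A) :
    MvPowerSeries.coeff m (normalExp q t e f) =
      ∑ i ∈ range A, ∑ j ∈ range B, MvPowerSeries.coeff m (cre (heisHat q t) e.1 i
        ((ann (heis q t) e.2 j f : Fock K) : FockHat K)) := by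
  have h1 : ∀ m' : ℕ+ →₀ ℕ, wt m' < B →
      MvPowerSeries.coeff m (normalExp q t e (MvPolynomial.monomial m' 1)) =
      ∑ i ∈ range A, ∑ j ∈ range B, MvPowerSeries.coeff m (cre (heisHat q t) e.1 i
        ((ann (heis q t) e.2 j (MvPolynomial.monomial m' 1) : Fock K) : FockHat K)) := by
    intro m' hm'
    have h2 : MvPowerSeries.coeff m (normalExp q t e (MvPolynomial.monomial m' 1)) =
        ∑ i ∈ range (wt m + 1), ∑ j ∈ range (wt m' + 1),
          MvPowerSeries.coeff m (cre (heisHat q t) e.1 i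
            ((ann (heis q t) e.2 j (MvPolynomial.monomial m' 1) : Fock K) : FockHat K)) := by
      have hb := (MvPolynomial.basisMonomials ℕ+ K).constr_basis K (fun m => ofCoeffs fun m' =>
        ∑ i ∈ range (wt m' + 1), ∑ j ∈ range (wt m + 1), MvPowerSeries.coeff m'
          (PowerSeries.coeff i (creation (heisHat q t) e.1)
            ((PowerSeries.coeff j (annihilation (heis q t) e.2)
              (MvPolynomial.monomial m 1) : Fock K) : FockHat K))) m'
      rw [MvPolynomial.coe_basisMonomials] at hb
      simp_rw [ann_natCast, cre_natCast]
      exact congrFun hb m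
    rw [h2]
    have h3 : ∀ i, ∑ j ∈ range (wt m' + 1),
          MvPowerSeries.coeff m (cre (heisHat q t) e.1 i
            ((ann (heis q t) e.2 j (MvPolynomial.monomial m' 1) : Fock K) : FockHat K)) =
        ∑ j ∈ range B,
          MvPowerSeries.coeff m (cre (heisHat q t) e.1 i
            ((ann (heis q t) e.2 j (MvPolynomial.monomial m' 1) : Fock K) : FockHat K)) := by
      intro i
      refine sum_subset (range_subset_range.2 hm') fun j _ hj => ?_
      rw [mem_range] at hj
      rw [ann_eq_zero e.2 (monomial_mem_degLT m' (Nat.lt_succ_self _)) (by omega)]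
      simp
    simp_rw [h3]
    refine sum_subset (range_subset_range.2 hA) fun i _ hi => ?_
    rw [mem_range] at hi
    exact sum_eq_zero fun j _ => coeff_cre_eq_zero _ (by omega) _
  have h3 : ∀ m ∈ f.support, MvPolynomial.monomial m (f.coeff m) =
      f.coeff m • (MvPolynomial.monomial m 1 : Fock K) := by
    intro m _
    rw [MvPolynomial.smul_monomial, smul_eq_mul, mul_one]
  let T : ℕ → ℕ → Fock K →ₗ[K] K := fun i j => (MvPowerSeries.coeff m : FockHat K →ₗ[K] K) ∘ₗ
    cre (heisHat q t) e.1 i ∘ₗ (MvPolynomial.coeToMvPowerSeries.algHom K).toLinearMap ∘ₗ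
      ann (heis q t) e.2 j
  have hT : ∀ (i j : ℕ) (g : Fock K), MvPowerSeries.coeff m (cre (heisHat q t) e.1 i
        ((ann (heis q t) e.2 j g : Fock K) : FockHat K)) = T i j g := by
    intro i j g
    simp [T, MvPolynomial.coeToMvPowerSeries.algHom_apply]
  simp_rw [hT] at h1 ⊢
  rw [f.as_sum, sum_congr rfl h3]
  simp only [map_sum, map_smul]
  have e1 : ∀ m' ∈ f.support, f.coeff m' • MvPowerSeries.coeff m
      (normalExp q t e (MvPolynomial.monomial m' 1)) =
      ∑ i ∈ range A, ∑ j ∈ range B, f.coeff m' • T i j (MvPolynomial.monomial m' 1) := by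
    intro m' hm'
    rw [h1 m', smul_sum]
    · simp_rw [smul_sum]
    · by_contra h
      exact MvPolynomial.mem_support_iff.1 hm' (hf m' (by omega))
  rw [sum_congr rfl e1, sum_comm]
  exact sum_congr rfl fun i _ => sum_comm

/-- The argument for modes applies, but all degrees of the creating part are now summed, so the
shift by n is invisible and the exponential is multiplied by a scalar. -/
theorem pos_normalExp (e : Exponents K) (n : ℕ+) (f : Fock K) :
    heisHat q t n (normalExp q t e f) =
      normalExp q t e (heis q t n f) + (kap q t n * e.1 n) • normalExp q t e f := by
  refine MvPowerSeries.ext fun m => ?_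
  obtain ⟨B, hB⟩ := exists_mem_degLT f
  have hB' : heis q t n f ∈ degLT K B :=
    degLT_mono (by have := n.pos; omega) (heis_pos_mem_degLT n hB)
  have h1 : MvPowerSeries.coeff m (heisHat q t n (normalExp q t e f)) =
      ∑ i ∈ range (n + (wt m + 1)), ∑ j ∈ range B, MvPowerSeries.coeff m (heisHat q t n
        (cre (heisHat q t) e.1 i ((ann (heis q t) e.2 j f : Fock K) : FockHat K))) := by
    simp_rw [coeff_heisHat_pos]
    rw [coeff_normalExp e hB (A := n + (wt m + 1)) (by rw [wt_add, wt_single]; omega), mul_sum]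
    exact sum_congr rfl fun i _ => mul_sum _ _ _
  rw [h1, map_add, map_smul, coeff_normalExp e hB' (A := n + (wt m + 1)) (by omega),
    coeff_normalExp e hB (A := wt m + 1) (by omega), smul_sum,
    ← sum_range_shift (g := fun i : ℤ => (kap q t n * e.1 n) • ∑ j ∈ range B, MvPowerSeries.coeff m
        (cre (heisHat q t) e.1 i ((ann (heis q t) e.2 j f : Fock K) : FockHat K))),
    ← sum_add_distrib]
  · refine sum_congr rfl fun i _ => ?_
    rw [smul_sum, ← sum_add_distrib]
    refine sum_congr rfl fun j _ => ?_
    rw [← Module.End.mul_apply, (isHeis_heisHat q t).pos_mul_cre, LinearMap.add_apply,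
      Module.End.mul_apply, heisHat_coe_pos, ← Module.End.mul_apply _ (ann _ _ _),
      (isHeis_heis q t).pos_mul_ann, LinearMap.smul_apply, map_add, map_smul, Module.End.mul_apply]
  · intro i hi
    simp [cre_of_neg _ _ hi]

theorem neg_normalExp (e : Exponents K) (n : ℕ+) (f : Fock K) :
    heisHat q t (-n) (normalExp q t e f) =
      normalExp q t e (heis q t (-n) f) + (-(kap q t n * e.2 n)) • normalExp q t e f := by
  refine MvPowerSeries.ext fun m => ?_
  obtain ⟨B, hB⟩ := exists_mem_degLT f
  have hB' : heis q t (-n) f ∈ degLT K ((n + B : ℕ) : ℤ) :=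
    degLT_mono (by push_cast; omega) (heis_neg_mem_degLT n hB)
  have hB'' : f ∈ degLT K ((n + B : ℕ) : ℤ) := degLT_mono (by push_cast; omega) hB
  have h1 : MvPowerSeries.coeff m (heisHat q t (-n) (normalExp q t e f)) =
      ∑ i ∈ range (wt m + 1), ∑ j ∈ range (n + B), MvPowerSeries.coeff m (heisHat q t (-n)
        (cre (heisHat q t) e.1 i ((ann (heis q t) e.2 j f : Fock K) : FockHat K))) := by
    simp_rw [coeff_heisHat_neg]
    split_ifs with h
    · exact coeff_normalExp e hB'' (by have := wt_sub_single h; omega)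
    · simp
  rw [h1, map_add, map_smul, coeff_normalExp e hB' (A := wt m + 1) (by omega),
    coeff_normalExp e hB (A := wt m + 1) (by omega), smul_sum, ← sum_add_distrib]
  refine sum_congr rfl fun i _ => ?_
  rw [smul_sum, ← sum_range_shift (g := fun j : ℤ => (-(kap q t n * e.2 n)) • MvPowerSeries.coeff m
        (cre (heisHat q t) e.1 i ((ann (heis q t) e.2 j f : Fock K) : FockHat K))),
    ← sum_add_distrib]
  · refine sum_congr rfl fun j _ => ?_
    rw [← Module.End.mul_apply, (isHeis_heisHat q t).neg_mul_cre,
      Module.End.mul_apply, heisHat_coe_neg, ← Module.End.mul_apply _ (ann _ _ _),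
      (isHeis_heis q t).neg_mul_ann, LinearMap.add_apply, LinearMap.smul_apply,
      MvPolynomial.coe_add, MvPolynomial.coe_smul, map_add, map_add, map_smul, map_smul,
      Module.End.mul_apply]
  · intro i hi
    simp [ann_of_neg _ _ hi]

end Modes

/-! ### Currents with only a creating or only an annihilating part, as needed for ψ^±. -/

section OneSided

variable {K : Type*} [Field K] [CharZero K] {q t : K}

theorem expSeries_zero_exponent {R : Type*} [Ring R] [Algebra K R] {f : PowerSeries R}
    (hf : f = 0) (k : ℤ) : coeffZ k (expSeries K f) = if k = 0 then 1 else 0 := by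
  rw [hf, expSeries_zero]
  rcases lt_or_ge k 0 with hk | hk
  · rw [coeffZ_of_neg hk, if_neg hk.ne]
  · lift k to ℕ using hk
    rw [coeffZ_natCast, PowerSeries.coeff_one]
    simp

theorem cre_zero_exponent {V : Type*} [AddCommGroup V] [Module K V] (a : ℤ → Module.End K V)
    (k : ℤ) : cre a (0 : ℕ → K) k = if k = 0 then 1 else 0 :=
  expSeries_zero_exponent (by ext n; simp) k

theorem ann_zero_exponent {V : Type*} [AddCommGroup V] [Module K V] (a : ℤ → Module.End K V)
    (k : ℤ) : ann a (0 : ℕ → K) k = if k = 0 then 1 else 0 :=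
  expSeries_zero_exponent (by ext n; simp) k

theorem modeHat_creating (c : ℕ → K) (k : ℤ) : modeHat q t (c, 0) k = cre (heisHat q t) c k := by
  refine LinearMap.ext fun F => MvPowerSeries.ext fun m => ?_
  rw [coeff_modeHat _ k F (B := wt m + 1 + k.toNat) (by omega)]
  simp only [ann_zero_exponent]
  rcases lt_or_ge k 0 with hk | hk
  · rw [cre_of_neg _ _ hk]
    refine (sum_eq_zero fun i _ => ?_).trans (by simp)
    rw [if_neg (by omega), LinearMap.zero_apply, map_zero, map_zero]
  · rw [sum_eq_single_of_mem k.toNat (by simp), if_pos (by omega), Module.End.one_apply,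
      Int.toNat_of_nonneg hk]
    intro i _ hi
    rw [if_neg (by omega), LinearMap.zero_apply, map_zero, map_zero]

theorem modeHat_annihilating (d : ℕ → K) (k : ℤ) :
    modeHat q t (0, d) k = ann (heisHat q t) d (-k) := by
  refine LinearMap.ext fun F => MvPowerSeries.ext fun m => ?_
  rw [coeff_modeHat _ k F (Nat.lt_succ_self _), sum_eq_single_of_mem 0 (by simp)]
  · simp only [cre_zero_exponent]
    simp
  · intro i _ hi
    simp only [cre_zero_exponent]
    rw [if_neg (by omega), LinearMap.zero_apply, map_zero]

theorem modeF_creating (c : ℕ → K) (k : ℤ) : modeF q t (c, 0) k = cre (heis q t) c k := by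
  refine LinearMap.ext fun f => ?_
  obtain ⟨B, hB⟩ := exists_mem_degLT f
  have hB' : f ∈ degLT K ((B + 1 : ℕ) : ℤ) := fun m hm => hB m (by push_cast at hm; omega)
  rw [modeF_apply _ k hB', sum_eq_single_of_mem 0 (by simp)]
  · simp only [ann_zero_exponent]
    simp
  · intro i _ hi
    simp only [ann_zero_exponent]
    rw [if_neg (by omega), LinearMap.zero_apply, map_zero]

theorem modeF_annihilating (d : ℕ → K) (k : ℤ) :
    modeF q t (0, d) k = ann (heis q t) d (-k) := by
  refine LinearMap.ext fun f => ?_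
  obtain ⟨B, hB⟩ := exists_mem_degLT f
  have hB' : f ∈ degLT K ((B + 1 + (-k).toNat : ℕ) : ℤ) := fun m hm => hB m (by
    push_cast at hm; omega)
  rw [modeF_apply _ k hB']
  simp only [cre_zero_exponent]
  rcases lt_or_ge (-k) 0 with hk | hk
  · rw [ann_of_neg _ _ hk]
    refine sum_eq_zero fun i _ => ?_
    rw [if_neg (by omega), LinearMap.zero_apply]
  · rw [sum_eq_single_of_mem (-k).toNat (by simp), if_pos (by omega), Module.End.one_apply,
      Int.toNat_of_nonneg hk]
    intro i _ hi
    rw [if_neg (by omega), LinearMap.zero_apply]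

end OneSided

/-! ### Vertex operators, their uniqueness and their vacuum expectation values. -/

section Vertex

variable {K : Type*} [Field K] [CharZero K] {q t : K}

/-- The family `X` has the same commutators with the Heisenberg generators as the coefficients of
the normally ordered product of the current with exponents `e` and the exponential with exponents
`e'`. -/
structure IsVertex (q t : K) (e e' : Exponents K) (X : ℤ → Fock K →ₗ[K] FockHat K) : Prop where
  pos (n : ℕ+) (k : ℤ) (f : Fock K) : heisHat q t n (X k f) = X k (heis q t n f) +
    (kap q t n * e.1 n) • X (k - n) f + (kap q t n * e'.1 n) • X k f
  neg (n : ℕ+) (k : ℤ) (f : Fock K) : heisHat q t (-n) (X k f) = X k (heis q t (-n) f) +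
    (-(kap q t n * e.2 n)) • X (k + n) f + (-(kap q t n * e'.2 n)) • X k f

variable {e e' : Exponents K} {X Y : ℤ → Fock K →ₗ[K] FockHat K}

/-- For fixed exponents the commutation conditions are linear in the family. Two families can thus
be compared by applying `IsVertex.eq_zero` to their difference. -/
theorem IsVertex.sub (hX : IsVertex q t e e' X) (hY : IsVertex q t e e' Y) :
    IsVertex q t e e' fun k => X k - Y k where
  pos n k f := by
    simp only [LinearMap.sub_apply, map_sub, hX.pos, hY.pos, smul_sub]; abel
  neg n k f := by
    simp only [LinearMap.sub_apply, map_sub, hX.neg, hY.neg, smul_sub]; abel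

theorem IsVertex.smul (hX : IsVertex q t e e' X) (a : K) :
    IsVertex q t e e' fun k => a • X k where
  pos n k f := by
    simp only [LinearMap.smul_apply, map_smul, hX.pos, smul_add, smul_comm a]
  neg n k f := by
    simp only [LinearMap.smul_apply, map_smul, hX.neg, smul_add, smul_comm a]

theorem IsVertex.sum {ι : Type*} (s : Finset ι) {Z : ι → ℤ → Fock K →ₗ[K] FockHat K}
    (h : ∀ i ∈ s, IsVertex q t e e' (Z i)) : IsVertex q t e e' fun k => ∑ i ∈ s, Z i k where
  pos n k f := by
    simp only [LinearMap.sum_apply, map_sum, smul_sum]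
    rw [← sum_add_distrib, ← sum_add_distrib]
    exact sum_congr rfl fun i hi => (h i hi).pos n k f
  neg n k f := by
    simp only [LinearMap.sum_apply, map_sum, smul_sum]
    rw [← sum_add_distrib, ← sum_add_distrib]
    exact sum_congr rfl fun i hi => (h i hi).neg n k f

theorem IsVertex.shift (hX : IsVertex q t e e' X) (a : ℤ) :
    IsVertex q t e e' fun k => X (k + a) where
  pos n k f := by rw [hX.pos, show k - n + a = k + a - n by ring]
  neg n k f := by rw [hX.neg, show k + n + a = k + a + n by ring]

/-- The current after the exponential, the current before it, and a delta function times their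
normally ordered product all satisfy the same commutation relations. These are the three kinds of
terms in the x^± relations. -/
theorem isVertex_modeHat_normalExp (e e' : Exponents K) :
    IsVertex q t e e' fun k => modeHat q t e k ∘ₗ normalExp q t e' where
  pos n k f := by
    simp only [LinearMap.comp_apply]
    rw [← Module.End.mul_apply, pos_mul_modeHat, LinearMap.add_apply, Module.End.mul_apply,
      pos_normalExp, map_add, map_smul, LinearMap.smul_apply]
    abel
  neg n k f := by
    simp only [LinearMap.comp_apply]
    rw [← Module.End.mul_apply, neg_mul_modeHat, LinearMap.add_apply, Module.End.mul_apply,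
      neg_normalExp, map_add, map_smul, LinearMap.smul_apply]
    abel

theorem isVertex_normalExp_modeF (e e' : Exponents K) :
    IsVertex q t e e' fun k => normalExp q t e' ∘ₗ modeF q t e k where
  pos n k f := by
    simp only [LinearMap.comp_apply]
    rw [pos_normalExp, ← Module.End.mul_apply, pos_mul_modeF, LinearMap.add_apply,
      Module.End.mul_apply, map_add, LinearMap.smul_apply, map_smul]
  neg n k f := by
    simp only [LinearMap.comp_apply]
    rw [neg_normalExp, ← Module.End.mul_apply, neg_mul_modeF, LinearMap.add_apply,
      Module.End.mul_apply, map_add, LinearMap.smul_apply, map_smul]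

/-- The scalar y^{-k} is the coefficient of z^k in δ(y/z). Replacing k by k - n multiplies it by
y^n, which is exactly the effect of evaluating the exponents of the current at y. -/
theorem isVertex_normalExp_evalAt (e e' : Exponents K) {y : K} (hy : y ≠ 0) :
    IsVertex q t e e' fun k => y ^ (-k) • normalExp q t (e.evalAt y + e') where
  pos n k f := by
    rw [LinearMap.smul_apply, map_smul, pos_normalExp]
    simp only [LinearMap.smul_apply, smul_add, smul_smul, add_assoc, ← add_smul, Prod.fst_add,
      Pi.add_apply, Exponents.evalAt]
    congr 2
    rw [neg_sub, zpow_sub₀ hy, zpow_neg, zpow_natCast]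
    ring
  neg n k f := by
    rw [LinearMap.smul_apply, map_smul, neg_normalExp]
    simp only [LinearMap.smul_apply, smul_add, smul_smul, add_assoc, ← add_smul, Prod.snd_add,
      Pi.add_apply, Exponents.evalAt]
    congr 2
    rw [neg_add, zpow_add₀ hy, zpow_neg, zpow_neg, zpow_natCast, inv_pow]
    ring

theorem constantCoeff_heisHat_neg (n : ℕ+) (F : FockHat K) :
    MvPowerSeries.constantCoeff (heisHat q t (-n) F) = 0 := by
  rw [heisHat_neg]; simp

theorem heis_pos_one (n : ℕ+) : heis q t n (1 : Fock K) = 0 := by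
  rw [heis_pos]; simp

/-- A vertex operator is determined by its vacuum expectation values. -/
theorem IsVertex.eq_zero (hκ : ∀ n : ℕ+, kap q t n ≠ 0) (hX : IsVertex q t e e' X)
    (h : ∀ k, MvPowerSeries.constantCoeff (X k 1) = 0) (k : ℤ) : X k = 0 := by
  have h1 : ∀ (d : ℕ) (m : ℕ+ →₀ ℕ), wt m = d → ∀ k, MvPowerSeries.coeff m (X k 1) = 0 := by
    intro d
    induction d using Nat.strong_induction_on with
    | _ d ih =>
      intro m hm k
      rcases eq_or_ne m 0 with rfl | hm0
      · exact h k
      obtain ⟨n, hn⟩ := Finsupp.support_nonempty_iff.2 hm0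
      have hle : Finsupp.single n 1 ≤ m := by
        rw [Finsupp.single_le_iff]
        exact Nat.one_le_iff_ne_zero.2 (Finsupp.mem_support_iff.1 hn)
      have hw := wt_sub_single hle
      -- Up to a nonzero factor, the coefficient at m is that of a_n X_k 1 at m with one p_n
      -- removed. As a_n kills the vacuum, only commutator terms remain, and they vanish by
      -- induction on the degree.
      have h2 := coeff_heisHat_pos (q := q) (t := t) n (m - Finsupp.single n 1) (X k 1)
      have hlt : wt (m - Finsupp.single n 1) < d := by have := n.pos; omega
      rw [tsub_add_cancel_of_le hle, hX.pos, heis_pos_one, map_zero, zero_add, map_add, map_smul,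
        map_smul, ih _ hlt _ rfl, ih _ hlt _ rfl, smul_zero, smul_zero, add_zero, eq_comm,
        mul_eq_zero] at h2
      refine h2.resolve_left (mul_ne_zero (hκ n) ?_)
      exact_mod_cast Nat.succ_ne_zero ((m - Finsupp.single n (1 : ℕ)) n)
  have h2 : ∀ k, X k 1 = 0 := fun k => MvPowerSeries.ext fun m => h1 _ m rfl k
  refine LinearMap.ext fun f => ?_
  rw [LinearMap.zero_apply]
  induction f using MvPolynomial.induction_on generalizing k with
  | C a => rw [MvPolynomial.C_eq_smul_one, map_smul, h2, smul_zero]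
  | add p p' hp hp' => rw [map_add, hp, hp', add_zero]
  | mul_X p n hp =>
    -- Multiplication by p_n is a_{-n}, so vanishing at p for every k passes to p_n p.
    have h3 := hX.neg n k p
    rw [hp, hp, map_zero, smul_zero, smul_zero, add_zero, add_zero, heis_neg,
      LinearMap.mulLeft_apply, mul_comm] at h3
    exact h3.symm

theorem constantCoeff_normalExp (e : Exponents K) :
    MvPowerSeries.constantCoeff (normalExp q t e 1) = 1 := by
  have h1 : (1 : Fock K) ∈ degLT K ((1 : ℕ) : ℤ) := monomial_mem_degLT 0 (by simp [wt])
  rw [← MvPowerSeries.coeff_zero_eq_constantCoeff_apply,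
    coeff_normalExp e h1 (A := 1) (by simp [wt])]
  simp [cre_zero, ann_zero]

/-- The contraction of an annihilating exponential and a creating one. -/
def contr (q t : K) (d c : ℕ → K) : PowerSeries K :=
  expSeries K (PowerSeries.mk fun n => if n = 0 then 0 else kap q t n * d n * c n)

/-- The constant term kills the creating part of the current, and the vector produced from the
vacuum is an eigenvector of the annihilating part. -/
theorem vev_modeHat_normalExp (e e' : Exponents K) (k : ℤ) :
    MvPowerSeries.constantCoeff (modeHat q t e k (normalExp q t e' 1)) =
      coeffZ (-k) (contr q t e.2 e'.1) := by
  rw [← MvPowerSeries.coeff_zero_eq_constantCoeff_apply, coeff_modeHat e k _ (B := 1) (by simp [wt]),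
    sum_range_one, Nat.cast_zero, cre_zero, Module.End.one_apply, zero_sub]
  rcases lt_or_ge (-k) 0 with hk | hk
  · rw [ann_of_neg _ _ hk, coeffZ_of_neg hk]; simp
  · generalize -k = j at hk
    lift j to ℕ using hk
    rw [ann_natCast, coeffZ_natCast, annihilation, expSeries_apply_eigen (l := PowerSeries.mk
      fun n => if n = 0 then 0 else kap q t n * e.2 n * e'.1 n), map_smul,
      MvPowerSeries.coeff_zero_eq_constantCoeff_apply, constantCoeff_normalExp, smul_eq_mul, mul_one]
    · rfl
    · intro m
      rw [PowerSeries.coeff_mk, PowerSeries.coeff_mk]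
      split_ifs with hm
      · simp
      · lift m to ℕ+ using Nat.pos_of_ne_zero hm
        rw [LinearMap.smul_apply, pos_normalExp, heis_pos_one, map_zero, zero_add, smul_smul]
        ring_nf

/-- Dually, the annihilating part of the current disappears on the vacuum, and the constant term
after the exponential is an eigenfunctional for the creating part. -/
theorem vev_normalExp_modeF (e e' : Exponents K) (k : ℤ) :
    MvPowerSeries.constantCoeff (normalExp q t e' (modeF q t e k 1)) =
      coeffZ k (contr q t e'.2 e.1) := by
  have h1 : (1 : Fock K) ∈ degLT K ((1 : ℕ) : ℤ) := monomial_mem_degLT 0 (by simp [wt])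
  rw [modeF_apply e k h1, sum_range_one, Nat.cast_zero, ann_zero, Module.End.one_apply, add_zero]
  rcases lt_or_ge k 0 with hk | hk
  · rw [cre_of_neg _ _ hk, coeffZ_of_neg hk]; simp
  · lift k to ℕ using hk
    have := expSeries_comp_eigen (φ := (MvPowerSeries.coeff 0 : FockHat K →ₗ[K] K) ∘ₗ
      normalExp q t e') (f := PowerSeries.mk fun n => if n = 0 then 0 else e.1 n •
        heis q t (-(n : ℤ)))
      (l := PowerSeries.mk fun n => if n = 0 then 0 else kap q t n * e'.2 n * e.1 n) ?_ k 1
    · rw [cre_natCast, coeffZ_natCast, creation, ← MvPowerSeries.coeff_zero_eq_constantCoeff_apply]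
      refine this.trans ?_
      rw [LinearMap.comp_apply, MvPowerSeries.coeff_zero_eq_constantCoeff_apply,
        constantCoeff_normalExp, smul_eq_mul, mul_one]
      rfl
    · intro m v
      rw [PowerSeries.coeff_mk, PowerSeries.coeff_mk]
      split_ifs with hm
      · simp
      · lift m to ℕ+ using Nat.pos_of_ne_zero hm
        have h2 := neg_normalExp (q := q) (t := t) e' m v
        rw [← sub_eq_iff_eq_add] at h2
        rw [LinearMap.smul_apply, map_smul, LinearMap.comp_apply, ← h2, map_sub, map_smul,
          LinearMap.comp_apply]
        simp only [MvPowerSeries.coeff_zero_eq_constantCoeff_apply, constantCoeff_heisHat_neg,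
          smul_eq_mul]
        ring

theorem contr_zero_right (d : ℕ → K) : contr q t d 0 = 1 := by
  rw [contr, ← expSeries_zero (K := K)]
  congr 1
  ext n
  simp

theorem contr_zero_left (c : ℕ → K) : contr q t 0 c = 1 := by
  rw [contr, ← expSeries_zero (K := K)]
  congr 1
  ext n
  simp

/-- The operators `∑_{l ≥ 0} b_l e_{k + l}`, where `e_j` is the coefficient of `z^j` of the current
with exponents `e`. -/
def convHat (q t : K) (e : Exponents K) (b : PowerSeries K) (k : ℤ) : Module.End K (FockHat K) :=
  ofCoeffsLin fun m => ∑ l ∈ range (wt m + 1 - k).toNat,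
    PowerSeries.coeff l b • (MvPowerSeries.coeff m : FockHat K →ₗ[K] K) ∘ₗ modeHat q t e (k + l)

theorem coeff_convHat (e : Exponents K) (b : PowerSeries K) (k : ℤ) (F : FockHat K)
    {m : ℕ+ →₀ ℕ} {B : ℕ} (hB : wt m < k + B) :
    MvPowerSeries.coeff m (convHat q t e b k F) =
      ∑ l ∈ range B, PowerSeries.coeff l b * MvPowerSeries.coeff m (modeHat q t e (k + l) F) := by
  have h1 : MvPowerSeries.coeff m (convHat q t e b k F) = ∑ l ∈ range (wt m + 1 - k).toNat,
      PowerSeries.coeff l b * MvPowerSeries.coeff m (modeHat q t e (k + l) F) := by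
    change (∑ l ∈ range (wt m + 1 - k).toNat, _ : FockHat K →ₗ[K] K) F = _
    rw [LinearMap.sum_apply]
    rfl
  rw [h1]
  refine sum_subset (range_subset_range.2 (by omega)) fun l _ hl => ?_
  rw [mem_range] at hl
  rw [coeff_modeHat_eq_zero e F (by omega), mul_zero]

theorem pos_mul_convHat (e : Exponents K) (b : PowerSeries K) (k : ℤ) (n : ℕ+) :
    heisHat q t n * convHat q t e b k =
      convHat q t e b k * heisHat q t n + (kap q t n * e.1 n) • convHat q t e b (k - n) := by
  refine LinearMap.ext fun F => MvPowerSeries.ext fun m => ?_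
  obtain ⟨B, hB⟩ : ∃ B : ℕ, (wt m : ℤ) + n < k + B :=
    ⟨(wt m + n + 1 - k).toNat, by omega⟩
  rw [Module.End.mul_apply, LinearMap.add_apply, Module.End.mul_apply, LinearMap.smul_apply,
    map_add, map_smul, coeff_heisHat_pos,
    coeff_convHat e b k F (B := B) (by rw [wt_add, wt_single]; push_cast; omega),
    coeff_convHat e b k _ (B := B) (by omega), coeff_convHat e b (k - n) F (B := B) (by omega),
    mul_sum, smul_sum, ← sum_add_distrib]
  refine sum_congr rfl fun l _ => ?_
  have h := congrArg (fun T => MvPowerSeries.coeff m (T F)) (pos_mul_modeHat (q := q) (t := t) e (k + l) n)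
  simp only [Module.End.mul_apply, LinearMap.add_apply, LinearMap.smul_apply, map_add, map_smul,
    coeff_heisHat_pos, smul_eq_mul] at h
  rw [smul_eq_mul, mul_left_comm, h, show k - (n : ℤ) + l = k + l - n by ring]
  ring

theorem neg_mul_convHat (e : Exponents K) (b : PowerSeries K) (k : ℤ) (n : ℕ+) :
    heisHat q t (-n) * convHat q t e b k =
      convHat q t e b k * heisHat q t (-n) + (-(kap q t n * e.2 n)) • convHat q t e b (k + n) := by
  refine LinearMap.ext fun F => MvPowerSeries.ext fun m => ?_
  obtain ⟨B, hB⟩ : ∃ B : ℕ, (wt m : ℤ) + n < k + B :=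
    ⟨(wt m + n + 1 - k).toNat, by omega⟩
  have h1 : MvPowerSeries.coeff m (heisHat q t (-n) (convHat q t e b k F)) =
      ∑ l ∈ range B, PowerSeries.coeff l b * MvPowerSeries.coeff m (heisHat q t (-n)
        (modeHat q t e (k + l) F)) := by
    simp_rw [coeff_heisHat_neg]
    split_ifs with h
    · exact coeff_convHat e b k F (by have := wt_sub_single h; omega)
    · simp
  rw [Module.End.mul_apply, LinearMap.add_apply, Module.End.mul_apply, LinearMap.smul_apply,
    map_add, map_smul, h1,
    coeff_convHat e b k _ (B := B) (by omega), coeff_convHat e b (k + n) F (B := B) (by omega),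
    smul_sum, ← sum_add_distrib]
  refine sum_congr rfl fun l _ => ?_
  have h := congrArg (fun T => MvPowerSeries.coeff m (T F)) (neg_mul_modeHat (q := q) (t := t) e (k + l) n)
  simp only [Module.End.mul_apply, LinearMap.add_apply, LinearMap.smul_apply, map_add, map_smul,
    smul_eq_mul] at h
  rw [smul_eq_mul, h, show k + (n : ℤ) + l = k + l + n by ring]
  ring

theorem isVertex_convHat_normalExp (e e' : Exponents K) (b : PowerSeries K) :
    IsVertex q t e e' fun k => convHat q t e b k ∘ₗ normalExp q t e' where
  pos n k f := by
    simp only [LinearMap.comp_apply]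
    rw [← Module.End.mul_apply, pos_mul_convHat, LinearMap.add_apply, Module.End.mul_apply,
      pos_normalExp, map_add, map_smul, LinearMap.smul_apply]
    abel
  neg n k f := by
    simp only [LinearMap.comp_apply]
    rw [← Module.End.mul_apply, neg_mul_convHat, LinearMap.add_apply, Module.End.mul_apply,
      neg_normalExp, map_add, map_smul, LinearMap.smul_apply]
    abel

/-- Weighting the modes by `b` multiplies the contraction by `b`; this is how eigenvalues of ψ^+
enter. -/
theorem vev_convHat_normalExp (e e' : Exponents K) (b : PowerSeries K) (k : ℤ) :
    MvPowerSeries.constantCoeff (convHat q t e b k (normalExp q t e' 1)) =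
      coeffZ (-k) (b * contr q t e.2 e'.1) := by
  rw [← MvPowerSeries.coeff_zero_eq_constantCoeff_apply,
    coeff_convHat e b k _ (B := (1 - k).toNat) (by simp [wt]; omega)]
  simp_rw [MvPowerSeries.coeff_zero_eq_constantCoeff_apply, vev_modeHat_normalExp]
  rcases lt_or_ge (-k) 0 with hk | hk
  · rw [show (1 - k).toNat = 0 by omega, coeffZ_of_neg hk, sum_range_zero]
  · obtain ⟨j, hj⟩ := Int.eq_ofNat_of_zero_le hk
    rw [hj, show (1 - k).toNat = j + 1 by omega, show ((j : ℕ) : ℤ) = Int.ofNat j from rfl]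
    rw [show Int.ofNat j = ((j : ℕ) : ℤ) from rfl, coeffZ_natCast, PowerSeries.coeff_mul,
      Nat.sum_antidiagonal_eq_sum_range_succ
        (fun i j => PowerSeries.coeff i b * PowerSeries.coeff j (contr q t e.2 e'.1))]
    refine sum_congr rfl fun l hl => ?_
    rw [mem_range] at hl
    rw [show -(k + (l : ℤ)) = ((j - l : ℕ) : ℤ) by omega, coeffZ_natCast]

/-- Summing the modes of a creating current with geometric weights. -/
theorem convHat_geometric_normalExp (hκ : ∀ n : ℕ+, kap q t n ≠ 0) (c : ℕ → K) (e' : Exponents K)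
    (y : K) :
    convHat q t (c, 0) (PowerSeries.mk fun l => y ^ l) 0 ∘ₗ normalExp q t e' =
      normalExp q t (Exponents.evalAt (c, 0) y + e') := by
  have hneg : ∀ (k : ℤ), k < 0 → modeHat q t (c, 0) k = 0 := fun k hk => by
    rw [modeHat_creating, cre_of_neg _ _ hk]
  -- A creating current has no modes of negative degree, so the first n terms vanish and a factor
  -- y^n comes out of the geometric weights.
  have hshift : ∀ n : ℕ+, convHat q t (c, 0) (PowerSeries.mk fun l => y ^ l) (0 - n) =
      y ^ (n : ℕ) • convHat q t (c, 0) (PowerSeries.mk fun l => y ^ l) 0 := by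
    intro n
    refine LinearMap.ext fun F => MvPowerSeries.ext fun m => ?_
    rw [LinearMap.smul_apply, map_smul,
      coeff_convHat _ _ _ F (B := n + (wt m + 1)) (by push_cast; omega),
      coeff_convHat _ _ _ F (B := wt m + 1) (by push_cast; omega), sum_range_add, sum_eq_zero,
      zero_add, smul_sum]
    · refine sum_congr rfl fun l _ => ?_
      rw [PowerSeries.coeff_mk, PowerSeries.coeff_mk, pow_add, smul_eq_mul, mul_assoc,
        show 0 - ((n : ℕ) : ℤ) + ((n + l : ℕ) : ℤ) = 0 + l by push_cast; ring]
    · intro l hl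
      rw [mem_range] at hl
      rw [hneg _ (by omega), LinearMap.zero_apply, map_zero, mul_zero]
  -- By the preceding identity the shift of the mode is multiplication by y^n. The operator is
  -- therefore a constant family with zero current, the exponents at y having moved into the second
  -- argument.
  have hV : IsVertex q t 0 (Exponents.evalAt (c, 0) y + e') fun _ =>
      convHat q t (c, 0) (PowerSeries.mk fun l => y ^ l) 0 ∘ₗ normalExp q t e' := by
    have h := isVertex_convHat_normalExp (q := q) (t := t) (c, 0) e' (PowerSeries.mk fun l => y ^ l)
    constructor
    · intro n k f
      have := h.pos n 0 f
      rw [hshift] at this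
      rw [this]
      simp only [Exponents.evalAt, LinearMap.comp_apply, LinearMap.smul_apply, Prod.fst_add,
        Pi.add_apply, Prod.fst_zero, Pi.zero_apply, mul_zero, zero_smul, add_zero, mul_add,
        add_smul, smul_smul, add_assoc, mul_assoc]
    · intro n k f
      rw [h.neg n 0 f]
      simp [Exponents.evalAt]
  have hN : IsVertex q t 0 (Exponents.evalAt (c, 0) y + e') fun _ =>
      normalExp q t (Exponents.evalAt (c, 0) y + e') := by
    constructor
    · intro n k f
      rw [pos_normalExp]; simp
    · intro n k f
      rw [neg_normalExp]; simp
  have := (hV.sub hN).eq_zero hκ (fun k => ?_) 0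
  · rwa [sub_eq_zero] at this
  · rw [LinearMap.sub_apply, map_sub, LinearMap.comp_apply,
      vev_convHat_normalExp, neg_zero, ← Nat.cast_zero, coeffZ_natCast, contr_zero_left]
    simp [constantCoeff_normalExp]

end Vertex

/-! ### Adding and removing boxes of Young diagrams. -/

section Diagrams

/-- `mu` is obtained from `lam` by adding a box to row `i`. -/
def IsAdd (lam : YoungDiagram) (i : ℕ) (mu : YoungDiagram) : Prop :=
  mu.cells = insert (i, lam.rowLen i) lam.cells

variable {lam mu : YoungDiagram} {i : ℕ}

theorem lt_rowLen_iff_lt_colLen (lam : YoungDiagram) (i j : ℕ) :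
    j < lam.rowLen i ↔ i < lam.colLen j := by
  rw [← YoungDiagram.mem_iff_lt_rowLen, YoungDiagram.mem_iff_lt_colLen]

theorem rowLen_eq_zero (lam : YoungDiagram) {k : ℕ} (h : lam.colLen 0 ≤ k) : lam.rowLen k = 0 := by
  have := lt_rowLen_iff_lt_colLen lam k 0
  omega

theorem addBox_eq_some : addBox lam i = some mu ↔ IsAdd lam i mu := by
  rw [addBox, IsAdd]
  split_ifs with h
  · rw [Option.some_inj]
    constructor
    · rintro rfl; rfl
    · intro h'; exact YoungDiagram.ext h'.symm
  · refine ⟨fun h' => by simp at h', fun h' => (h ?_).elim⟩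
    rw [← h']; exact mu.isLowerSet

theorem IsAdd.mem_iff (h : IsAdd lam i mu) (k j : ℕ) :
    (k, j) ∈ mu ↔ (k = i ∧ j = lam.rowLen i) ∨ (k, j) ∈ lam := by
  rw [← YoungDiagram.mem_cells, h, mem_insert, Prod.mk.injEq, YoungDiagram.mem_cells]

theorem IsAdd.rowLen_self (h : IsAdd lam i mu) : mu.rowLen i = lam.rowLen i + 1 := by
  have : ∀ j, j < mu.rowLen i ↔ j < lam.rowLen i + 1 := by
    intro j
    rw [← YoungDiagram.mem_iff_lt_rowLen, h.mem_iff, YoungDiagram.mem_iff_lt_rowLen]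
    omega
  have h1 := this (mu.rowLen i)
  have h2 := this (lam.rowLen i + 1)
  omega

theorem IsAdd.rowLen_of_ne (h : IsAdd lam i mu) {k : ℕ} (hk : k ≠ i) :
    mu.rowLen k = lam.rowLen k := by
  have : ∀ j, j < mu.rowLen k ↔ j < lam.rowLen k := by
    intro j
    rw [← YoungDiagram.mem_iff_lt_rowLen, h.mem_iff, YoungDiagram.mem_iff_lt_rowLen]
    omega
  have h1 := this (mu.rowLen k)
  have h2 := this (lam.rowLen k)
  omega

theorem IsAdd.rowLen_lt (h : IsAdd lam i mu) {k : ℕ} (hk : k < i) :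
    lam.rowLen i < lam.rowLen k := by
  have := mu.rowLen_anti k i hk.le
  rw [h.rowLen_self, h.rowLen_of_ne hk.ne] at this
  exact this

/-- The rows above the new box are strictly longer than row i, so the box is placed at the foot of
its column. This makes the relation symmetric under transposition. -/
theorem IsAdd.colLen_rowLen (h : IsAdd lam i mu) : lam.colLen (lam.rowLen i) = i := by
  have h1 := lt_rowLen_iff_lt_colLen lam i (lam.rowLen i)
  rcases Nat.eq_zero_or_pos i with rfl | hi
  · omega
  · have h2 := lt_rowLen_iff_lt_colLen lam (i - 1) (lam.rowLen i)
    have := h.rowLen_lt (k := i - 1) (by omega)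
    omega

theorem IsAdd.transpose (h : IsAdd lam i mu) : IsAdd lam.transpose (lam.rowLen i) mu.transpose := by
  rw [IsAdd, YoungDiagram.rowLen_transpose, h.colLen_rowLen]
  ext ⟨a, b⟩
  rw [mem_insert, YoungDiagram.mem_cells, YoungDiagram.mem_cells, YoungDiagram.mem_transpose,
    YoungDiagram.mem_transpose, Prod.swap_prod_mk, h.mem_iff, Prod.mk.injEq]
  tauto

theorem IsAdd.colLen_self (h : IsAdd lam i mu) : mu.colLen (lam.rowLen i) = i + 1 := by
  have := h.transpose.rowLen_self
  rwa [YoungDiagram.rowLen_transpose, YoungDiagram.rowLen_transpose, h.colLen_rowLen] at this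

theorem IsAdd.colLen_of_ne (h : IsAdd lam i mu) {j : ℕ} (hj : j ≠ lam.rowLen i) :
    mu.colLen j = lam.colLen j := by
  have := h.transpose.rowLen_of_ne hj
  rwa [YoungDiagram.rowLen_transpose, YoungDiagram.rowLen_transpose] at this

theorem IsAdd.lt_colLen (h : IsAdd lam i mu) : i < mu.colLen 0 := by
  rw [← lt_rowLen_iff_lt_colLen, h.rowLen_self]
  omega

theorem IsAdd.colLen_le (h : IsAdd lam i mu) : lam.colLen 0 ≤ mu.colLen 0 := by
  by_contra! hlt
  have h1 := (lt_rowLen_iff_lt_colLen lam (mu.colLen 0) 0).2 hlt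
  have h2 := rowLen_eq_zero mu le_rfl
  by_cases hk : mu.colLen 0 = i
  · rw [hk, h.rowLen_self] at h2; omega
  · rw [h.rowLen_of_ne hk] at h2; omega

theorem IsAdd.le_colLen (h : IsAdd lam i mu) : i ≤ lam.colLen 0 := by
  by_cases h0 : lam.rowLen i = 0
  · rw [← h0, h.colLen_rowLen]
  · have := (lt_rowLen_iff_lt_colLen lam i 0).1 (by omega)
    omega

theorem IsAdd.colLen_le_succ (h : IsAdd lam i mu) : mu.colLen 0 ≤ lam.colLen 0 + 1 := by
  by_cases hj : 0 = lam.rowLen i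
  · rw [hj, h.colLen_self, h.colLen_rowLen]
  · rw [h.colLen_of_ne hj]; omega

theorem IsAdd.not_mem (lam : YoungDiagram) (i : ℕ) : (i, lam.rowLen i) ∉ lam.cells := by
  rw [YoungDiagram.mem_cells, YoungDiagram.mem_iff_lt_rowLen]
  omega

theorem IsAdd.card (h : IsAdd lam i mu) : mu.card = lam.card + 1 := by
  change mu.cells.card = lam.cells.card + 1
  rw [h, card_insert_of_notMem (IsAdd.not_mem lam i)]

theorem removeBox_eq_some : removeBox mu i = some lam ↔ IsAdd lam i mu := by
  rw [removeBox]
  constructor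
  · intro h
    split_ifs at h with h1
    rw [Option.some_inj] at h
    have hc : lam.cells = mu.cells.erase (i, mu.rowLen i - 1) := by rw [← h]
    have hm : (i, mu.rowLen i - 1) ∈ mu.cells := by
      rw [YoungDiagram.mem_cells, YoungDiagram.mem_iff_lt_rowLen]; omega
    have hr : lam.rowLen i = mu.rowLen i - 1 := by
      have : ∀ j, j < lam.rowLen i ↔ j < mu.rowLen i - 1 := by
        intro j
        rw [← YoungDiagram.mem_iff_lt_rowLen, ← YoungDiagram.mem_cells, hc, mem_erase,
          YoungDiagram.mem_cells, YoungDiagram.mem_iff_lt_rowLen, Ne, Prod.mk.injEq]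
        omega
      have h2 := this (lam.rowLen i)
      have h3 := this (mu.rowLen i - 1)
      omega
    rw [IsAdd, hr, hc, insert_erase hm]
  · intro h
    have hc : mu.cells.erase (i, mu.rowLen i - 1) = lam.cells := by
      rw [h.rowLen_self, Nat.add_sub_cancel, h, erase_insert (IsAdd.not_mem lam i)]
    have h1 : 0 < mu.rowLen i ∧
        IsLowerSet (↑(mu.cells.erase (i, mu.rowLen i - 1)) : Set (ℕ × ℕ)) := by
      refine ⟨by rw [h.rowLen_self]; omega, ?_⟩
      rw [hc]; exact lam.isLowerSet
    rw [dif_pos h1, Option.some_inj]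
    exact YoungDiagram.ext hc

theorem exists_isAdd (h : ∀ k < i, lam.rowLen i < lam.rowLen k) : ∃ mu, IsAdd lam i mu := by
  refine ⟨⟨insert (i, lam.rowLen i) lam.cells, ?_⟩, rfl⟩
  rintro ⟨a, b⟩ ⟨a', b'⟩ hle hab
  rw [Prod.mk_le_mk] at hle
  rw [mem_coe, mem_insert, Prod.mk.injEq, YoungDiagram.mem_cells,
    YoungDiagram.mem_iff_lt_rowLen] at hab ⊢
  rcases hab with ⟨rfl, rfl⟩ | hab
  · rcases hle.1.lt_or_eq with h1 | h1
    · right; have := h a' h1; omega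
    · subst h1; omega
  · right
    have := lam.rowLen_anti a' a hle.1
    omega

theorem exists_isAdd_of_rowLen_lt (h : mu.rowLen (i + 1) < mu.rowLen i) :
    ∃ lam, IsAdd lam i mu := by
  have hl : IsLowerSet (↑(mu.cells.erase (i, mu.rowLen i - 1)) : Set (ℕ × ℕ)) := by
    rintro ⟨a, b⟩ ⟨a', b'⟩ hle hab
    rw [Prod.mk_le_mk] at hle
    rw [mem_coe, mem_erase, Ne, Prod.mk.injEq, YoungDiagram.mem_cells,
      YoungDiagram.mem_iff_lt_rowLen] at hab ⊢
    have h1 := mu.rowLen_anti a' a hle.1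
    refine ⟨?_, by omega⟩
    rintro ⟨rfl, rfl⟩
    rcases hle.1.lt_or_eq with h2 | h2
    · have := mu.rowLen_anti (a' + 1) a h2; omega
    · subst h2; omega
  refine ⟨⟨_, hl⟩, removeBox_eq_some.1 ?_⟩
  rw [removeBox, dif_pos ⟨by omega, hl⟩]

/-- The only obstruction is a row of equal length immediately above. In terms of nodes this is the
coincidence that kills the corresponding residue. -/
theorem addBox_eq_none (h : addBox lam i = none) : ∃ k, i = k + 1 ∧ lam.rowLen k = lam.rowLen i := by
  have h1 : ¬ ∀ k < i, lam.rowLen i < lam.rowLen k := by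
    intro h'
    obtain ⟨mu, hmu⟩ := exists_isAdd h'
    rw [addBox_eq_some.2 hmu] at h
    simp at h
  push Not at h1
  obtain ⟨k, hk, hk'⟩ := h1
  refine ⟨i - 1, by omega, ?_⟩
  have h2 := lam.rowLen_anti (i - 1) i (by omega)
  have h3 := lam.rowLen_anti k (i - 1) (by omega)
  omega

theorem removeBox_eq_none (h : removeBox mu i = none) : mu.rowLen (i + 1) = mu.rowLen i := by
  by_contra h1
  have := mu.rowLen_anti i (i + 1) (by omega)
  obtain ⟨lam, hl⟩ := exists_isAdd_of_rowLen_lt (mu := mu) (i := i) (by omega)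
  rw [removeBox_eq_some.2 hl] at h
  simp at h

/-- The last row of a nonempty diagram ends in a removable box. -/
theorem exists_isAdd_of_ne_bot (h : mu ≠ ⊥) : ∃ lam i, IsAdd lam i mu := by
  by_cases h0 : mu.colLen 0 = 0
  · refine (h (YoungDiagram.ext ?_)).elim
    rw [YoungDiagram.cells_bot, eq_empty_iff_forall_notMem]
    rintro ⟨a, b⟩ hab
    rw [YoungDiagram.mem_cells, YoungDiagram.mem_iff_lt_rowLen, rowLen_eq_zero mu (by omega)] at hab
    omega
  · obtain ⟨lam, hl⟩ := exists_isAdd_of_rowLen_lt (mu := mu) (i := mu.colLen 0 - 1) (by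
      rw [rowLen_eq_zero mu (by omega), lt_rowLen_iff_lt_colLen]; omega)
    exact ⟨lam, _, hl⟩

theorem mem_neighbours_self (mu : YoungDiagram) : mu ∈ neighbours mu := by
  simp [neighbours]

theorem IsAdd.mem_neighbours (h : IsAdd lam i mu) : lam ∈ neighbours mu := by
  classical
  have : some lam ∈ (range (mu.colLen 0)).image (removeBox mu) :=
    mem_image.2 ⟨i, mem_range.2 h.lt_colLen, removeBox_eq_some.2 h⟩
  simp only [neighbours, mem_insert, mem_eraseNone, mem_union]
  right; right
  convert this

theorem IsAdd.mem_neighbours' (h : IsAdd lam i mu) : mu ∈ neighbours lam := by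
  classical
  have : some mu ∈ (range (lam.colLen 0 + 1)).image (addBox lam) :=
    mem_image.2 ⟨i, mem_range.2 (Nat.lt_succ_of_le h.le_colLen), addBox_eq_some.2 h⟩
  simp only [neighbours, mem_insert, mem_eraseNone, mem_union]
  right; left
  convert this

theorem nStat_eq {L : ℕ} (h : lam.colLen 0 ≤ L) : nStat lam = ∑ k ∈ range L, k * lam.rowLen k := by
  refine sum_subset (range_subset_range.2 h) fun k _ hk => ?_
  rw [mem_range, not_lt] at hk
  rw [rowLen_eq_zero lam hk, mul_zero]

theorem IsAdd.nStat (h : IsAdd lam i mu) : nStat mu = nStat lam + i := by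
  rw [nStat_eq le_rfl, nStat_eq h.colLen_le,
    ← add_sum_erase _ _ (mem_range.2 h.lt_colLen), ← add_sum_erase (range (mu.colLen 0)) _
      (mem_range.2 h.lt_colLen), h.rowLen_self, sum_congr rfl fun k hk => by
      rw [h.rowLen_of_ne (mem_erase.1 hk).1]]
  ring

theorem IsAdd.nStat_transpose (h : IsAdd lam i mu) :
    Toroidal.nStat mu.transpose = Toroidal.nStat lam.transpose + lam.rowLen i :=
  h.transpose.nStat

theorem mem_cells_iff {L : ℕ} (hL : lam.colLen 0 ≤ L) (p : ℕ × ℕ) :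
    p ∈ lam.cells ↔ p.1 ∈ range L ∧ p.2 ∈ range (lam.rowLen p.1) := by
  rw [YoungDiagram.mem_cells, mem_range, mem_range]
  rw [show (p ∈ lam) = ((p.1, p.2) ∈ lam) from rfl, YoungDiagram.mem_iff_lt_rowLen]
  refine ⟨fun h => ⟨?_, h⟩, fun h => h.2⟩
  have := (lt_rowLen_iff_lt_colLen lam p.1 0).1 (by omega)
  omega

theorem prod_cells {M : Type*} [CommMonoid M] {L : ℕ} (hL : lam.colLen 0 ≤ L) (f : ℕ × ℕ → M) :
    ∏ s ∈ lam.cells, f s = ∏ k ∈ range L, ∏ j ∈ range (lam.rowLen k), f (k, j) :=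
  prod_finset_product _ _ _ (mem_cells_iff hL)

theorem sum_cells {M : Type*} [AddCommMonoid M] {L : ℕ} (hL : lam.colLen 0 ≤ L) (f : ℕ × ℕ → M) :
    ∑ s ∈ lam.cells, f s = ∑ k ∈ range L, ∑ j ∈ range (lam.rowLen k), f (k, j) :=
  sum_finset_product _ _ _ (mem_cells_iff hL)

end Diagrams

/-- `q` and `t` are multiplicatively independent. -/
structure Generic {K : Type*} [Field K] (q t : K) : Prop where
  q_ne : q ≠ 0
  t_ne : t ≠ 0
  eq_zero {a b : ℤ} : q ^ a * t ^ b = 1 → a = 0 ∧ b = 0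

/-! ### Hook products and the matrix coefficients A^± as residues. -/

section Hooks

variable {K : Type*} [Field K] {q t : K}

/-- `1 - q^a t^b` -/
def om (q t : K) (a b : ℤ) : K := 1 - q ^ a * t ^ b

theorem Generic.om_ne (h : Generic q t) {a b : ℤ} (hab : a ≠ 0 ∨ b ≠ 0) : om q t a b ≠ 0 := by
  intro h0
  have := h.eq_zero (sub_eq_zero.1 h0).symm
  omega

theorem Generic.om_neg (h : Generic q t) (a b : ℤ) :
    om q t a b = -(q ^ a * t ^ b) * om q t (-a) (-b) := by
  have h1 : q ^ a ≠ 0 := zpow_ne_zero _ h.q_ne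
  have h2 : t ^ b ≠ 0 := zpow_ne_zero _ h.t_ne
  rw [om, om, zpow_neg, zpow_neg]
  field_simp
  ring

variable {lam mu : YoungDiagram} {i L : ℕ}

/-- The contribution of row `k` to `c'_lam`. -/
def rowHook (q t : K) (lam : YoungDiagram) (k : ℕ) : K :=
  ∏ j ∈ range (lam.rowLen k), om q t ((lam.rowLen k : ℤ) - j) ((lam.colLen j : ℤ) - k - 1)

theorem cLam'_eq (q t : K) (hL : lam.colLen 0 ≤ L) :
    cLam' q t lam = ∏ k ∈ range L, rowHook q t lam k := by
  rw [cLam', prod_cells hL]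
  refine prod_congr rfl fun k _ => prod_congr rfl fun j hj => ?_
  rw [mem_range] at hj
  have := (lt_rowLen_iff_lt_colLen lam k j).1 hj
  rw [om, arm, leg, ← zpow_natCast, ← zpow_natCast]
  congr 3 <;> simp only <;> omega

theorem prod_Ico_div_succ {f : ℕ → K} {a b : ℕ} (hab : a ≤ b) (hf : ∀ j ∈ Icc a b, f j ≠ 0) :
    ∏ j ∈ Ico a b, f j / f (j + 1) = f a / f b := by
  induction b, hab using Nat.le_induction with
  | base => rw [Ico_self, prod_empty, div_self (hf a (by simp))]
  | succ b hab ih =>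
    have h1 : f b ≠ 0 := hf b (by simp; omega)
    rw [prod_Ico_succ_top hab, ih fun j hj => hf j (by simp at hj ⊢; omega)]
    field_simp

/-- In a row above the new box only the hook in its column changes, its leg growing by one. -/
theorem IsAdd.rowHook_lt (h : IsAdd lam i mu) (hg : Generic q t) {k : ℕ} (hk : k < i) :
    rowHook q t mu k = rowHook q t lam k *
      (om q t ((lam.rowLen k : ℤ) - lam.rowLen i) ((i : ℤ) - k) /
        om q t ((lam.rowLen k : ℤ) - lam.rowLen i) ((i : ℤ) - k - 1)) := by
  have hlt := h.rowLen_lt hk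
  have hm : lam.rowLen i ∈ range (lam.rowLen k) := mem_range.2 hlt
  rw [rowHook, rowHook, h.rowLen_of_ne hk.ne, ← mul_prod_erase _ _ hm, ← mul_prod_erase _ _ hm,
    h.colLen_self, h.colLen_rowLen, prod_congr rfl fun j hj => by
      rw [h.colLen_of_ne (mem_erase.1 hj).1]]
  have h1 : om q t ((lam.rowLen k : ℤ) - lam.rowLen i) ((i : ℤ) - k - 1) ≠ 0 :=
    hg.om_ne (by omega)
  rw [show (((i + 1 : ℕ) : ℤ) - k - 1) = i - k by push_cast; ring]
  field_simp

/-- Lower rows are no longer than the old row i, so they do not meet the column of the new box. -/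
theorem IsAdd.rowHook_gt (h : IsAdd lam i mu) {k : ℕ} (hk : i < k) :
    rowHook q t mu k = rowHook q t lam k := by
  rw [rowHook, rowHook, h.rowLen_of_ne hk.ne']
  refine prod_congr rfl fun j hj => ?_
  have := lam.rowLen_anti i k hk.le
  rw [h.colLen_of_ne (by have := mem_range.1 hj; omega)]

/-- This is the effect on the hooks of row i of lengthening its arms by one. Columns of equal height
form blocks, one for each row length, and within a block the quotients telescope; the induction
starts below the last row. -/
theorem prod_row_telescope (hg : Generic q t) (lam : YoungDiagram) (i : ℕ)
    (hL : lam.colLen 0 ≤ L) {k : ℕ} (hik : i ≤ k) (hk : k ≤ L) :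
    ∏ j ∈ range (lam.rowLen k),
      om q t ((lam.rowLen i : ℤ) + 1 - j) ((lam.colLen j : ℤ) - i - 1) /
        om q t ((lam.rowLen i : ℤ) - j) ((lam.colLen j : ℤ) - i - 1) =
    ∏ l ∈ Ico k L, om q t ((lam.rowLen i : ℤ) + 1 - lam.rowLen (l + 1)) ((l : ℤ) - i) /
        om q t ((lam.rowLen i : ℤ) + 1 - lam.rowLen l) ((l : ℤ) - i) := by
  induction hk using Nat.decreasingInduction with
  | self => rw [rowLen_eq_zero lam hL, range_zero, Ico_self, prod_empty, prod_empty]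
  | of_succ k hk ih =>
    have h1 : lam.rowLen (k + 1) ≤ lam.rowLen k := lam.rowLen_anti _ _ (by omega)
    have h2 : lam.rowLen k ≤ lam.rowLen i := lam.rowLen_anti _ _ hik
    rw [prod_eq_prod_Ico_succ_bot hk, ← ih (by omega), ← prod_range_mul_prod_Ico _ h1, mul_comm]
    congr 1
    rw [← prod_Ico_div_succ (f := fun j : ℕ => om q t ((lam.rowLen i : ℤ) + 1 - j) ((k : ℤ) - i)) h1]
    · refine prod_congr rfl fun j hj => ?_
      rw [mem_Ico] at hj
      have h3 := lt_rowLen_iff_lt_colLen lam k j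
      have h4 := lt_rowLen_iff_lt_colLen lam (k + 1) j
      -- The columns with λ_{k+1} ≤ j < λ_k, rows being numbered from 0, all have height k + 1.
      rw [show lam.colLen j = k + 1 by omega]
      congr 2 <;> push_cast <;> ring
    · intro j hj
      rw [mem_Icc] at hj
      exact hg.om_ne (by omega)

/-- `∏_{k ≥ i} (1 - q^{lam_{k+1} - lam_i - 1} t^{i-k})` -/
def hookNum (q t : K) (lam : YoungDiagram) (i L : ℕ) : K :=
  ∏ k ∈ Ico i L, om q t ((lam.rowLen (k + 1) : ℤ) - lam.rowLen i - 1) ((i : ℤ) - k)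

/-- `∏_{k > i} (1 - q^{lam_k - lam_i - 1} t^{i-k})` -/
def hookDen (q t : K) (lam : YoungDiagram) (i L : ℕ) : K :=
  ∏ k ∈ Ico (i + 1) L, om q t ((lam.rowLen k : ℤ) - lam.rowLen i - 1) ((i : ℤ) - k)

theorem hookDen_ne_zero (hg : Generic q t) : hookDen q t lam i L ≠ 0 :=
  prod_ne_zero_iff.2 fun k hk => hg.om_ne (by rw [mem_Ico] at hk; omega)

theorem IsAdd.rowHook_self (h : IsAdd lam i mu) (hg : Generic q t) (hL : mu.colLen 0 ≤ L) :
    rowHook q t mu i = rowHook q t lam i *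
      (-q ^ (lam.rowLen i + 1) * (hookNum q t lam i L / hookDen q t lam i L)) := by
  have hi : i < L := h.lt_colLen.trans_le hL
  have hL' : lam.colLen 0 ≤ L := h.colLen_le.trans hL
  have e1 : rowHook q t mu i = rowHook q t lam i * (om q t 1 0 *
      ∏ j ∈ range (lam.rowLen i),
        om q t ((lam.rowLen i : ℤ) + 1 - j) ((lam.colLen j : ℤ) - i - 1) /
          om q t ((lam.rowLen i : ℤ) - j) ((lam.colLen j : ℤ) - i - 1)) := by
    rw [rowHook, h.rowLen_self, prod_range_succ, h.colLen_self, prod_div_distrib]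
    have h1 : rowHook q t lam i ≠ 0 := by
      refine prod_ne_zero_iff.2 fun j hj => hg.om_ne ?_
      rw [mem_range] at hj; omega
    have h2 : ∏ j ∈ range (lam.rowLen i),
        om q t ((lam.rowLen i + 1 : ℕ) - j : ℤ) ((mu.colLen j : ℤ) - i - 1) =
        ∏ j ∈ range (lam.rowLen i),
        om q t ((lam.rowLen i : ℤ) + 1 - j) ((lam.colLen j : ℤ) - i - 1) := by
      refine prod_congr rfl fun j hj => ?_
      rw [h.colLen_of_ne (mem_range.1 hj).ne]
      push_cast
      rfl
    rw [h2]
    rw [rowHook] at h1 ⊢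
    rw [show ((lam.rowLen i + 1 : ℕ) - lam.rowLen i : ℤ) = 1 by push_cast; ring,
      show ((i + 1 : ℕ) - i - 1 : ℤ) = 0 by push_cast; ring]
    field_simp
  rw [e1, prod_row_telescope hg lam i hL' le_rfl hi.le]
  congr 1
  -- Inverting the monomial in numerator and denominator leaves only a ratio of powers of q, and
  -- these ratios telescope over the rows to q^{λ_i}.
  have e2 : ∀ l ∈ Ico i L, om q t ((lam.rowLen i : ℤ) + 1 - lam.rowLen (l + 1)) ((l : ℤ) - i) /
        om q t ((lam.rowLen i : ℤ) + 1 - lam.rowLen l) ((l : ℤ) - i) =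
      q ^ lam.rowLen l / q ^ lam.rowLen (l + 1) *
        (om q t ((lam.rowLen (l + 1) : ℤ) - lam.rowLen i - 1) ((i : ℤ) - l) /
          om q t ((lam.rowLen l : ℤ) - lam.rowLen i - 1) ((i : ℤ) - l)) := by
    intro l hl
    rw [mem_Ico] at hl
    have h1 := lam.rowLen_anti i l hl.1
    have h2 : om q t ((lam.rowLen l : ℤ) - lam.rowLen i - 1) ((i : ℤ) - l) ≠ 0 :=
      hg.om_ne (by omega)
    have hq := hg.q_ne
    have h3 : t ^ ((l : ℤ) - i) ≠ 0 := zpow_ne_zero _ hg.t_ne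
    rw [hg.om_neg, hg.om_neg ((lam.rowLen i : ℤ) + 1 - lam.rowLen l),
      show -((lam.rowLen i : ℤ) + 1 - lam.rowLen (l + 1)) = lam.rowLen (l + 1) - lam.rowLen i - 1
        by ring,
      show -((lam.rowLen i : ℤ) + 1 - lam.rowLen l) = lam.rowLen l - lam.rowLen i - 1 by ring,
      show -((l : ℤ) - i) = i - l by ring, zpow_sub₀ hq, zpow_sub₀ hq, zpow_natCast, zpow_natCast]
    have h4 : q ^ ((lam.rowLen i : ℤ) + 1) ≠ 0 := zpow_ne_zero _ hq
    field_simp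
  rw [prod_congr rfl e2, prod_mul_distrib, prod_Ico_div_succ (f := fun l => q ^ lam.rowLen l) hi.le
    (fun j _ => pow_ne_zero _ hg.q_ne), prod_div_distrib, rowLen_eq_zero lam hL', pow_zero, div_one,
    prod_eq_prod_Ico_succ_bot hi (fun l => om q t ((lam.rowLen l : ℤ) - lam.rowLen i - 1) _),
    ← hookNum, ← hookDen]
  -- The hook 1 - q of the new box cancels the factor k = i of the denominator. For this reason
  -- `hookDen` starts one row later than `hookNum`.
  have h5 : om q t 1 0 = -q * om q t ((lam.rowLen i : ℤ) - lam.rowLen i - 1) ((i : ℤ) - i) := by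
    rw [hg.om_neg]
    congr 1
    · simp
    · congr 1 <;> ring
  have h6 : om q t ((lam.rowLen i : ℤ) - lam.rowLen i - 1) ((i : ℤ) - i) ≠ 0 := hg.om_ne (by omega)
  have h7 : hookDen q t lam i L ≠ 0 := hookDen_ne_zero hg
  rw [h5]
  field_simp
  ring

/-- The ratio of the hook products of two partitions that differ by a box. -/
theorem IsAdd.cLam' (h : IsAdd lam i mu) (hg : Generic q t) (hL : mu.colLen 0 ≤ L) :
    Toroidal.cLam' q t mu = Toroidal.cLam' q t lam *
      ((∏ k ∈ range i, om q t ((lam.rowLen k : ℤ) - lam.rowLen i) ((i : ℤ) - k) /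
        om q t ((lam.rowLen k : ℤ) - lam.rowLen i) ((i : ℤ) - k - 1)) *
      (-q ^ (lam.rowLen i + 1) * (hookNum q t lam i L / hookDen q t lam i L))) := by
  have hi : i < L := h.lt_colLen.trans_le hL
  rw [cLam'_eq q t hL, cLam'_eq q t (h.colLen_le.trans hL), ← prod_range_mul_prod_Ico _ hi.le,
    ← prod_range_mul_prod_Ico _ hi.le, prod_eq_prod_Ico_succ_bot hi, prod_eq_prod_Ico_succ_bot hi,
    h.rowHook_self hg hL, prod_congr rfl fun k hk => h.rowHook_lt hg (mem_range.1 hk),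
    prod_mul_distrib, prod_congr (s₁ := Ico (i + 1) L) rfl fun k hk =>
      h.rowHook_gt (q := q) (t := t) (mem_Ico.1 hk).1]
  ring

theorem cLam'_ne_zero (hg : Generic q t) (lam : YoungDiagram) : cLam' q t lam ≠ 0 := by
  rw [cLam'_eq q t le_rfl]
  refine prod_ne_zero_iff.2 fun k _ => prod_ne_zero_iff.2 fun j hj => hg.om_ne ?_
  rw [mem_range] at hj; omega

/-- The position `q^{lam_k} t^{-k}` of the end of row `k`. -/
def nodeA (q t : K) (lam : YoungDiagram) (k : ℕ) : K := q ^ (lam.rowLen k : ℤ) * t ^ (-k : ℤ)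

/-- `q^{lam_k} t^{-k-1}` -/
def nodeB (q t : K) (lam : YoungDiagram) (k : ℕ) : K := q ^ (lam.rowLen k : ℤ) * t ^ (-k - 1 : ℤ)

theorem Generic.div_eq (hg : Generic q t) (a b c d : ℤ) :
    1 - q ^ a * t ^ b / (q ^ c * t ^ d) = om q t (a - c) (b - d) := by
  rw [om, zpow_sub₀ hg.q_ne, zpow_sub₀ hg.t_ne, div_mul_div_comm]

theorem Generic.nodeA_ne (hg : Generic q t) (lam : YoungDiagram) (k : ℕ) : nodeA q t lam k ≠ 0 :=
  mul_ne_zero (zpow_ne_zero _ hg.q_ne) (zpow_ne_zero _ hg.t_ne)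

theorem Generic.nodeB_ne (hg : Generic q t) (lam : YoungDiagram) (k : ℕ) : nodeB q t lam k ≠ 0 :=
  mul_ne_zero (zpow_ne_zero _ hg.q_ne) (zpow_ne_zero _ hg.t_ne)

/-- The residue of `∏ (1 - a_k x) / ∏ (1 - b_k x)` at `x = 1 / b_i`. -/
def resB (q t : K) (lam : YoungDiagram) (L i : ℕ) : K :=
  (∏ k ∈ range (L + 1), (1 - nodeA q t lam k / nodeB q t lam i)) /
    ∏ k ∈ (range L).erase i, (1 - nodeB q t lam k / nodeB q t lam i)

/-- The residue of `∏ (1 - b_k x) / ∏ (1 - a_k x)` at `x = 1 / a_i`. -/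
def resA (q t : K) (lam : YoungDiagram) (L i : ℕ) : K :=
  (∏ k ∈ range L, (1 - nodeB q t lam k / nodeA q t lam i)) /
    ∏ k ∈ (range (L + 1)).erase i, (1 - nodeA q t lam k / nodeA q t lam i)

theorem prod_range_erase {M : Type*} [CommMonoid M] (f : ℕ → M) (hi : i < L) :
    ∏ k ∈ (range L).erase i, f k = (∏ k ∈ range i, f k) * ∏ k ∈ Ico (i + 1) L, f k := by
  rw [← prod_union]
  · refine prod_congr ?_ fun _ _ => rfl
    ext k
    simp only [mem_erase, mem_range, mem_union, mem_Ico]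
    omega
  · rw [disjoint_left]
    intro k hk hk'
    rw [mem_range] at hk
    rw [mem_Ico] at hk'
    omega

theorem prod_range_split {M : Type*} [CommMonoid M] (f : ℕ → M) (hi : i < L) :
    ∏ k ∈ range L, f k = (∏ k ∈ range i, f k) * (f i * ∏ k ∈ Ico (i + 1) L, f k) := by
  rw [← prod_range_mul_prod_Ico _ hi.le, prod_eq_prod_Ico_succ_bot hi]

/-- A^+ is a product over the rows above row i only. The ratio of hook products replaces half of its
factors and supplies those of the rows from i on, which together give the residue of Y at the
removable corner of μ. -/
theorem IsAdd.APlus_mul (h : IsAdd lam i mu) (hg : Generic q t) (hL : mu.colLen 0 ≤ L) :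
    APlus q t lam i * Toroidal.cLam' q t mu =
      -q ^ (lam.rowLen i + 1) * resB q t mu L i * Toroidal.cLam' q t lam := by
  have hi : i < L := h.lt_colLen.trans_le hL
  have hD : hookDen q t lam i L ≠ 0 := hookDen_ne_zero hg
  have e1 : resB q t mu L i = (1 - t) * (∏ k ∈ range i,
      om q t ((lam.rowLen k : ℤ) - lam.rowLen i - 1) ((i : ℤ) - k + 1) /
      om q t ((lam.rowLen k : ℤ) - lam.rowLen i - 1) ((i : ℤ) - k)) *
        (hookNum q t lam i L / hookDen q t lam i L) := by
    have n1 : ∏ k ∈ range i, (1 - nodeA q t mu k / nodeB q t mu i) = ∏ k ∈ range i,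
        om q t ((lam.rowLen k : ℤ) - lam.rowLen i - 1) ((i : ℤ) - k + 1) := by
      refine prod_congr rfl fun k hk => ?_
      rw [nodeA, nodeB, hg.div_eq, h.rowLen_self, h.rowLen_of_ne (mem_range.1 hk).ne]
      congr 1 <;> push_cast <;> ring
    have n2 : ∏ k ∈ range i, (1 - nodeB q t mu k / nodeB q t mu i) = ∏ k ∈ range i,
        om q t ((lam.rowLen k : ℤ) - lam.rowLen i - 1) ((i : ℤ) - k) := by
      refine prod_congr rfl fun k hk => ?_
      rw [nodeB, nodeB, hg.div_eq, h.rowLen_self, h.rowLen_of_ne (mem_range.1 hk).ne]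
      congr 1 <;> push_cast <;> ring
    have n3 : 1 - nodeA q t mu i / nodeB q t mu i = 1 - t := by
      rw [nodeA, nodeB, hg.div_eq, om, sub_self, show -(i : ℤ) - (-(i : ℤ) - 1) = 1 by ring]
      simp
    have n4 : ∏ k ∈ Ico (i + 1) (L + 1), (1 - nodeA q t mu k / nodeB q t mu i) =
        hookNum q t lam i L := by
      rw [hookNum, ← prod_Ico_add' _ i L 1]
      refine prod_congr rfl fun k hk => ?_
      rw [mem_Ico] at hk
      rw [nodeA, nodeB, hg.div_eq, h.rowLen_self, h.rowLen_of_ne (by omega)]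
      congr 1 <;> push_cast <;> ring
    have n5 : ∏ k ∈ Ico (i + 1) L, (1 - nodeB q t mu k / nodeB q t mu i) =
        hookDen q t lam i L := by
      refine prod_congr rfl fun k hk => ?_
      rw [mem_Ico] at hk
      rw [nodeB, nodeB, hg.div_eq, h.rowLen_self, h.rowLen_of_ne (by omega)]
      congr 1 <;> push_cast <;> ring
    rw [resB, prod_range_split _ (hi.trans (Nat.lt_succ_self L)), prod_range_erase _ hi, n1, n2, n3,
      n4, n5, prod_div_distrib]
    have : ∏ k ∈ range i, om q t ((lam.rowLen k : ℤ) - lam.rowLen i - 1) ((i : ℤ) - k) ≠ 0 :=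
      prod_ne_zero_iff.2 fun k hk => hg.om_ne (by rw [mem_range] at hk; omega)
    field_simp
  -- After inverting the monomials the prefactors cancel, because the exponents in the two numerator
  -- factors and in the two denominator factors have equal sums.
  have e2 : APlus q t lam i * ∏ k ∈ range i,
      om q t ((lam.rowLen k : ℤ) - lam.rowLen i) ((i : ℤ) - k) /
        om q t ((lam.rowLen k : ℤ) - lam.rowLen i) ((i : ℤ) - k - 1) =
      (1 - t) * (∏ k ∈ range i,
      om q t ((lam.rowLen k : ℤ) - lam.rowLen i - 1) ((i : ℤ) - k + 1) /
      om q t ((lam.rowLen k : ℤ) - lam.rowLen i - 1) ((i : ℤ) - k)) := by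
    rw [APlus, mul_assoc, ← prod_mul_distrib]
    congr 1
    refine prod_congr rfl fun k hk => ?_
    rw [mem_range] at hk
    have hlt := h.rowLen_lt hk
    have q1 : 1 - q ^ ((lam.rowLen i : ℤ) - lam.rowLen k) * t ^ (-(i : ℤ) + k + 1) =
        -(q ^ ((lam.rowLen i : ℤ) - lam.rowLen k) * t ^ (-(i : ℤ) + k + 1)) *
          om q t ((lam.rowLen k : ℤ) - lam.rowLen i) ((i : ℤ) - k - 1) :=
      (hg.om_neg _ _).trans (by congr 2 <;> ring)
    have q2 : 1 - q ^ ((lam.rowLen i : ℤ) - lam.rowLen k + 1) * t ^ (-(i : ℤ) + k - 1) =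
        -(q ^ ((lam.rowLen i : ℤ) - lam.rowLen k + 1) * t ^ (-(i : ℤ) + k - 1)) *
          om q t ((lam.rowLen k : ℤ) - lam.rowLen i - 1) ((i : ℤ) - k + 1) :=
      (hg.om_neg _ _).trans (by congr 2 <;> ring)
    have q3 : 1 - q ^ ((lam.rowLen i : ℤ) - lam.rowLen k) * t ^ (-(i : ℤ) + k) =
        -(q ^ ((lam.rowLen i : ℤ) - lam.rowLen k) * t ^ (-(i : ℤ) + k)) *
          om q t ((lam.rowLen k : ℤ) - lam.rowLen i) ((i : ℤ) - k) :=
      (hg.om_neg _ _).trans (by congr 2 <;> ring)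
    have q4 : 1 - q ^ ((lam.rowLen i : ℤ) - lam.rowLen k + 1) * t ^ (-(i : ℤ) + k) =
        -(q ^ ((lam.rowLen i : ℤ) - lam.rowLen k + 1) * t ^ (-(i : ℤ) + k)) *
          om q t ((lam.rowLen k : ℤ) - lam.rowLen i - 1) ((i : ℤ) - k) :=
      (hg.om_neg _ _).trans (by congr 2 <;> ring)
    rw [q1, q2, q3, q4]
    have o1 : om q t ((lam.rowLen k : ℤ) - lam.rowLen i) ((i : ℤ) - k - 1) ≠ 0 :=
      hg.om_ne (by omega)
    have o2 : om q t ((lam.rowLen k : ℤ) - lam.rowLen i - 1) ((i : ℤ) - k) ≠ 0 :=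
      hg.om_ne (by omega)
    have o3 : om q t ((lam.rowLen k : ℤ) - lam.rowLen i) ((i : ℤ) - k) ≠ 0 :=
      hg.om_ne (by omega)
    have z1 : q ^ ((lam.rowLen i : ℤ) - lam.rowLen k) ≠ 0 := zpow_ne_zero _ hg.q_ne
    have z2 : q ^ ((lam.rowLen i : ℤ) - lam.rowLen k + 1) ≠ 0 := zpow_ne_zero _ hg.q_ne
    have z3 : t ^ (-(i : ℤ) + k) ≠ 0 := zpow_ne_zero _ hg.t_ne
    have ht := hg.t_ne
    rw [zpow_add_one₀ ht, zpow_sub_one₀ ht]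
    field_simp
  rw [h.cLam' hg hL, e1]
  linear_combination (-q ^ (lam.rowLen i + 1) * (hookNum q t lam i L / hookDen q t lam i L) *
    Toroidal.cLam' q t lam) * e2

/-- The product may be extended past the last row. The residues of λ and A^- of μ can then be
compared with a common number of rows. -/
theorem AMinus_eq (hg : Generic q t) (mu : YoungDiagram) (i : ℕ) (hL : mu.colLen 0 ≤ L) :
    AMinus q t mu i = (1 - t⁻¹) *
      ((1 - q ^ ((mu.rowLen (i + 1) : ℤ) - mu.rowLen i)) /
        (1 - q ^ ((mu.rowLen (i + 1) : ℤ) - mu.rowLen i + 1) * t⁻¹)) *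
      ∏ j ∈ Ico (i + 1) L,
        ((1 - q ^ ((mu.rowLen j : ℤ) - mu.rowLen i + 1) * t ^ (-(j : ℤ) + i - 1)) *
          (1 - q ^ ((mu.rowLen (j + 1) : ℤ) - mu.rowLen i) * t ^ (-(j : ℤ) + i))) /
        ((1 - q ^ ((mu.rowLen (j + 1) : ℤ) - mu.rowLen i + 1) * t ^ (-(j : ℤ) + i - 1)) *
          (1 - q ^ ((mu.rowLen j : ℤ) - mu.rowLen i) * t ^ (-(j : ℤ) + i))) := by
  rw [AMinus]
  congr 1
  refine prod_subset (Ico_subset_Ico_right hL) fun j hj hj' => ?_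
  rw [mem_Ico] at hj hj'
  rw [rowLen_eq_zero mu (by omega : mu.colLen 0 ≤ j),
    rowLen_eq_zero mu (by omega : mu.colLen 0 ≤ j + 1)]
  have h1 : om q t (((0 : ℕ) : ℤ) - mu.rowLen i + 1) (-(j : ℤ) + i - 1) ≠ 0 :=
    hg.om_ne (by omega)
  have h2 : om q t (((0 : ℕ) : ℤ) - mu.rowLen i) (-(j : ℤ) + i) ≠ 0 := hg.om_ne (by omega)
  exact div_self (mul_ne_zero h1 h2)

/-- The counterpart for 1/Y: A^- involves the rows from i downwards, and the hook ratio cancels the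
residue factors of the rows above. -/
theorem IsAdd.AMinus_mul (h : IsAdd lam i mu) (hg : Generic q t) (hL : mu.colLen 0 ≤ L) :
    AMinus q t mu i * q ^ (lam.rowLen i + 1) * Toroidal.cLam' q t lam =
      -resA q t lam L i * Toroidal.cLam' q t mu := by
  have hi : i < L := h.lt_colLen.trans_le hL
  have hD : hookDen q t lam i L ≠ 0 := hookDen_ne_zero hg
  have e1 : resA q t lam L i = (∏ k ∈ range i,
      om q t ((lam.rowLen k : ℤ) - lam.rowLen i) ((i : ℤ) - k - 1) /
      om q t ((lam.rowLen k : ℤ) - lam.rowLen i) ((i : ℤ) - k)) * (1 - t⁻¹) *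
      ((∏ k ∈ Ico (i + 1) L, om q t ((lam.rowLen k : ℤ) - lam.rowLen i) ((i : ℤ) - k - 1)) /
        ∏ k ∈ Ico i L, om q t ((lam.rowLen (k + 1) : ℤ) - lam.rowLen i) ((i : ℤ) - k - 1)) := by
    have n1 : ∏ k ∈ range i, (1 - nodeB q t lam k / nodeA q t lam i) = ∏ k ∈ range i,
        om q t ((lam.rowLen k : ℤ) - lam.rowLen i) ((i : ℤ) - k - 1) := by
      refine prod_congr rfl fun k hk => ?_
      rw [nodeA, nodeB, hg.div_eq]
      congr 1; ring
    have n2 : ∏ k ∈ range i, (1 - nodeA q t lam k / nodeA q t lam i) = ∏ k ∈ range i,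
        om q t ((lam.rowLen k : ℤ) - lam.rowLen i) ((i : ℤ) - k) := by
      refine prod_congr rfl fun k hk => ?_
      rw [nodeA, nodeA, hg.div_eq]
      congr 1; ring
    have n3 : 1 - nodeB q t lam i / nodeA q t lam i = 1 - t⁻¹ := by
      rw [nodeA, nodeB, hg.div_eq, om, sub_self, show (-(i : ℤ) - 1) - -(i : ℤ) = -1 by ring]
      simp
    have n4 : ∏ k ∈ Ico (i + 1) (L + 1), (1 - nodeA q t lam k / nodeA q t lam i) =
        ∏ k ∈ Ico i L, om q t ((lam.rowLen (k + 1) : ℤ) - lam.rowLen i) ((i : ℤ) - k - 1) := by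
      rw [← prod_Ico_add' _ i L 1]
      refine prod_congr rfl fun k hk => ?_
      rw [nodeA, nodeA, hg.div_eq]
      congr 1; push_cast; ring
    have n5 : ∏ k ∈ Ico (i + 1) L, (1 - nodeB q t lam k / nodeA q t lam i) =
        ∏ k ∈ Ico (i + 1) L, om q t ((lam.rowLen k : ℤ) - lam.rowLen i) ((i : ℤ) - k - 1) := by
      refine prod_congr rfl fun k hk => ?_
      rw [nodeB, nodeA, hg.div_eq]
      congr 1; ring
    rw [resA, prod_range_split _ hi, prod_range_erase _ (hi.trans (Nat.lt_succ_self L)), n1, n2, n3,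
      n4, n5, prod_div_distrib]
    have o1 : ∏ k ∈ range i, om q t ((lam.rowLen k : ℤ) - lam.rowLen i) ((i : ℤ) - k) ≠ 0 :=
      prod_ne_zero_iff.2 fun k hk => hg.om_ne (by rw [mem_range] at hk; omega)
    have o2 : ∏ k ∈ Ico i L, om q t ((lam.rowLen (k + 1) : ℤ) - lam.rowLen i) ((i : ℤ) - k - 1) ≠ 0 :=
      prod_ne_zero_iff.2 fun k hk => hg.om_ne (by rw [mem_Ico] at hk; omega)
    field_simp
  have e2 : AMinus q t mu i = (1 - t⁻¹) *
      ((∏ k ∈ Ico (i + 1) L, om q t ((lam.rowLen k : ℤ) - lam.rowLen i) ((i : ℤ) - k - 1)) /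
        ∏ k ∈ Ico i L, om q t ((lam.rowLen (k + 1) : ℤ) - lam.rowLen i) ((i : ℤ) - k - 1)) *
      (hookNum q t lam i L / hookDen q t lam i L) := by
    rw [AMinus_eq hg mu i hL, hookNum, hookDen, prod_eq_prod_Ico_succ_bot hi,
      prod_eq_prod_Ico_succ_bot hi, h.rowLen_self, h.rowLen_of_ne (by omega : i + 1 ≠ i)]
    have a1 : 1 - q ^ ((lam.rowLen (i + 1) : ℤ) - (lam.rowLen i + 1 : ℕ)) =
        om q t ((lam.rowLen (i + 1) : ℤ) - lam.rowLen i - 1) ((i : ℤ) - i) := by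
      rw [om, sub_self, zpow_zero, mul_one, Nat.cast_succ, sub_sub]
    have a2 : 1 - q ^ ((lam.rowLen (i + 1) : ℤ) - (lam.rowLen i + 1 : ℕ) + 1) * t⁻¹ =
        om q t ((lam.rowLen (i + 1) : ℤ) - lam.rowLen i) ((i : ℤ) - i - 1) := by
      rw [om, sub_self, zero_sub, zpow_neg_one, Nat.cast_succ, sub_add_eq_sub_sub, sub_add_cancel]
    have a3 : ∀ j ∈ Ico (i + 1) L,
        ((1 - q ^ ((mu.rowLen j : ℤ) - (lam.rowLen i + 1 : ℕ) + 1) * t ^ (-(j : ℤ) + i - 1)) *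
          (1 - q ^ ((mu.rowLen (j + 1) : ℤ) - (lam.rowLen i + 1 : ℕ)) * t ^ (-(j : ℤ) + i))) /
        ((1 - q ^ ((mu.rowLen (j + 1) : ℤ) - (lam.rowLen i + 1 : ℕ) + 1) * t ^ (-(j : ℤ) + i - 1)) *
          (1 - q ^ ((mu.rowLen j : ℤ) - (lam.rowLen i + 1 : ℕ)) * t ^ (-(j : ℤ) + i))) =
        (om q t ((lam.rowLen j : ℤ) - lam.rowLen i) ((i : ℤ) - j - 1) *
          om q t ((lam.rowLen (j + 1) : ℤ) - lam.rowLen i - 1) ((i : ℤ) - j)) /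
        (om q t ((lam.rowLen (j + 1) : ℤ) - lam.rowLen i) ((i : ℤ) - j - 1) *
          om q t ((lam.rowLen j : ℤ) - lam.rowLen i - 1) ((i : ℤ) - j)) := by
      intro j hj
      rw [mem_Ico] at hj
      rw [h.rowLen_of_ne (by omega : j ≠ i), h.rowLen_of_ne (by omega : j + 1 ≠ i)]
      simp only [om]
      push_cast
      congr 1 <;> congr 3 <;> congr 1 <;> ring
    rw [a1, a2, prod_congr rfl a3, prod_div_distrib, prod_mul_distrib, prod_mul_distrib]
    have o1 : om q t ((lam.rowLen (i + 1) : ℤ) - lam.rowLen i) ((i : ℤ) - i - 1) ≠ 0 :=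
      hg.om_ne (by omega)
    have o2 : ∏ k ∈ Ico (i + 1) L,
        om q t ((lam.rowLen (k + 1) : ℤ) - lam.rowLen i) ((i : ℤ) - k - 1) ≠ 0 :=
      prod_ne_zero_iff.2 fun k hk => hg.om_ne (by rw [mem_Ico] at hk; omega)
    rw [hookDen] at hD
    field_simp
  have e3 : (∏ k ∈ range i,
      om q t ((lam.rowLen k : ℤ) - lam.rowLen i) ((i : ℤ) - k - 1) /
      om q t ((lam.rowLen k : ℤ) - lam.rowLen i) ((i : ℤ) - k)) * ∏ k ∈ range i,
      om q t ((lam.rowLen k : ℤ) - lam.rowLen i) ((i : ℤ) - k) /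
      om q t ((lam.rowLen k : ℤ) - lam.rowLen i) ((i : ℤ) - k - 1) = 1 := by
    rw [← prod_mul_distrib]
    refine prod_eq_one fun k hk => ?_
    rw [mem_range] at hk
    have hlt := h.rowLen_lt hk
    have o1 : om q t ((lam.rowLen k : ℤ) - lam.rowLen i) ((i : ℤ) - k - 1) ≠ 0 :=
      hg.om_ne (by omega)
    have o2 : om q t ((lam.rowLen k : ℤ) - lam.rowLen i) ((i : ℤ) - k) ≠ 0 := hg.om_ne (by omega)
    field_simp
  rw [h.cLam' hg hL, e1, e2]
  generalize (∏ k ∈ Ico (i + 1) L, om q t ((lam.rowLen k : ℤ) - lam.rowLen i) ((i : ℤ) - k - 1)) /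
    ∏ k ∈ Ico i L, om q t ((lam.rowLen (k + 1) : ℤ) - lam.rowLen i) ((i : ℤ) - k - 1) = E at *
  linear_combination (-(1 - t⁻¹) * E * q ^ (lam.rowLen i + 1) * Toroidal.cLam' q t lam *
    (hookNum q t lam i L / hookDen q t lam i L)) * e3

/-- A factor of the residue of 1/Y could vanish only if the row above row i had the same length, and
then no box could be added to row i. Uniqueness divides by this coefficient. -/
theorem IsAdd.AMinus_ne_zero (h : IsAdd lam i mu) (hg : Generic q t) : AMinus q t mu i ≠ 0 := by
  intro h0
  have h1 := h.AMinus_mul hg le_rfl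
  rw [h0, zero_mul, zero_mul, eq_comm, mul_eq_zero, or_iff_left (cLam'_ne_zero hg mu), neg_eq_zero,
    resA, div_eq_zero_iff, prod_eq_zero_iff, prod_eq_zero_iff] at h1
  rcases h1 with ⟨k, hk, h1⟩ | ⟨k, hk, h1⟩
  · rw [nodeB, nodeA, hg.div_eq] at h1
    refine hg.om_ne ?_ h1
    by_contra! h2
    have := h.rowLen_lt (k := k) (by omega)
    omega
  · rw [nodeA, nodeA, hg.div_eq] at h1
    refine hg.om_ne ?_ h1
    rw [mem_erase] at hk
    omega

end Hooks

/-! ### Partial fractions and delta functions. -/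

section PartialFractions

variable {K : Type*} [Field K] [CharZero K]

theorem eval_eq_sum_nodes {s : Finset ℕ} {v : ℕ → K} (hv : Set.InjOn v s) {p : Polynomial K}
    (hp : p.degree < #s) (x : K) :
    p.eval x = ∑ i ∈ s, p.eval (v i) / (∏ k ∈ s.erase i, (v i - v k)) *
      ∏ k ∈ s.erase i, (x - v k) := by
  conv_lhs => rw [Lagrange.eq_interpolate hv hp]
  rw [Lagrange.interpolate_apply, Polynomial.eval_finsetSum]
  refine sum_congr rfl fun i _ => ?_
  rw [Polynomial.eval_mul, Polynomial.eval_C, Lagrange.basis, Polynomial.eval_prod, div_mul_eq_mul_div,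
    mul_div_assoc, ← prod_div_distrib]
  congr 1
  refine prod_congr rfl fun k _ => ?_
  rw [Lagrange.basisDivisor, Polynomial.eval_mul, Polynomial.eval_C, Polynomial.eval_sub,
    Polynomial.eval_X, Polynomial.eval_C, div_eq_inv_mul]

theorem prod_sub_eq {s : Finset ℕ} {a : K} (ha : a ≠ 0) (b : ℕ → K) :
    ∏ k ∈ s, (a - b k) = a ^ #s * ∏ k ∈ s, (1 - b k / a) := by
  rw [← prod_const, ← prod_mul_distrib]
  exact prod_congr rfl fun k _ => by field_simp

theorem prod_sub_eq' {s : Finset ℕ} (y : K) {b : ℕ → K} (hb : ∀ k, b k ≠ 0) :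
    ∏ k ∈ s, (y - b k) = (∏ k ∈ s, (-b k)) * ∏ k ∈ s, (1 - (b k)⁻¹ * y) := by
  rw [← prod_mul_distrib]
  refine prod_congr rfl fun k _ => ?_
  have := hb k
  field_simp
  ring

variable {a b : ℕ → K} {L : ℕ}

theorem prod_eq_sum_resA (ha : ∀ k, a k ≠ 0) (hi : Set.InjOn a (range (L + 1))) (x : K) :
    ∏ k ∈ range L, (x - b k) = ∑ i ∈ range (L + 1),
      ((∏ k ∈ range L, (1 - b k / a i)) / ∏ k ∈ (range (L + 1)).erase i, (1 - a k / a i)) *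
        ∏ k ∈ (range (L + 1)).erase i, (x - a k) := by
  have hdeg : (∏ k ∈ range L, (Polynomial.X - Polynomial.C (b k))).degree <
      ((#(range (L + 1)) : ℕ) : WithBot ℕ) := by
    rw [Polynomial.degree_prod]
    simp only [Polynomial.degree_X_sub_C, sum_const, card_range, nsmul_eq_mul, mul_one]
    exact_mod_cast Nat.lt_succ_self L
  have h := eval_eq_sum_nodes hi hdeg x
  simp only [Polynomial.eval_prod, Polynomial.eval_sub, Polynomial.eval_X, Polynomial.eval_C] at h
  rw [h]
  refine sum_congr rfl fun i hi => ?_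
  rw [prod_sub_eq (ha i), prod_sub_eq (ha i), card_erase_of_mem hi, card_range, card_range,
    Nat.add_sub_cancel, mul_div_mul_left _ _ (pow_ne_zero _ (ha i))]

/-- The numerator has one factor more than the denominator, so a polynomial part is split off first.
Subtracting (x - 1) ∏(x - b_k) removes the leading coefficient and, because ∏ a_k = ∏ b_k, the
constant one; the rest is x times a polynomial of degree below L, which is interpolated at the b_i.
-/
theorem prod_eq_sum_resB (hb : ∀ k, b k ≠ 0) (hi : Set.InjOn b (range L))
    (hab : ∏ k ∈ range (L + 1), a k = ∏ k ∈ range L, b k) (x : K) :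
    ∏ k ∈ range (L + 1), (x - a k) = (x - 1) * ∏ k ∈ range L, (x - b k) +
      x * ∑ i ∈ range L, (((∏ k ∈ range (L + 1), (1 - a k / b i)) /
        ∏ k ∈ (range L).erase i, (1 - b k / b i)) * b i) *
          ∏ k ∈ (range L).erase i, (x - b k) := by
  set P := ∏ k ∈ range (L + 1), (Polynomial.X - Polynomial.C (a k)) with hP
  set Q := (Polynomial.X - Polynomial.C 1) * ∏ k ∈ range L, (Polynomial.X - Polynomial.C (b k)) with hQ
  have hPm : P.Monic := Polynomial.monic_prod_of_monic _ _ fun k _ => Polynomial.monic_X_sub_C _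
  have hQm : Q.Monic := (Polynomial.monic_X_sub_C _).mul
    (Polynomial.monic_prod_of_monic _ _ fun k _ => Polynomial.monic_X_sub_C _)
  have hPd : P.degree = (L + 1 : ℕ) := by
    rw [hP, Polynomial.degree_prod]
    simp
  have hQd : Q.degree = (L + 1 : ℕ) := by
    rw [hQ, Polynomial.degree_mul, Polynomial.degree_prod]
    simp only [Polynomial.degree_X_sub_C, sum_const, card_range, nsmul_eq_mul, mul_one]
    push_cast
    exact add_comm _ _
  have hR : (P - Q).degree < (L + 1 : ℕ) := by
    rw [← hPd]
    exact Polynomial.degree_sub_lt_left (hPd.trans hQd.symm) hPm.ne_zero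
      (hPm.leadingCoeff.trans hQm.leadingCoeff.symm)
  have h0 : (P - Q).coeff 0 = 0 := by
    rw [Polynomial.coeff_zero_eq_eval_zero, Polynomial.eval_sub, hP, hQ]
    simp only [Polynomial.eval_mul, Polynomial.eval_prod, Polynomial.eval_sub, Polynomial.eval_X,
      Polynomial.eval_C, zero_sub]
    rw [prod_neg, prod_neg, hab, card_range, card_range, pow_succ]
    ring
  have hX : P - Q = Polynomial.X * (P - Q).divX := by
    have := Polynomial.X_mul_divX_add (P - Q)
    rw [h0, map_zero, add_zero] at this
    exact this.symm
  have hdeg : (P - Q).divX.degree < #(range L) := by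
    rw [card_range, Polynomial.degree_lt_iff_coeff_zero]
    intro m hm
    rw [Polynomial.coeff_divX]
    exact (Polynomial.degree_lt_iff_coeff_zero _ _).1 hR _ (by omega)
  have hev : ∀ y, ∏ k ∈ range (L + 1), (y - a k) = (y - 1) * ∏ k ∈ range L, (y - b k) +
      y * (P - Q).divX.eval y := by
    intro y
    have := congrArg (Polynomial.eval y) hX
    rw [Polynomial.eval_mul, Polynomial.eval_X, Polynomial.eval_sub] at this
    rw [← this, hP, hQ]
    simp only [Polynomial.eval_mul, Polynomial.eval_prod, Polynomial.eval_sub, Polynomial.eval_X,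
      Polynomial.eval_C]
    ring
  rw [hev, eval_eq_sum_nodes hi hdeg x]
  congr 2
  refine sum_congr rfl fun i hi => ?_
  congr 1
  -- At b_i only the interpolated part survives, multiplied by b_i. Dividing by this b_i leaves
  -- b_i^L in the numerator, against b_i^{L-1} from the denominator.
  have h1 := hev (b i)
  rw [prod_eq_zero (i := i) (s := range L) hi (sub_self _), mul_zero, zero_add,
    prod_sub_eq (hb i), card_range, pow_succ', mul_assoc, mul_right_inj' (hb i)] at h1
  rw [← h1, prod_sub_eq (hb i), card_erase_of_mem hi, card_range]
  have hL : L = L - 1 + 1 := by have := mem_range.1 hi; omega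
  have h2 : b i ^ L = b i ^ (L - 1) * b i := by rw [← pow_succ, ← hL]
  rw [h2, mul_assoc, mul_div_mul_left _ _ (pow_ne_zero _ (hb i))]
  ring

/-- The power series `1 - a s` as a polynomial. -/
def oneSubPoly (a : K) : Polynomial K := 1 - Polynomial.C a * Polynomial.X

theorem coe_oneSubPoly (a : K) :
    Polynomial.coeToPowerSeries.ringHom (oneSubPoly a) = oneSub a := by
  simp [oneSubPoly, oneSub]

theorem eval_oneSubPoly (a x : K) : (oneSubPoly a).eval x = 1 - a * x := by
  simp [oneSubPoly]

/-- Infinitely many points suffice, so x may be inverted while the identity is checked. -/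
theorem powerSeries_eq_of_eval {P Q : Polynomial K}
    (h : ∀ x, x ≠ 0 → P.eval x = Q.eval x) :
    Polynomial.coeToPowerSeries.ringHom P = Polynomial.coeToPowerSeries.ringHom Q := by
  congr 1
  refine Polynomial.eq_of_infinite_eval_eq P Q (Set.Infinite.mono (s := {x | x ≠ 0}) h ?_)
  exact Set.Finite.infinite_compl (Set.finite_singleton (0 : K))

theorem ringHom_C (c : K) :
    Polynomial.coeToPowerSeries.ringHom (Polynomial.C c) = PowerSeries.C c := by
  simp

theorem ringHom_X :
    Polynomial.coeToPowerSeries.ringHom (Polynomial.X : Polynomial K) = PowerSeries.X := by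
  simp

/-- The expansion of `∏ (1 - a_k x) / ∏ (1 - b_k x)`. -/
def ySeries (a b : ℕ → K) (L : ℕ) : PowerSeries K :=
  (∏ k ∈ range (L + 1), oneSub (a k)) * ∏ k ∈ range L, (oneSub (b k))⁻¹

/-- The expansion of `∏ (1 - b_k x) / ∏ (1 - a_k x)`. -/
def yInv (a b : ℕ → K) (L : ℕ) : PowerSeries K :=
  (∏ k ∈ range L, oneSub (b k)) * ∏ k ∈ range (L + 1), (oneSub (a k))⁻¹

theorem prod_oneSub_mul_inv (s : Finset ℕ) (c : ℕ → K) :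
    (∏ k ∈ s, oneSub (c k)) * ∏ k ∈ s, (oneSub (c k))⁻¹ = 1 := by
  rw [← prod_mul_distrib]
  exact prod_eq_one fun k _ => oneSub_mul_inv _

theorem prod_erase_mul_inv {s : Finset ℕ} {i : ℕ} (hi : i ∈ s) (c : ℕ → K) :
    (∏ k ∈ s.erase i, oneSub (c k)) * ∏ k ∈ s, (oneSub (c k))⁻¹ = (oneSub (c i))⁻¹ := by
  rw [← mul_prod_erase s _ hi, mul_left_comm, prod_oneSub_mul_inv, mul_one]

/-- Substituting 1/x in the interpolation formula and clearing powers of x gives the expansion at 0.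
-/
theorem yInv_eq_sum (ha : ∀ k, a k ≠ 0) (hi : Set.InjOn a (range (L + 1))) :
    yInv a b L = ∑ i ∈ range (L + 1), PowerSeries.C
      ((∏ k ∈ range L, (1 - b k / a i)) / ∏ k ∈ (range (L + 1)).erase i, (1 - a k / a i)) *
        (oneSub (a i))⁻¹ := by
  have h : ∏ k ∈ range L, oneSub (b k) = ∑ i ∈ range (L + 1), PowerSeries.C
      ((∏ k ∈ range L, (1 - b k / a i)) / ∏ k ∈ (range (L + 1)).erase i, (1 - a k / a i)) *
        ∏ k ∈ (range (L + 1)).erase i, oneSub (a k) := by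
    have := powerSeries_eq_of_eval (P := ∏ k ∈ range L, oneSubPoly (b k))
      (Q := ∑ i ∈ range (L + 1), Polynomial.C
      ((∏ k ∈ range L, (1 - b k / a i)) / ∏ k ∈ (range (L + 1)).erase i, (1 - a k / a i)) *
        ∏ k ∈ (range (L + 1)).erase i, oneSubPoly (a k)) ?_
    · simpa only [map_prod, map_sum, map_mul, coe_oneSubPoly, ringHom_C] using this
    · intro x hx
      have hx' := inv_ne_zero hx
      have h1 := prod_eq_sum_resA (b := b) ha hi x⁻¹
      simp only [Polynomial.eval_prod, Polynomial.eval_finsetSum, Polynomial.eval_mul,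
        Polynomial.eval_C, eval_oneSubPoly]
      simp only [prod_sub_eq hx', div_inv_eq_mul, card_range] at h1
      rw [← mul_right_inj' (pow_ne_zero L hx'), h1, mul_sum]
      refine sum_congr rfl fun i hi => ?_
      rw [card_erase_of_mem hi, card_range, Nat.add_sub_cancel]
      ring
  rw [yInv, h, sum_mul]
  refine sum_congr rfl fun i hi => ?_
  rw [mul_assoc, prod_erase_mul_inv hi]

/-- The same formula taken at x itself gives the expansion at infinity with the same residues; ∏ a_k
= ∏ b_k makes the leading factors match. The delta functions arise from comparing this with
`yInv_eq_sum`. -/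
theorem yInv_inv_eq_sum (ha : ∀ k, a k ≠ 0) (hb : ∀ k, b k ≠ 0) (hi : Set.InjOn a (range (L + 1)))
    (hab : ∏ k ∈ range (L + 1), a k = ∏ k ∈ range L, b k) :
    yInv (fun k => (a k)⁻¹) (fun k => (b k)⁻¹) L = ∑ i ∈ range (L + 1), PowerSeries.C
      ((∏ k ∈ range L, (1 - b k / a i)) / (∏ k ∈ (range (L + 1)).erase i, (1 - a k / a i)) *
        (a i)⁻¹) * (oneSub (a i)⁻¹)⁻¹ := by
  have h : ∏ k ∈ range L, oneSub (b k)⁻¹ = ∑ i ∈ range (L + 1), PowerSeries.C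
      ((∏ k ∈ range L, (1 - b k / a i)) / (∏ k ∈ (range (L + 1)).erase i, (1 - a k / a i)) *
        (a i)⁻¹) * ∏ k ∈ (range (L + 1)).erase i, oneSub (a k)⁻¹ := by
    have := powerSeries_eq_of_eval (P := ∏ k ∈ range L, oneSubPoly (b k)⁻¹)
      (Q := ∑ i ∈ range (L + 1), Polynomial.C
      ((∏ k ∈ range L, (1 - b k / a i)) / (∏ k ∈ (range (L + 1)).erase i, (1 - a k / a i)) *
        (a i)⁻¹) * ∏ k ∈ (range (L + 1)).erase i, oneSubPoly (a k)⁻¹) ?_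
    · simpa only [map_prod, map_sum, map_mul, coe_oneSubPoly, ringHom_C] using this
    · intro x hx
      have h1 := prod_eq_sum_resA (b := b) ha hi x
      simp only [Polynomial.eval_prod, Polynomial.eval_finsetSum, Polynomial.eval_mul,
        Polynomial.eval_C, eval_oneSubPoly]
      simp only [prod_sub_eq' x hb, prod_sub_eq' x ha] at h1
      have hne : ∏ k ∈ range L, -b k ≠ 0 := prod_ne_zero_iff.2 fun k _ => neg_ne_zero.2 (hb k)
      rw [← mul_right_inj' hne, h1, mul_sum]
      refine sum_congr rfl fun i hi => ?_
      have h2 : ∏ k ∈ range L, -b k = a i * ∏ k ∈ (range (L + 1)).erase i, -a k := by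
        have h3 := mul_prod_erase (range (L + 1)) (fun k => -a k) hi
        have h4 : ∏ k ∈ range (L + 1), -a k = -∏ k ∈ range L, -b k := by
          rw [prod_neg, prod_neg, card_range, card_range, hab, pow_succ]; ring
        rw [h4] at h3
        linear_combination h3
      rw [h2]
      have := ha i
      field_simp
  rw [yInv, h, sum_mul]
  refine sum_congr rfl fun i hi => ?_
  rw [mul_assoc, prod_erase_mul_inv hi fun k => (a k)⁻¹]

theorem ySeries_eq_sum (hb : ∀ k, b k ≠ 0) (hi : Set.InjOn b (range L))
    (hab : ∏ k ∈ range (L + 1), a k = ∏ k ∈ range L, b k) :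
    ySeries a b L = 1 - PowerSeries.X + PowerSeries.X * ∑ i ∈ range L, PowerSeries.C
      (((∏ k ∈ range (L + 1), (1 - a k / b i)) / ∏ k ∈ (range L).erase i, (1 - b k / b i)) * b i) *
        (oneSub (b i))⁻¹ := by
  have h : ∏ k ∈ range (L + 1), oneSub (a k) = (1 - PowerSeries.X) * ∏ k ∈ range L, oneSub (b k) +
      PowerSeries.X * ∑ i ∈ range L, PowerSeries.C
      (((∏ k ∈ range (L + 1), (1 - a k / b i)) / ∏ k ∈ (range L).erase i, (1 - b k / b i)) * b i) *
        ∏ k ∈ (range L).erase i, oneSub (b k) := by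
    have := powerSeries_eq_of_eval (P := ∏ k ∈ range (L + 1), oneSubPoly (a k))
      (Q := (1 - Polynomial.X) * ∏ k ∈ range L, oneSubPoly (b k) +
      Polynomial.X * ∑ i ∈ range L, Polynomial.C
      (((∏ k ∈ range (L + 1), (1 - a k / b i)) / ∏ k ∈ (range L).erase i, (1 - b k / b i)) * b i) *
        ∏ k ∈ (range L).erase i, oneSubPoly (b k)) ?_
    · simpa only [map_prod, map_sum, map_mul, map_add, map_sub, map_one, coe_oneSubPoly, ringHom_C,
        ringHom_X] using this
    · intro x hx
      have hx' := inv_ne_zero hx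
      have h1 := prod_eq_sum_resB hb hi hab x⁻¹
      simp only [Polynomial.eval_prod, Polynomial.eval_finsetSum, Polynomial.eval_mul,
        Polynomial.eval_C, eval_oneSubPoly, Polynomial.eval_add, Polynomial.eval_sub,
        Polynomial.eval_one, Polynomial.eval_X]
      simp only [prod_sub_eq hx', div_inv_eq_mul, card_range] at h1
      rw [← mul_right_inj' (pow_ne_zero (L + 1) hx'), h1, mul_add, mul_sum, mul_sum, mul_sum]
      congr 1
      · rw [pow_succ]; field_simp
      · refine sum_congr rfl fun i hi => ?_
        have hL : L = L - 1 + 1 := by have := mem_range.1 hi; omega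
        rw [card_erase_of_mem hi, card_range]
        have h2 : x⁻¹ ^ (L + 1) = x⁻¹ ^ (L - 1) * x⁻¹ * x⁻¹ := by
          rw [← pow_succ, ← pow_succ, ← hL]
        rw [h2]
        field_simp
  rw [ySeries, h, add_mul, mul_assoc, prod_oneSub_mul_inv, mul_one, mul_assoc, sum_mul]
  congr 2
  refine sum_congr rfl fun i hi => ?_
  rw [mul_assoc, prod_erase_mul_inv hi]

/-- The polynomial part 1 - X is the same as at 0. In `ySeries_delta` these parts cancel, since the
second series is read at index 1 - j. -/
theorem ySeries_inv_eq_sum (ha : ∀ k, a k ≠ 0) (hb : ∀ k, b k ≠ 0) (hi : Set.InjOn b (range L))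
    (hab : ∏ k ∈ range (L + 1), a k = ∏ k ∈ range L, b k) :
    ySeries (fun k => (a k)⁻¹) (fun k => (b k)⁻¹) L =
      1 - PowerSeries.X + PowerSeries.X * ∑ i ∈ range L, PowerSeries.C
      ((∏ k ∈ range (L + 1), (1 - a k / b i)) / ∏ k ∈ (range L).erase i, (1 - b k / b i)) *
        (oneSub (b i)⁻¹)⁻¹ := by
  have h : ∏ k ∈ range (L + 1), oneSub (a k)⁻¹ =
      (1 - PowerSeries.X) * ∏ k ∈ range L, oneSub (b k)⁻¹ +
      PowerSeries.X * ∑ i ∈ range L, PowerSeries.C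
      ((∏ k ∈ range (L + 1), (1 - a k / b i)) / ∏ k ∈ (range L).erase i, (1 - b k / b i)) *
        ∏ k ∈ (range L).erase i, oneSub (b k)⁻¹ := by
    have := powerSeries_eq_of_eval (P := ∏ k ∈ range (L + 1), oneSubPoly (a k)⁻¹)
      (Q := (1 - Polynomial.X) * ∏ k ∈ range L, oneSubPoly (b k)⁻¹ +
      Polynomial.X * ∑ i ∈ range L, Polynomial.C
      ((∏ k ∈ range (L + 1), (1 - a k / b i)) / ∏ k ∈ (range L).erase i, (1 - b k / b i)) *
        ∏ k ∈ (range L).erase i, oneSubPoly (b k)⁻¹) ?_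
    · simpa only [map_prod, map_sum, map_mul, map_add, map_sub, map_one, coe_oneSubPoly, ringHom_C,
        ringHom_X] using this
    · intro x hx
      have h1 := prod_eq_sum_resB hb hi hab x
      simp only [Polynomial.eval_prod, Polynomial.eval_finsetSum, Polynomial.eval_mul,
        Polynomial.eval_C, eval_oneSubPoly, Polynomial.eval_add, Polynomial.eval_sub,
        Polynomial.eval_one, Polynomial.eval_X]
      simp only [prod_sub_eq' x hb, prod_sub_eq' x ha] at h1
      have hne : ∏ k ∈ range (L + 1), -a k ≠ 0 :=
        prod_ne_zero_iff.2 fun k _ => neg_ne_zero.2 (ha k)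
      have h4 : ∏ k ∈ range (L + 1), -a k = -∏ k ∈ range L, -b k := by
        rw [prod_neg, prod_neg, card_range, card_range, hab, pow_succ]; ring
      rw [← mul_right_inj' hne, h1, mul_add, mul_sum, mul_sum, mul_sum]
      congr 1
      · rw [h4]; ring
      · refine sum_congr rfl fun i hi => ?_
        rw [h4, ← mul_prod_erase (range L) (fun k => -b k) hi]
        ring
  rw [ySeries, h, add_mul, mul_assoc, prod_oneSub_mul_inv (range L) fun k => (b k)⁻¹, mul_one,
    mul_assoc, sum_mul]
  congr 2
  refine sum_congr rfl fun i hi => ?_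
  rw [mul_assoc, prod_erase_mul_inv hi fun k => (b k)⁻¹]

theorem coeff_oneSub_inv (c : K) (n : ℕ) : PowerSeries.coeff n (oneSub c)⁻¹ = c ^ n := by
  rw [oneSub_inv, PowerSeries.coeff_mk]

/-- The difference of the expansions of `∏ (1 - b_k x) / ∏ (1 - a_k x)` at `0` and at `∞` is a sum
of delta functions. -/
theorem yInv_delta (ha : ∀ k, a k ≠ 0) (hb : ∀ k, b k ≠ 0) (hi : Set.InjOn a (range (L + 1)))
    (hab : ∏ k ∈ range (L + 1), a k = ∏ k ∈ range L, b k) (j : ℤ) :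
    coeffZ j (yInv a b L) + coeffZ (-j - 1) (yInv (fun k => (a k)⁻¹) (fun k => (b k)⁻¹) L) =
      ∑ i ∈ range (L + 1), ((∏ k ∈ range L, (1 - b k / a i)) /
        ∏ k ∈ (range (L + 1)).erase i, (1 - a k / a i)) * a i ^ j := by
  rcases lt_or_ge j 0 with hj | hj
  · obtain ⟨n, rfl⟩ : ∃ n : ℕ, j = -n - 1 := ⟨(-j - 1).toNat, by omega⟩
    -- At infinity 1/Y behaves like -1/x. This explains the plus sign between the two expansions and
    -- the index -j - 1; exactly one of them contributes for each j.
    rw [coeffZ_of_neg hj, zero_add, show -(-(n : ℤ) - 1) - 1 = n by ring, coeffZ_natCast,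
      yInv_inv_eq_sum ha hb hi hab, map_sum]
    refine sum_congr rfl fun i _ => ?_
    rw [PowerSeries.coeff_C_mul, coeff_oneSub_inv, mul_assoc, zpow_sub_one₀ (ha i), zpow_neg,
      zpow_natCast, inv_pow, mul_comm (a i)⁻¹]
  · lift j to ℕ using hj
    rw [coeffZ_of_neg (by omega : -(j : ℤ) - 1 < 0), add_zero, coeffZ_natCast,
      yInv_eq_sum ha hi, map_sum]
    refine sum_congr rfl fun i _ => ?_
    rw [PowerSeries.coeff_C_mul, coeff_oneSub_inv, zpow_natCast]

/-- The difference of the expansions of `∏ (1 - a_k x) / ∏ (1 - b_k x)` at `0` and at `∞` is a sum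
of delta functions. -/
theorem ySeries_delta (ha : ∀ k, a k ≠ 0) (hb : ∀ k, b k ≠ 0) (hi : Set.InjOn b (range L))
    (hab : ∏ k ∈ range (L + 1), a k = ∏ k ∈ range L, b k) (j : ℤ) :
    coeffZ j (ySeries a b L) + coeffZ (1 - j) (ySeries (fun k => (a k)⁻¹) (fun k => (b k)⁻¹) L) =
      ∑ i ∈ range L, ((∏ k ∈ range (L + 1), (1 - a k / b i)) /
        ∏ k ∈ (range L).erase i, (1 - b k / b i)) * b i ^ j := by
  rw [ySeries_eq_sum hb hi hab, ySeries_inv_eq_sum ha hb hi hab]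
  rcases lt_trichotomy j 0 with hj | rfl | hj
  · obtain ⟨n, rfl⟩ : ∃ n : ℕ, j = -n - 1 := ⟨(-j - 1).toNat, by omega⟩
    rw [coeffZ_of_neg hj, zero_add, show 1 - (-(n : ℤ) - 1) = (n + 1 + 1 : ℕ) by push_cast; ring,
      coeffZ_natCast, map_add, map_sub, PowerSeries.coeff_one, PowerSeries.coeff_X,
      if_neg (by omega), if_neg (by omega), sub_zero, zero_add, PowerSeries.coeff_succ_X_mul,
      map_sum]
    refine sum_congr rfl fun i _ => ?_
    rw [PowerSeries.coeff_C_mul, coeff_oneSub_inv, zpow_sub_one₀ (hb i), zpow_neg,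
      zpow_natCast, inv_pow, pow_succ, mul_inv]
  · have c0 : ∀ f : PowerSeries K, coeffZ 0 f = PowerSeries.coeff 0 f := fun f => coeffZ_natCast 0 f
    have c1 : ∀ f : PowerSeries K, coeffZ 1 f = PowerSeries.coeff 1 f := fun f => coeffZ_natCast 1 f
    rw [sub_zero, c0, c1]
    simp only [map_add, map_sub, PowerSeries.coeff_one, PowerSeries.coeff_X, if_pos,
      PowerSeries.coeff_zero_X_mul]
    rw [show (1 : ℕ) = 0 + 1 from rfl, PowerSeries.coeff_succ_X_mul, map_sum]
    simp only [PowerSeries.coeff_C_mul, coeff_oneSub_inv]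
    simp
  · obtain ⟨n, rfl⟩ : ∃ n : ℕ, j = n + 1 := ⟨(j - 1).toNat, by omega⟩
    rw [show (n : ℤ) + 1 = (n + 1 : ℕ) by push_cast; ring, coeffZ_natCast, map_add, map_sub,
      PowerSeries.coeff_succ_X_mul, map_sum]
    simp only [PowerSeries.coeff_C_mul, coeff_oneSub_inv]
    have h1 : PowerSeries.coeff (n + 1) (1 : PowerSeries K) - PowerSeries.coeff (n + 1)
        (PowerSeries.X : PowerSeries K) + coeffZ (1 - ((n + 1 : ℕ) : ℤ))
        (1 - PowerSeries.X + PowerSeries.X * ∑ i ∈ range L, PowerSeries.C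
      ((∏ k ∈ range (L + 1), (1 - a k / b i)) / ∏ k ∈ (range L).erase i, (1 - b k / b i)) *
        (oneSub (b i)⁻¹)⁻¹) = 0 := by
      rcases Nat.eq_zero_or_pos n with rfl | hn
      · rw [show (1 - ((0 + 1 : ℕ) : ℤ)) = ((0 : ℕ) : ℤ) by simp, coeffZ_natCast]
        simp
      · rw [coeffZ_of_neg (by push_cast; omega), PowerSeries.coeff_one, PowerSeries.coeff_X,
          if_neg (by omega), if_neg (by omega)]
        ring
    have h2 : ∀ i, b i ^ ((n + 1 : ℕ) : ℤ) = b i * b i ^ n := fun i => by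
      rw [zpow_natCast, pow_succ']
    simp only [h2, ← mul_assoc]
    linear_combination h1

end PartialFractions

/-! ### Exponentials of power sums as rational functions. -/

section Exponential

variable {K : Type*} [Field K] [CharZero K]

/-- `exp (∑_{n ≥ 1} E_n s^n / n)` -/
def pexp (E : ℕ → K) : PowerSeries K :=
  expSeries K (PowerSeries.mk fun n => if n = 0 then 0 else E n / n)

theorem pexp_congr {E E' : ℕ → K} (h : ∀ n, n ≠ 0 → E n = E' n) : pexp E = pexp E' := by
  rw [pexp, pexp]
  congr 1
  ext n
  rw [PowerSeries.coeff_mk, PowerSeries.coeff_mk]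
  split_ifs with hn
  · rfl
  · rw [h n hn]

theorem pexp_add (E E' : ℕ → K) : pexp (fun n => E n + E' n) = pexp E * pexp E' := by
  rw [pexp, pexp, pexp, ← expSeries_add (by simp) (by simp)]
  congr 1
  ext n
  rw [map_add, PowerSeries.coeff_mk, PowerSeries.coeff_mk, PowerSeries.coeff_mk]
  split_ifs
  · simp
  · ring

theorem pexp_zero : pexp (fun _ => (0 : K)) = 1 := by
  rw [pexp, ← expSeries_zero (K := K)]
  congr 1
  ext n
  simp

theorem pexp_sum (s : Finset ℕ) (E : ℕ → ℕ → K) :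
    pexp (fun n => ∑ k ∈ s, E k n) = ∏ k ∈ s, pexp (E k) := by
  induction s using Finset.induction_on with
  | empty => simp only [sum_empty, prod_empty, pexp_zero]
  | insert k s hk ih => simp only [sum_insert hk, prod_insert hk, pexp_add, ih]

theorem pexp_pow (a : K) : pexp (fun n => a ^ n) = (oneSub a)⁻¹ := expSeries_negLog a

theorem pexp_neg_pow (a : K) : pexp (fun n => -a ^ n) = oneSub a := by
  rw [← expSeries_neg_negLog, pexp]
  congr 1
  ext n
  rw [map_neg, coeff_negLog, PowerSeries.coeff_mk]
  split_ifs
  · simp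
  · ring

theorem pexp_yInv (a b : ℕ → K) (L : ℕ) (c : K) :
    pexp (fun n => c ^ n * (∑ k ∈ range (L + 1), a k ^ n - ∑ k ∈ range L, b k ^ n)) =
      yInv (fun k => c * a k) (fun k => c * b k) L := by
  have h : ∀ n, c ^ n * (∑ k ∈ range (L + 1), a k ^ n - ∑ k ∈ range L, b k ^ n) =
      ∑ k ∈ range L, -(c * b k) ^ n + ∑ k ∈ range (L + 1), (c * a k) ^ n := by
    intro n
    simp only [mul_pow, sum_neg_distrib, mul_sub, mul_sum]
    ring
  simp only [h]
  rw [pexp_add, pexp_sum, pexp_sum, yInv]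
  simp only [pexp_pow, pexp_neg_pow]

theorem pexp_ySeries (a b : ℕ → K) (L : ℕ) (c : K) :
    pexp (fun n => -(c ^ n * (∑ k ∈ range (L + 1), a k ^ n - ∑ k ∈ range L, b k ^ n))) =
      ySeries (fun k => c * a k) (fun k => c * b k) L := by
  have h : ∀ n, -(c ^ n * (∑ k ∈ range (L + 1), a k ^ n - ∑ k ∈ range L, b k ^ n)) =
      ∑ k ∈ range (L + 1), -(c * a k) ^ n + ∑ k ∈ range L, (c * b k) ^ n := by
    intro n
    simp only [mul_pow, sum_neg_distrib, mul_sub, mul_sum]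
    ring
  simp only [h]
  rw [pexp_add, pexp_sum, pexp_sum, ySeries]
  simp only [pexp_pow, pexp_neg_pow]

theorem rescale_oneSub (c a : K) : PowerSeries.rescale c (oneSub a) = oneSub (c * a) := by
  ext n
  rw [PowerSeries.coeff_rescale, oneSub, oneSub, map_sub, map_sub, PowerSeries.coeff_C_mul,
    PowerSeries.coeff_C_mul, PowerSeries.coeff_one, PowerSeries.coeff_X]
  split_ifs <;> simp_all

theorem rescale_oneSub_inv (c a : K) :
    PowerSeries.rescale c (oneSub a)⁻¹ = (oneSub (c * a))⁻¹ := by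
  ext n
  rw [PowerSeries.coeff_rescale, coeff_oneSub_inv, coeff_oneSub_inv, mul_pow]

/-- Rescaling commutes with the Euler derivation, so both sides solve the same first-order equation.
-/
theorem rescale_pexp (c : K) (E : ℕ → K) :
    PowerSeries.rescale c (pexp E) = pexp fun n => c ^ n * E n := by
  refine euler_ode_unique K (g := euler (PowerSeries.mk fun n => if n = 0 then 0 else
    c ^ n * E n / n)) (by simp [coeff_euler]) ?_ (euler_expSeries (by simp) (mul_comm _ _)) ?_
  · have h1 : ∀ f : PowerSeries K, euler (PowerSeries.rescale c f) =
        PowerSeries.rescale c (euler f) := by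
      intro f
      ext n
      rw [coeff_euler, PowerSeries.coeff_rescale, PowerSeries.coeff_rescale, coeff_euler,
        mul_smul_comm]
    rw [h1, pexp, euler_expSeries (by simp) (mul_comm _ _), map_mul, ← h1]
    congr 2
    ext n
    rw [PowerSeries.coeff_rescale, PowerSeries.coeff_mk, PowerSeries.coeff_mk]
    split_ifs <;> ring
  · rw [PowerSeries.coeff_rescale, pexp, pexp, expSeries_coeff_zero, expSeries_coeff_zero, pow_zero,
      one_mul]

theorem coeffZ_rescale {c : K} (j : ℤ) (f : PowerSeries K) :
    coeffZ j (PowerSeries.rescale c f) = c ^ j * coeffZ j f := by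
  rcases lt_or_ge j 0 with hj | hj
  · rw [coeffZ_of_neg hj, coeffZ_of_neg hj, mul_zero]
  · lift j to ℕ using hj
    rw [coeffZ_natCast, coeffZ_natCast, PowerSeries.coeff_rescale, zpow_natCast]

theorem yInv_scale (a b : ℕ → K) (L : ℕ) (c : K) :
    yInv (fun k => c * a k) (fun k => c * b k) L = PowerSeries.rescale c (yInv a b L) := by
  simp only [yInv, map_mul, map_prod, rescale_oneSub, rescale_oneSub_inv]

theorem ySeries_scale (a b : ℕ → K) (L : ℕ) (c : K) :
    ySeries (fun k => c * a k) (fun k => c * b k) L = PowerSeries.rescale c (ySeries a b L) := by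
  simp only [ySeries, map_mul, map_prod, rescale_oneSub, rescale_oneSub_inv]

/-- `1 - (1 - q^n) (1 - t^{-n}) ∑ χ^n`, where `χ` runs over the contents `q^j t^{-i}` of the boxes
of `lam`. -/
def boxSum (q t : K) (lam : YoungDiagram) (n : ℕ) : K :=
  1 - (1 - q ^ n) * (1 - t⁻¹ ^ n) * ∑ s ∈ lam.cells, (q ^ s.2 * t⁻¹ ^ s.1) ^ n

/-- Summing a geometric series along each row leaves its two ends; the left ends telescope over the
rows, and the right ends are the nodes. -/
theorem boxSum_eq {q t : K} {lam : YoungDiagram} {L : ℕ}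
    (hL : lam.colLen 0 ≤ L) (n : ℕ) : boxSum q t lam n =
      ∑ k ∈ range (L + 1), nodeA q t lam k ^ n - ∑ k ∈ range L, nodeB q t lam k ^ n := by
  have e1 : ∀ k, nodeA q t lam k ^ n = (q ^ n) ^ lam.rowLen k * (t⁻¹ ^ n) ^ k := by
    intro k
    rw [nodeA, zpow_natCast, zpow_neg, zpow_natCast, mul_pow, ← inv_pow]
    ring
  have e2 : ∀ k, nodeB q t lam k ^ n = (q ^ n) ^ lam.rowLen k * (t⁻¹ ^ n) ^ (k + 1) := by
    intro k
    rw [nodeB, zpow_natCast, ← neg_add', zpow_neg, ← Nat.cast_one, ← Nat.cast_add, zpow_natCast,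
      mul_pow, ← inv_pow]
    ring
  have e3 : ∀ s : ℕ × ℕ, (q ^ s.2 * t⁻¹ ^ s.1) ^ n = (q ^ n) ^ s.2 * (t⁻¹ ^ n) ^ s.1 := by
    intro s; ring
  simp only [e1, e2, boxSum, e3]
  generalize q ^ n = Q
  generalize t⁻¹ ^ n = T
  rw [sum_cells hL]
  simp only []
  have e4 : ∀ k, (1 - Q) * (1 - T) * ∑ j ∈ range (lam.rowLen k), Q ^ j * T ^ k =
      T ^ k - T ^ (k + 1) - (Q ^ lam.rowLen k * T ^ k - Q ^ lam.rowLen k * T ^ (k + 1)) := by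
    intro k
    rw [← sum_mul]
    have := mul_neg_geom_sum Q (lam.rowLen k)
    linear_combination (1 - T) * T ^ k * this
  rw [mul_sum, sum_congr rfl fun k _ => e4 k, sum_sub_distrib, sum_range_sub', sum_sub_distrib,
    sum_range_succ _ L, rowLen_eq_zero lam hL]
  ring

theorem nodeA_inv (q t : K) (lam : YoungDiagram) (k : ℕ) :
    nodeA q⁻¹ t⁻¹ lam k = (nodeA q t lam k)⁻¹ := by
  rw [nodeA, nodeA, inv_zpow, inv_zpow, mul_inv]

theorem nodeB_inv (q t : K) (lam : YoungDiagram) (k : ℕ) :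
    nodeB q⁻¹ t⁻¹ lam k = (nodeB q t lam k)⁻¹ := by
  rw [nodeB, nodeB, inv_zpow, inv_zpow, mul_inv]

/-- The product in the definition is Y(tx/q) / Y(x), the prefactor being the contribution of the
node k = 0. -/
theorem BPlus_eq {q t : K} (hq : q ≠ 0) (ht : t ≠ 0) (lam : YoungDiagram) :
    BPlus q t lam = pexp fun n => (1 - (t / q) ^ n) * boxSum q t lam n := by
  have h1 : pexp (fun n => (1 - (t / q) ^ n) * boxSum q t lam n) =
      yInv (fun k => 1 * nodeA q t lam k) (fun k => 1 * nodeB q t lam k) (lam.colLen 0) *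
        ySeries (fun k => t / q * nodeA q t lam k) (fun k => t / q * nodeB q t lam k)
          (lam.colLen 0) := by
    rw [← pexp_yInv, ← pexp_ySeries, ← pexp_add]
    refine pexp_congr fun n _ => ?_
    rw [boxSum_eq le_rfl]
    ring
  rw [h1, BPlus, yInv, ySeries]
  simp only [one_mul, PowerSeries.mul_inv_rev, prod_mul_distrib]
  rw [prod_range_succ' (fun k => (oneSub (nodeA q t lam k))⁻¹),
    prod_range_succ' (fun k => oneSub (t / q * nodeA q t lam k))]
  have a0 : q ^ lam.rowLen 0 = nodeA q t lam 0 := by simp [nodeA]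
  have a1 : q ^ ((lam.rowLen 0 : ℤ) - 1) * t = t / q * nodeA q t lam 0 := by
    rw [← a0, zpow_sub_one₀ hq, zpow_natCast]; ring
  have a2 : ∀ i, q ^ lam.rowLen i * t ^ (-(i : ℤ) - 1) = nodeB q t lam i := by
    intro i; rw [nodeB, zpow_natCast]
  have a3 : ∀ i, q ^ ((lam.rowLen i : ℤ) - 1) * t ^ (-(i : ℤ)) = t / q * nodeB q t lam i := by
    intro i
    rw [nodeB, zpow_sub_one₀ hq, zpow_sub_one₀ ht]
    field_simp
  have a4 : ∀ i, q ^ lam.rowLen (i + 1) * t ^ (-(i : ℤ) - 1) = nodeA q t lam (i + 1) := by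
    intro i; rw [nodeA, zpow_natCast]; congr 2; push_cast; ring
  have a5 : ∀ i, q ^ ((lam.rowLen (i + 1) : ℤ) - 1) * t ^ (-(i : ℤ)) =
      t / q * nodeA q t lam (i + 1) := by
    intro i
    rw [← a4, zpow_sub_one₀ hq, zpow_sub_one₀ ht, zpow_natCast]
    field_simp
  simp only [a0, a1, a2, a3, a4, a5]
  ring

theorem BMinus_eq {q t : K} (hq : q ≠ 0) (ht : t ≠ 0) (lam : YoungDiagram) :
    BMinus q t lam = pexp fun n => (1 - (q / t) ^ n) * boxSum q⁻¹ t⁻¹ lam n := by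
  rw [BMinus, BPlus_eq (inv_ne_zero hq) (inv_ne_zero ht)]
  refine pexp_congr fun n _ => ?_
  rw [inv_div_inv]

end Exponential

/-! ### Contractions of the currents with Φ*_λ. -/

section Contractions

variable {K : Type*} [Field K] [CharZero K] {q4 t4 u : K}

theorem generic_of_algebraicIndependent (h : AlgebraicIndependent ℚ ![q4, t4]) :
    Generic q4 t4 := by
  have hq : q4 ≠ 0 := h.ne_zero 0
  have ht : t4 ≠ 0 := h.ne_zero 1
  refine ⟨hq, ht, fun {a b} hab => ?_⟩
  -- Moving negative exponents to the other side turns the relation into an equality of two honest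
  -- monomials.
  have h1 : q4 ^ a.toNat * t4 ^ b.toNat = q4 ^ (-a).toNat * t4 ^ (-b).toNat := by
    have e1 : (a.toNat : ℤ) = a + (-a).toNat := by omega
    have e2 : (b.toNat : ℤ) = b + (-b).toNat := by omega
    rw [← zpow_natCast, ← zpow_natCast, e1, e2, zpow_add₀ hq, zpow_add₀ ht, zpow_natCast,
      zpow_natCast]
    linear_combination (q4 ^ (-a).toNat * t4 ^ (-b).toNat) * hab
  have h2 : (MvPolynomial.X 0 ^ a.toNat * MvPolynomial.X 1 ^ b.toNat : MvPolynomial (Fin 2) ℚ) =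
      MvPolynomial.X 0 ^ (-a).toNat * MvPolynomial.X 1 ^ (-b).toNat := by
    have h0 : Function.Injective (MvPolynomial.aeval (R := ℚ) ![q4, t4]) := h
    refine h0 ?_
    simpa using h1
  rw [MvPolynomial.X_pow_eq_monomial, MvPolynomial.X_pow_eq_monomial, MvPolynomial.X_pow_eq_monomial,
    MvPolynomial.X_pow_eq_monomial, MvPolynomial.monomial_mul, MvPolynomial.monomial_mul] at h2
  have h3 := MvPolynomial.monomial_left_injective (R := ℚ) (by norm_num : (1 : ℚ) * 1 ≠ 0) h2
  have h4 := DFunLike.congr_fun h3 0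
  have h5 := DFunLike.congr_fun h3 1
  simp at h4 h5
  omega

theorem Generic.pow_four (h : Generic q4 t4) : Generic (q4 ^ 4) (t4 ^ 4) := by
  refine ⟨pow_ne_zero _ h.q_ne, pow_ne_zero _ h.t_ne, fun {a b} hab => ?_⟩
  have := h.eq_zero (a := 4 * a) (b := 4 * b) (by
    rw [zpow_mul, zpow_mul]; exact_mod_cast hab)
  omega

theorem Generic.one_sub_q_pow_ne {q t : K} (h : Generic q t) {n : ℕ} (hn : n ≠ 0) :
    1 - q ^ n ≠ 0 := by
  have := h.om_ne (a := n) (b := 0) (by omega)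
  simpa [om] using this

theorem Generic.one_sub_t_pow_ne {q t : K} (h : Generic q t) {n : ℕ} (hn : n ≠ 0) :
    1 - t ^ n ≠ 0 := by
  have := h.om_ne (a := 0) (b := n) (by omega)
  simpa [om] using this

theorem Generic.kap_ne {q t : K} (h : Generic q t) (n : ℕ+) : kap q t n ≠ 0 :=
  mul_ne_zero (Nat.cast_ne_zero.2 n.ne_zero)
    (div_ne_zero (h.one_sub_q_pow_ne n.ne_zero) (h.one_sub_t_pow_ne n.ne_zero))

/-- The exponents of `:Φ̃*_∅(u) ξ_lam(u):` -/
def phiExp (q4 t4 u : K) (lam : YoungDiagram) : Exponents K :=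
  phiStarEmpty q4 t4 u + xiLam q4 t4 u lam

/-- Φ̃*_∅ contributes the 1 in `boxSum` and ξ_λ the sum over the boxes, once 1 / (1 - q^n) is
factored out. The latter is then cancelled by κ_n in every contraction. -/
theorem phiExp_fst (hg : Generic q4 t4) (lam : YoungDiagram) {n : ℕ} (hn : n ≠ 0) :
    (phiExp q4 t4 u lam).1 n =
      (t4 ^ 2 / q4 ^ 2 * u) ^ n / n * (boxSum (q4 ^ 4) (t4 ^ 4) lam n / (1 - (q4 ^ 4) ^ n)) := by
  have h1 := hg.pow_four.one_sub_q_pow_ne hn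
  have hn' : (n : K) ≠ 0 := Nat.cast_ne_zero.2 hn
  have h2 : (xiLam q4 t4 u lam).1 n = -((1 - (t4 ^ 4)⁻¹ ^ n) / n * (t4 ^ 2 / q4 ^ 2) ^ n) * u ^ n *
      ∑ s ∈ lam.cells, ((q4 ^ 4) ^ s.2 * (t4 ^ 4)⁻¹ ^ s.1) ^ n := by
    rw [xiLam, Prod.fst_sum, Finset.sum_apply, mul_sum]
    refine sum_congr rfl fun s _ => ?_
    simp only [Exponents.evalAt, xi]
    ring
  rw [phiExp, Prod.fst_add, Pi.add_apply, h2, boxSum]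
  simp only [phiStarEmpty]
  rw [mul_pow]
  field_simp
  ring

theorem phiExp_snd (hg : Generic q4 t4) (lam : YoungDiagram) {n : ℕ} (hn : n ≠ 0) :
    (phiExp q4 t4 u lam).2 n = (q4 ^ 4 * (t4 ^ 2 / q4 ^ 2) * u⁻¹) ^ n / n *
      (boxSum (q4 ^ 4)⁻¹ (t4 ^ 4)⁻¹ lam n / (1 - (q4 ^ 4) ^ n)) := by
  have h1 := hg.pow_four.one_sub_q_pow_ne hn
  have hn' : (n : K) ≠ 0 := Nat.cast_ne_zero.2 hn
  have hq : (q4 ^ 4) ^ n ≠ 0 := pow_ne_zero _ hg.pow_four.q_ne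
  have h2 : (xiLam q4 t4 u lam).2 n = (1 - (t4 ^ 4) ^ n) / n * (t4 ^ 2 / q4 ^ 2) ^ n * u⁻¹ ^ n *
      ∑ s ∈ lam.cells, ((q4 ^ 4)⁻¹ ^ s.2 * (t4 ^ 4)⁻¹⁻¹ ^ s.1) ^ n := by
    rw [xiLam, Prod.snd_sum, Finset.sum_apply, mul_sum]
    refine sum_congr rfl fun s _ => ?_
    simp only [Exponents.evalAt, xi, mul_inv, inv_pow]
    ring
  rw [phiExp, Prod.snd_add, Pi.add_apply, h2, boxSum]
  simp only [phiStarEmpty]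
  generalize ∑ s ∈ lam.cells, ((q4 ^ 4)⁻¹ ^ s.2 * (t4 ^ 4)⁻¹⁻¹ ^ s.1) ^ n = S
  rw [mul_pow, mul_pow, inv_inv, inv_pow (q4 ^ 4)]
  generalize (q4 ^ 4) ^ n = Q at *
  generalize (t4 ^ 2 / q4 ^ 2) ^ n = R
  generalize (t4 ^ 4) ^ n = T
  field_simp
  ring

theorem contr_eq_pexp {q t : K} {d c E : ℕ → K}
    (h : ∀ n, n ≠ 0 → kap q t n * d n * c n = E n / n) : contr q t d c = pexp E := by
  rw [contr, pexp]
  congr 1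
  ext n
  rw [PowerSeries.coeff_mk, PowerSeries.coeff_mk]
  split_ifs with hn
  · rfl
  · exact h n hn

variable (lam : YoungDiagram)

theorem contr_eta_phiExp (hg : Generic q4 t4) :
    contr (q4 ^ 4) (t4 ^ 4) (eta t4).2 (phiExp q4 t4 u lam).1 = pexp fun n =>
      -((t4 ^ 2 / q4 ^ 2 * u) ^ n * boxSum (q4 ^ 4) (t4 ^ 4) lam n) := by
  refine contr_eq_pexp fun n hn => ?_
  rw [phiExp_fst hg lam hn]
  have h1 := hg.pow_four.one_sub_q_pow_ne hn
  have h2 := hg.pow_four.one_sub_t_pow_ne hn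
  have hn' : (n : K) ≠ 0 := Nat.cast_ne_zero.2 hn
  simp only [eta, kap]
  generalize (q4 ^ 4) ^ n = Q at *
  generalize (t4 ^ 4) ^ n = T at *
  field_simp

theorem contr_xi_phiExp (hg : Generic q4 t4) :
    contr (q4 ^ 4) (t4 ^ 4) (xi q4 t4).2 (phiExp q4 t4 u lam).1 = pexp fun n =>
      (t4 ^ 4 / q4 ^ 4 * u) ^ n * boxSum (q4 ^ 4) (t4 ^ 4) lam n := by
  refine contr_eq_pexp fun n hn => ?_
  rw [phiExp_fst hg lam hn]
  have h1 := hg.pow_four.one_sub_q_pow_ne hn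
  have h2 := hg.pow_four.one_sub_t_pow_ne hn
  have hn' : (n : K) ≠ 0 := Nat.cast_ne_zero.2 hn
  simp only [xi, kap]
  rw [show t4 ^ 4 / q4 ^ 4 * u = t4 ^ 2 / q4 ^ 2 * (t4 ^ 2 / q4 ^ 2 * u) by ring, mul_pow _ (_ * u)]
  generalize (q4 ^ 4) ^ n = Q at *
  generalize (t4 ^ 4) ^ n = T at *
  generalize (t4 ^ 2 / q4 ^ 2 * u) ^ n = R
  generalize (t4 ^ 2 / q4 ^ 2) ^ n = S
  field_simp

/-- Stated for single exponents because uniqueness uses the logarithm of the contraction, existence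
its exponential. -/
theorem phiPlus_mul_phiExp (hg : Generic q4 t4) {n : ℕ} (hn : n ≠ 0) :
    kap (q4 ^ 4) (t4 ^ 4) n * (phiPlus q4 t4).2 n * (phiExp q4 t4 u lam).1 n =
      -((t4 / q4 * u) ^ n * ((1 - (t4 ^ 4 / q4 ^ 4) ^ n) * boxSum (q4 ^ 4) (t4 ^ 4) lam n)) / n := by
  rw [phiExp_fst hg lam hn]
  have h1 := hg.pow_four.one_sub_q_pow_ne hn
  have h2 := hg.pow_four.one_sub_t_pow_ne hn
  have hn' : (n : K) ≠ 0 := Nat.cast_ne_zero.2 hn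
  have hq := hg.q_ne
  have ht := hg.t_ne
  simp only [phiPlus, kap]
  rw [show t4 / q4 * u = q4 / t4 * (t4 ^ 2 / q4 ^ 2 * u) by field_simp, mul_pow (q4 / t4)]
  generalize (t4 ^ 4 / q4 ^ 4) ^ n = W
  generalize (q4 ^ 4) ^ n = Q at *
  generalize (t4 ^ 4) ^ n = T at *
  generalize (t4 ^ 2 / q4 ^ 2 * u) ^ n = R
  generalize (q4 / t4) ^ n = S
  field_simp

theorem contr_phiPlus_phiExp (hg : Generic q4 t4) :
    contr (q4 ^ 4) (t4 ^ 4) (phiPlus q4 t4).2 (phiExp q4 t4 u lam).1 = pexp fun n =>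
      -((t4 / q4 * u) ^ n * ((1 - (t4 ^ 4 / q4 ^ 4) ^ n) * boxSum (q4 ^ 4) (t4 ^ 4) lam n)) :=
  contr_eq_pexp fun _ hn => phiPlus_mul_phiExp lam hg hn

theorem contr_phiExp_eta (hg : Generic q4 t4) :
    contr (q4 ^ 4) (t4 ^ 4) (phiExp q4 t4 u lam).2 (eta t4).1 = pexp fun n =>
      -((t4 ^ 2 / q4 ^ 2 * u)⁻¹ ^ n * boxSum (q4 ^ 4)⁻¹ (t4 ^ 4)⁻¹ lam n) := by
  refine contr_eq_pexp fun n hn => ?_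
  rw [phiExp_snd hg lam hn]
  have h1 := hg.pow_four.one_sub_q_pow_ne hn
  have h2 := hg.pow_four.one_sub_t_pow_ne hn
  have hn' : (n : K) ≠ 0 := Nat.cast_ne_zero.2 hn
  have hq := hg.q_ne
  have ht := hg.t_ne
  have hT : (t4 ^ 4) ^ n ≠ 0 := pow_ne_zero _ hg.pow_four.t_ne
  simp only [eta, kap]
  rw [show q4 ^ 4 * (t4 ^ 2 / q4 ^ 2) * u⁻¹ = t4 ^ 4 * (t4 ^ 2 / q4 ^ 2 * u)⁻¹ by
    rw [mul_inv]; field_simp, mul_pow (t4 ^ 4), inv_pow (t4 ^ 4)]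
  generalize (q4 ^ 4) ^ n = Q at *
  generalize (t4 ^ 4) ^ n = T at *
  generalize (t4 ^ 2 / q4 ^ 2 * u)⁻¹ ^ n = R
  field_simp
  ring

theorem contr_phiExp_xi (hg : Generic q4 t4) :
    contr (q4 ^ 4) (t4 ^ 4) (phiExp q4 t4 u lam).2 (xi q4 t4).1 = pexp fun n =>
      u⁻¹ ^ n * boxSum (q4 ^ 4)⁻¹ (t4 ^ 4)⁻¹ lam n := by
  refine contr_eq_pexp fun n hn => ?_
  rw [phiExp_snd hg lam hn]
  have h1 := hg.pow_four.one_sub_q_pow_ne hn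
  have h2 := hg.pow_four.one_sub_t_pow_ne hn
  have hn' : (n : K) ≠ 0 := Nat.cast_ne_zero.2 hn
  have hq := hg.q_ne
  have ht := hg.t_ne
  have hT : (t4 ^ 4) ^ n ≠ 0 := pow_ne_zero _ hg.pow_four.t_ne
  have hS : (t4 ^ 2 / q4 ^ 2) ^ n ≠ 0 := pow_ne_zero _ (div_ne_zero (pow_ne_zero _ ht) (pow_ne_zero _ hq))
  simp only [xi, kap]
  rw [show q4 ^ 4 * (t4 ^ 2 / q4 ^ 2) * u⁻¹ = t4 ^ 4 * ((t4 ^ 2 / q4 ^ 2)⁻¹ * u⁻¹) by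
    field_simp, mul_pow (t4 ^ 4), mul_pow _⁻¹, inv_pow (t4 ^ 4), inv_pow (t4 ^ 2 / q4 ^ 2)]
  generalize (q4 ^ 4) ^ n = Q at *
  generalize (t4 ^ 4) ^ n = T at *
  generalize (t4 ^ 2 / q4 ^ 2) ^ n = R at *
  field_simp
  ring

theorem phiExp_mul_phiMinus (hg : Generic q4 t4) {n : ℕ} (hn : n ≠ 0) :
    kap (q4 ^ 4) (t4 ^ 4) n * (phiExp q4 t4 u lam).2 n * (phiMinus q4 t4).1 n =
      (t4 / q4 * u⁻¹) ^ n *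
        ((1 - (q4 ^ 4 / t4 ^ 4) ^ n) * boxSum (q4 ^ 4)⁻¹ (t4 ^ 4)⁻¹ lam n) / n := by
  rw [phiExp_snd hg lam hn]
  have h1 := hg.pow_four.one_sub_q_pow_ne hn
  have h2 := hg.pow_four.one_sub_t_pow_ne hn
  have hn' : (n : K) ≠ 0 := Nat.cast_ne_zero.2 hn
  have hq := hg.q_ne
  have ht := hg.t_ne
  have hT : (t4 ^ 4) ^ n ≠ 0 := pow_ne_zero _ hg.pow_four.t_ne
  have hQ : (q4 ^ 4) ^ n ≠ 0 := pow_ne_zero _ hg.pow_four.q_ne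
  have hS : (q4 / t4) ^ n ≠ 0 := pow_ne_zero _ (div_ne_zero hq ht)
  simp only [phiMinus, kap]
  rw [show q4 ^ 4 * (t4 ^ 2 / q4 ^ 2) * u⁻¹ = q4 ^ 4 * ((q4 / t4)⁻¹ * (t4 / q4 * u⁻¹)) by
    field_simp, mul_pow (q4 ^ 4), mul_pow _⁻¹, inv_pow (t4 ^ 4), inv_pow (q4 / t4),
    div_pow (q4 ^ 4), div_pow (t4 ^ 4)]
  generalize (q4 ^ 4) ^ n = Q at *
  generalize (t4 ^ 4) ^ n = T at *
  generalize (q4 / t4) ^ n = R at *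
  generalize (t4 / q4 * u⁻¹) ^ n = S at *
  field_simp
  ring

theorem contr_phiExp_phiMinus (hg : Generic q4 t4) :
    contr (q4 ^ 4) (t4 ^ 4) (phiExp q4 t4 u lam).2 (phiMinus q4 t4).1 = pexp fun n =>
      (t4 / q4 * u⁻¹) ^ n *
        ((1 - (q4 ^ 4 / t4 ^ 4) ^ n) * boxSum (q4 ^ 4)⁻¹ (t4 ^ 4)⁻¹ lam n) :=
  contr_eq_pexp fun _ hn => phiExp_mul_phiMinus lam hg hn

end Contractions

/-! ### Weighted sums of modes of an annihilating current. -/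

section OneSided

variable {K : Type*} [Field K] [CharZero K] {q t : K}

theorem convHat_annihilating (d : ℕ → K) (b : PowerSeries K) (n : ℕ) (F : FockHat K) :
    convHat q t (0, d) b (-n) F = ∑ k ∈ range (n + 1),
      PowerSeries.coeff k b • modeHat q t (0, d) (-((n - k : ℕ) : ℤ)) F := by
  refine MvPowerSeries.ext fun m => ?_
  rw [coeff_convHat _ _ _ F (B := n + 1 + wt m) (by push_cast; omega), map_sum]
  symm
  refine (sum_congr rfl fun k hk => ?_).trans
    (sum_subset (range_subset_range.2 (by omega)) fun k _ hk => ?_)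
  · rw [mem_range] at hk
    rw [map_smul, smul_eq_mul, show -((n - k : ℕ) : ℤ) = -n + k by omega]
  · rw [mem_range] at hk
    rw [modeHat_annihilating, ann_of_neg _ _ (by omega), LinearMap.zero_apply, map_zero, mul_zero]

end OneSided

/-! ### Distinctness and cancellation of nodes. -/

section Nodes

variable {K : Type*} [Field K] {q t : K} {lam mu : YoungDiagram} {i : ℕ}

theorem Generic.nodeA_inj (hg : Generic q t) (lam : YoungDiagram) {k l : ℕ}
    (h : nodeA q t lam k = nodeA q t lam l) : k = l := by
  have h1 := hg.div_eq (lam.rowLen k) (-k) (lam.rowLen l) (-l)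
  by_contra hkl
  refine hg.om_ne (a := lam.rowLen k - lam.rowLen l) (b := -k - -l) (by omega) ?_
  rw [← h1]
  rw [nodeA, nodeA] at h
  have h2 := hg.nodeA_ne lam l
  rw [nodeA] at h2
  rw [h, div_self h2, sub_self]

theorem nodeB_eq (ht : t ≠ 0) (lam : YoungDiagram) (k : ℕ) :
    nodeB q t lam k = nodeA q t lam k * t⁻¹ := by
  rw [nodeA, nodeB, zpow_sub_one₀ ht, mul_assoc]

theorem Generic.nodeB_inj (hg : Generic q t) (lam : YoungDiagram) {k l : ℕ}
    (h : nodeB q t lam k = nodeB q t lam l) : k = l := by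
  rw [nodeB_eq hg.t_ne, nodeB_eq hg.t_ne] at h
  exact hg.nodeA_inj lam (mul_right_cancel₀ (inv_ne_zero hg.t_ne) h)

/-- The extra node a_L has no power of q, and the powers of t agree after a shift of the index. This
is the equality of products behind the behaviour of Y at infinity. -/
theorem prod_nodeA (q t : K) {L : ℕ} (hL : lam.colLen 0 ≤ L) :
    ∏ k ∈ range (L + 1), nodeA q t lam k = ∏ k ∈ range L, nodeB q t lam k := by
  simp only [nodeA, nodeB, prod_mul_distrib]
  congr 1
  · rw [prod_range_succ, rowLen_eq_zero lam hL]
    simp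
  · rw [prod_range_succ']
    simp only [Nat.cast_zero, neg_zero, zpow_zero, mul_one]
    refine prod_congr rfl fun k _ => ?_
    congr 1
    push_cast
    ring

/-- When row i - 1 has the same length, b_{i-1} = a_i and zero and pole cancel. Sums over all rows
therefore agree with sums over the rows that can be extended. -/
theorem resA_eq_zero (hg : Generic q t) {L : ℕ} (hi : i ≤ L) (h : addBox lam i = none) :
    resA q t lam L i = 0 := by
  obtain ⟨k, rfl, hk⟩ := addBox_eq_none h
  rw [resA, div_eq_zero_iff]
  refine Or.inl (prod_eq_zero (mem_range.2 (Nat.lt_of_succ_le hi)) ?_)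
  rw [sub_eq_zero, eq_comm, div_eq_one_iff_eq (hg.nodeA_ne _ _), nodeA, nodeB, hk]
  congr 2
  push_cast
  ring

/-- When row i + 1 has the same length, a_{i+1} = b_i, and the pole at the end of row i disappears.
-/
theorem resB_eq_zero (hg : Generic q t) {L : ℕ} (hi : i < L) (h : removeBox lam i = none) :
    resB q t lam L i = 0 := by
  rw [resB, div_eq_zero_iff]
  refine Or.inl (prod_eq_zero (mem_range.2 (Nat.succ_lt_succ hi)) ?_)
  rw [sub_eq_zero, eq_comm, div_eq_one_iff_eq (hg.nodeB_ne _ _), nodeA, nodeB, removeBox_eq_none h]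
  congr 2
  push_cast
  ring

/-- The content `q^{lam_i} t^{-i}` of the box that can be added to row `i`. -/
theorem IsAdd.nodeB_mul (h : IsAdd lam i mu) (hq : q ≠ 0) (ht : t ≠ 0) :
    nodeB q t mu i * (t / q) = nodeA q t lam i := by
  rw [nodeA, nodeB, h.rowLen_self, Nat.cast_succ, zpow_sub_one₀ ht, zpow_add_one₀ hq]
  field_simp

end Nodes

/-! ### Sums over neighbouring partitions as sums over rows. -/

section Reindexing

variable {M : Type*} [AddCommMonoid M]

open Classical in
theorem sum_neighbours_isAdd_left (mu : YoungDiagram) (f : YoungDiagram → ℕ → M) :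
    ∑ lam ∈ neighbours mu, ∑ i ∈ range (lam.colLen 0 + 1), (if IsAdd lam i mu then f lam i else 0) =
      ∑ i ∈ range (mu.colLen 0), (removeBox mu i).elim 0 fun lam => f lam i := by
  have h1 : ∀ lam, ∑ i ∈ range (lam.colLen 0 + 1), (if IsAdd lam i mu then f lam i else 0) =
      ∑ i ∈ range (mu.colLen 0), if IsAdd lam i mu then f lam i else 0 := by
    intro lam
    rw [← sum_filter, ← sum_filter]
    refine sum_congr (Finset.ext fun i => ?_) fun _ _ => rfl
    rw [mem_filter, mem_filter, mem_range, mem_range]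
    exact ⟨fun h => ⟨h.2.lt_colLen, h.2⟩, fun h => ⟨Nat.lt_succ_of_le h.2.le_colLen, h.2⟩⟩
  rw [sum_congr rfl fun lam _ => h1 lam, sum_comm]
  refine sum_congr rfl fun i _ => ?_
  rcases h : removeBox mu i with _ | lam
  · refine sum_eq_zero fun lam _ => if_neg fun h2 => ?_
    rw [removeBox_eq_some.2 h2] at h
    cases h
  · have h2 := removeBox_eq_some.1 h
    rw [sum_eq_single_of_mem lam h2.mem_neighbours, if_pos h2]
    · rfl
    · intro lam' _ hne
      refine if_neg fun h3 => hne ?_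
      rw [removeBox_eq_some.2 h3] at h
      exact Option.some_injective _ h

open Classical in
theorem sum_neighbours_isAdd_right (mu : YoungDiagram) (f : YoungDiagram → ℕ → M) :
    ∑ lam ∈ neighbours mu, ∑ i ∈ range (lam.colLen 0), (if IsAdd mu i lam then f lam i else 0) =
      ∑ i ∈ range (mu.colLen 0 + 1), (addBox mu i).elim 0 fun lam => f lam i := by
  have h1 : ∀ lam, ∑ i ∈ range (lam.colLen 0), (if IsAdd mu i lam then f lam i else 0) =
      ∑ i ∈ range (mu.colLen 0 + 1), if IsAdd mu i lam then f lam i else 0 := by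
    intro lam
    rw [← sum_filter, ← sum_filter]
    refine sum_congr (Finset.ext fun i => ?_) fun _ _ => rfl
    rw [mem_filter, mem_filter, mem_range, mem_range]
    exact ⟨fun h => ⟨Nat.lt_succ_of_le h.2.le_colLen, h.2⟩, fun h => ⟨h.2.lt_colLen, h.2⟩⟩
  rw [sum_congr rfl fun lam _ => h1 lam, sum_comm]
  refine sum_congr rfl fun i _ => ?_
  rcases h : addBox mu i with _ | lam
  · refine sum_eq_zero fun lam _ => if_neg fun h2 => ?_
    rw [addBox_eq_some.2 h2] at h
    cases h
  · have h2 := addBox_eq_some.1 h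
    rw [sum_eq_single_of_mem lam h2.mem_neighbours', if_pos h2]
    · rfl
    · intro lam' _ hne
      refine if_neg fun h3 => hne ?_
      rw [addBox_eq_some.2 h3] at h
      exact Option.some_injective _ h

end Reindexing

/-! ### The coproduct action in components, and the reduction to generators. -/

section Coproduct

variable {K : Type*} [Field K] [CharZero K] {q4 t4 u v : K} {N : ℤ} (T : TensorHat K) (mu : YoungDiagram)
  (A : Module.End K (FockHat K))

theorem tens_apply (B : Module.End K (VFock K)) :
    tens A B T mu = ∑ lam ∈ neighbours mu, B (Finsupp.single lam 1) mu • A (T lam) := by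
  rw [tens, LinearMap.pi_apply, LinearMap.sum_apply]
  rfl

theorem tens_diagonal {B : Module.End K (VFock K)} {c : YoungDiagram → K}
    (hB : ∀ lam, B (Finsupp.single lam 1) = c lam • basisP K (some lam)) :
    tens A B T mu = c mu • A (T mu) := by
  rw [tens_apply, sum_eq_single_of_mem mu (mem_neighbours_self mu)]
  · simp [hB, basisP]
  · intro lam _ hne
    simp [hB, basisP, hne]

theorem tens_one : tens A 1 T mu = A (T mu) := by
  rw [tens_diagonal T mu A (c := fun _ => 1), one_smul]
  intro lam
  rw [one_smul]
  rfl

theorem tens_psip (k : ℕ) : tens A (vertical q4 t4 u (Gen.psip k)) T mu =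
    (q4 ^ 2 / t4 ^ 2 * (PowerSeries.coeff k (BPlus (q4 ^ 4) (t4 ^ 4) mu) * u ^ k)) • A (T mu) :=
  tens_diagonal T mu A (c := fun mu => q4 ^ 2 / t4 ^ 2 *
    (PowerSeries.coeff k (BPlus (q4 ^ 4) (t4 ^ 4) mu) * u ^ k)) fun lam => by
      rw [vertical, Finsupp.linearCombination_single, one_smul]

theorem tens_psim (k : ℕ) : tens A (vertical q4 t4 u (Gen.psim k)) T mu =
    (t4 ^ 2 / q4 ^ 2 * (PowerSeries.coeff k (BMinus (q4 ^ 4) (t4 ^ 4) mu) * u⁻¹ ^ k)) • A (T mu) :=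
  tens_diagonal T mu A (c := fun mu => t4 ^ 2 / q4 ^ 2 *
    (PowerSeries.coeff k (BMinus (q4 ^ 4) (t4 ^ 4) mu) * u⁻¹ ^ k)) fun lam => by
      rw [vertical, Finsupp.linearCombination_single, one_smul]

theorem tens_xp (n : ℤ) : tens A (vertical q4 t4 u (Gen.xp n)) T mu =
    ∑ i ∈ range (mu.colLen 0), (removeBox mu i).elim 0 fun lam =>
      (APlus (q4 ^ 4) (t4 ^ 4) lam i * (nodeA (q4 ^ 4) (t4 ^ 4) lam i * u) ^ n) • A (T lam) := by
  classical
  rw [tens_apply, ← sum_neighbours_isAdd_left]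
  refine sum_congr rfl fun lam _ => ?_
  rw [vertical, Finsupp.linearCombination_single, one_smul, Finsupp.finsetSum_apply, sum_smul]
  refine sum_congr rfl fun i _ => ?_
  rw [Finsupp.smul_apply, ← addBox_eq_some, nodeA, zpow_natCast]
  rcases addBox lam i with _ | lam'
  · simp [basisP]
  · simp only [basisP, Finsupp.single_apply, Option.some_inj]
    split_ifs <;> simp

theorem tens_xm (n : ℤ) : tens A (vertical q4 t4 u (Gen.xm n)) T mu =
    ∑ i ∈ range (mu.colLen 0 + 1), (addBox mu i).elim 0 fun lam =>
      (q4 ^ 2 / t4 ^ 2 * (AMinus (q4 ^ 4) (t4 ^ 4) lam i *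
        (nodeA (q4 ^ 4) (t4 ^ 4) mu i * u) ^ n)) • A (T lam) := by
  classical
  rw [tens_apply, ← sum_neighbours_isAdd_right]
  refine sum_congr rfl fun lam _ => ?_
  rw [vertical, Finsupp.linearCombination_single, one_smul, Finsupp.smul_apply,
    Finsupp.finsetSum_apply, smul_eq_mul, mul_sum, sum_smul]
  refine sum_congr rfl fun i _ => ?_
  rw [Finsupp.smul_apply, ← removeBox_eq_some]
  rcases h : removeBox lam i with _ | lam'
  · simp [basisP]
  · simp only [basisP, Finsupp.single_apply, Option.some_inj]
    split_ifs with h1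
    · subst h1
      rw [nodeA, (removeBox_eq_some.1 h).rowLen_self]
      simp
    · simp

theorem coeff_sumOp (bound : (ℕ+ →₀ ℕ) → ℕ) (O : ℕ → Module.End K (TensorHat K)) (m : ℕ+ →₀ ℕ) :
    MvPowerSeries.coeff m (sumOp bound O T mu) =
      ∑ k ∈ range (bound m), MvPowerSeries.coeff m (O k T mu) := by
  rw [sumOp, LinearMap.pi_apply]
  change (∑ k ∈ range (bound m), _ : TensorHat K →ₗ[K] K) T = _
  rw [LinearMap.sum_apply]
  rfl

theorem coproductAction_psip (n : ℕ) : coproductAction q4 t4 N v u (Gen.psip n) T mu =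
    (q4 ^ 2 / t4 ^ 2) ^ N • (q4 ^ 2 / t4 ^ 2) • convHat (q4 ^ 4) (t4 ^ 4) (phiPlus q4 t4)
      (PowerSeries.rescale (t4 / q4 * u) (BPlus (q4 ^ 4) (t4 ^ 4) mu)) (-n) (T mu) := by
  rw [phiPlus, convHat_annihilating, smul_sum, smul_sum, coproductAction, LinearMap.sum_apply,
    Finset.sum_apply]
  refine sum_congr rfl fun k _ => ?_
  rw [LinearMap.smul_apply, Pi.smul_apply, tens_psip, horizontal, LinearMap.smul_apply, smul_smul,
    smul_smul, smul_smul, smul_smul, PowerSeries.coeff_rescale]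
  congr 1
  ring

theorem coproductAction_psim (n : ℕ) : coproductAction q4 t4 N v u (Gen.psim n) T mu =
    (t4 ^ 2 / q4 ^ 2) ^ N • (t4 ^ 2 / q4 ^ 2) • ∑ k ∈ range (n + 1),
      PowerSeries.coeff k (PowerSeries.rescale (t4 / q4 * u⁻¹) (BMinus (q4 ^ 4) (t4 ^ 4) mu)) •
        modeHat (q4 ^ 4) (t4 ^ 4) (phiMinus q4 t4) (n - k : ℕ) (T mu) := by
  rw [smul_sum, smul_sum, coproductAction, LinearMap.sum_apply, Finset.sum_apply]
  refine sum_congr rfl fun k _ => ?_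
  rw [LinearMap.smul_apply, Pi.smul_apply, tens_psim, horizontal, LinearMap.smul_apply, smul_smul,
    smul_smul, smul_smul, smul_smul, PowerSeries.coeff_rescale]
  congr 1
  ring

/-- The eigenvalues of ψ^+ in the second factor act as weights on the modes of ξ, giving the
convolution; the other term adds a box to `mu` and takes the component there. -/
theorem coproductAction_xm (n : ℤ) : coproductAction q4 t4 N v u (Gen.xm n) T mu =
    (v⁻¹ * (q4 ^ 2 / t4 ^ 2) ^ N * (q4 ^ 2 / t4 ^ 2)) • convHat (q4 ^ 4) (t4 ^ 4) (xi q4 t4)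
      (PowerSeries.rescale u (BPlus (q4 ^ 4) (t4 ^ 4) mu)) (-N - n) (T mu) +
    ∑ i ∈ range (mu.colLen 0 + 1), (addBox mu i).elim 0 fun lam =>
      (q4 ^ 2 / t4 ^ 2 * (AMinus (q4 ^ 4) (t4 ^ 4) lam i *
        (nodeA (q4 ^ 4) (t4 ^ 4) mu i * u) ^ n)) • T lam := by
  rw [coproductAction, LinearMap.add_apply, Pi.add_apply, tens_xm]
  congr 1
  refine MvPowerSeries.ext fun m => ?_
  rw [coeff_sumOp, map_smul, coeff_convHat _ _ _ _ (B := (wt m + n + N + 1 : ℤ).toNat) (by omega),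
    smul_sum]
  refine sum_congr rfl fun k _ => ?_
  rw [tens_psip, horizontal, LinearMap.smul_apply, smul_smul, map_smul, smul_eq_mul, smul_eq_mul,
    PowerSeries.coeff_rescale, show -N - n + (k : ℤ) = -N - (n - k) by ring]
  ring

/-- The delta function in the vertical factor fixes the argument of ψ^-, so its modes are summed
with geometric weights, that is, φ^- is evaluated at the content of the box divided by γ^{1/2}. -/
theorem coproductAction_xp (hq : q4 ≠ 0) (ht : t4 ≠ 0) (hu : u ≠ 0) (n : ℤ) :
    coproductAction q4 t4 N v u (Gen.xp n) T mu =
    (v * (t4 ^ 2 / q4 ^ 2) ^ N) • modeHat (q4 ^ 4) (t4 ^ 4) (eta t4) (N - n) (T mu) +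
    ∑ i ∈ range (mu.colLen 0), (removeBox mu i).elim 0 fun lam =>
      ((t4 ^ 2 / q4 ^ 2) ^ N * (APlus (q4 ^ 4) (t4 ^ 4) lam i *
        (nodeA (q4 ^ 4) (t4 ^ 4) lam i * u / (t4 ^ 2 / q4 ^ 2)) ^ n)) •
          convHat (q4 ^ 4) (t4 ^ 4) (phiMinus q4 t4)
            (PowerSeries.mk fun l => (nodeA (q4 ^ 4) (t4 ^ 4) lam i * u / (t4 / q4)) ^ l) 0
              (T lam) := by
  rw [coproductAction, LinearMap.add_apply, Pi.add_apply, tens_one]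
  congr 1
  refine MvPowerSeries.ext fun m => ?_
  rw [coeff_sumOp, map_sum]
  simp_rw [LinearMap.smul_apply, Pi.smul_apply, tens_xp, map_smul, map_sum, smul_sum]
  rw [sum_comm]
  refine sum_congr rfl fun i _ => ?_
  rcases removeBox mu i with _ | lam
  · simp
  · simp only [Option.elim_some]
    rw [map_smul, coeff_convHat _ _ _ _ (B := wt m + 1) (by push_cast; omega), smul_sum]
    refine sum_congr rfl fun k _ => ?_
    have hy : nodeA (q4 ^ 4) (t4 ^ 4) lam i * u ≠ 0 := mul_ne_zero
      (mul_ne_zero (zpow_ne_zero _ (pow_ne_zero _ hq)) (zpow_ne_zero _ (pow_ne_zero _ ht))) hu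
    have hr : t4 / q4 ≠ 0 := div_ne_zero ht hq
    generalize nodeA (q4 ^ 4) (t4 ^ 4) lam i * u = y at *
    rw [horizontal, LinearMap.smul_apply, map_smul, map_smul, smul_eq_mul, smul_eq_mul, smul_eq_mul,
      smul_eq_mul, PowerSeries.coeff_mk, zero_add, zpow_add₀ hy, show t4 ^ 2 / q4 ^ 2 = (t4 / q4) ^ 2
      by ring, zpow_sub₀ hr, zpow_mul, div_zpow y, div_pow y, zpow_natCast, zpow_natCast]
    rw [show ((t4 / q4) ^ (-2 : ℤ)) ^ n = (((t4 / q4) ^ 2) ^ n)⁻¹ by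
      rw [zpow_neg, inv_zpow]; norm_cast]
    ring

variable {w : K} {Phi : Fock K →ₗ[K] TensorHat K}

/-- Both actions are homomorphisms from the free algebra, so compatibility with the generators
propagates through sums and products. -/
theorem isDualIntertwiner_iff : IsDualIntertwiner q4 t4 N u v w Phi ↔
    ∀ (g : Gen) (f : Fock K), coproductAction q4 t4 N v u g (Phi f) =
      Phi (horizontal (modeF (q4 ^ 4) (t4 ^ 4)) q4 t4 (N + 1) w g f) := by
  constructor
  · intro h g f
    simpa using h _ (FreeAlgebra.ι K g) rfl f
  · intro h a x _
    clear * - h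
    induction x using FreeAlgebra.induction with
    | grade0 r =>
      intro f
      rw [AlgHom.commutes, AlgHom.commutes, Module.algebraMap_end_apply,
        Module.algebraMap_end_apply, map_smul]
    | grade1 g =>
      intro f
      simpa using h g f
    | mul x y hx hy =>
      intro f
      rw [map_mul, map_mul, Module.End.mul_apply, Module.End.mul_apply, hy, hx]
    | add x y hx hy =>
      intro f
      rw [map_add, map_add, LinearMap.add_apply, LinearMap.add_apply, hx, hy, map_add]

end Coproduct

/-! ### Comparison and convolution of vertex families. -/

section VertexTools

variable {K : Type*} [Field K] [CharZero K] {q t : K} {e e' : Exponents K}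
  {X Y : ℤ → Fock K →ₗ[K] FockHat K}

theorem IsVertex.ext (hκ : ∀ n : ℕ+, kap q t n ≠ 0) (hX : IsVertex q t e e' X)
    (hY : IsVertex q t e e' Y)
    (h : ∀ k, MvPowerSeries.constantCoeff (X k 1) = MvPowerSeries.constantCoeff (Y k 1)) (k : ℤ) :
    X k = Y k := by
  refine sub_eq_zero.1 ((hX.sub hY).eq_zero hκ (fun k => ?_) k)
  rw [LinearMap.sub_apply, map_sub, h, sub_self]

theorem IsVertex.conv (hX : IsVertex q t e e' X) (h0 : ∀ k < 0, X k = 0) (b : PowerSeries K) :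
    IsVertex q t e e' fun k => ∑ l ∈ range (k + 1).toNat, PowerSeries.coeff l b • X (k - l) := by
  have h1 : ∀ (B : ℕ) (k : ℤ), k < B →
      ∑ l ∈ range (k + 1).toNat, PowerSeries.coeff l b • X (k - l) =
        ∑ l ∈ range B, PowerSeries.coeff l b • X (k - l) := by
    intro B k hB
    refine sum_subset (range_subset_range.2 (by omega)) fun l _ hl => ?_
    rw [mem_range] at hl
    rw [h0 _ (by omega), smul_zero]
  have h2 : ∀ B : ℕ, IsVertex q t e e' fun k => ∑ l ∈ range B, PowerSeries.coeff l b • X (k - l) :=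
    fun B => IsVertex.sum _ fun l _ => (hX.shift (-l)).smul _
  refine ⟨fun n k f => ?_, fun n k f => ?_⟩
  · rw [h1 (k + 1).toNat k (by omega), h1 (k + 1).toNat (k - n) (by omega)]
    exact (h2 _).pos n k f
  · rw [h1 (k + n + 1).toNat k (by omega), h1 (k + n + 1).toNat (k + n) (by omega)]
    exact (h2 _).neg n k f

theorem coeffZ_one (k : ℤ) : coeffZ k (1 : PowerSeries K) = if k = 0 then 1 else 0 := by
  rcases lt_or_ge k 0 with hk | hk
  · rw [coeffZ_of_neg hk, if_neg hk.ne]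
  · lift k to ℕ using hk
    rw [coeffZ_natCast, PowerSeries.coeff_one]
    simp

end VertexTools

/-! ### Existence of the intertwiner for w = -vu. -/

section Existence

theorem rowLen_bot (i : ℕ) : (⊥ : YoungDiagram).rowLen i = 0 := by
  by_contra h
  exact YoungDiagram.notMem_bot _
    ((YoungDiagram.mem_iff_lt_rowLen (μ := ⊥) (i := i) (j := 0)).2 (Nat.pos_of_ne_zero h))

theorem transpose_bot : (⊥ : YoungDiagram).transpose = ⊥ :=
  YoungDiagram.ext (by ext p; simp)

theorem nStat_bot : nStat ⊥ = 0 := by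
  simp [nStat, rowLen_bot]

variable {K : Type*} [Field K] [CharZero K] {q4 t4 u v : K} {N : ℤ} {lam mu : YoungDiagram} {i : ℕ}

theorem IsAdd.phiExp (h : IsAdd lam i mu) :
    phiExp q4 t4 u mu =
      (xi q4 t4).evalAt (nodeA (q4 ^ 4) (t4 ^ 4) lam i * u) + phiExp q4 t4 u lam := by
  rw [Toroidal.phiExp, Toroidal.phiExp, xiLam, xiLam, h, sum_insert (IsAdd.not_mem lam i), nodeA,
    zpow_natCast, zpow_neg, zpow_natCast, ← inv_pow (t4 ^ 4) i]
  abel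

/-- The annihilating parts of η(γ^{-1} y) and ξ(y) cancel. In the x^+ relation the factor ξ(y) adds
the box, and η(γ^{-1} y) remains at the pole of the contraction. -/
theorem phiMinus_evalAt (hq : q4 ≠ 0) (ht : t4 ≠ 0) (y : K) :
    (phiMinus q4 t4).evalAt (y / (t4 / q4)) =
      (eta t4).evalAt (y / (t4 ^ 2 / q4 ^ 2)) + (xi q4 t4).evalAt y := by
  ext n
  · have hr : (t4 / q4) ^ n ≠ 0 := pow_ne_zero _ (div_ne_zero ht hq)
    have h1 : (q4 / t4) ^ n = ((t4 / q4) ^ n)⁻¹ := by rw [← inv_pow, inv_div]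
    have h2 : (t4 ^ 4 / q4 ^ 4) ^ n = ((t4 / q4) ^ n) ^ 4 := by ring
    have h3 : (t4 ^ 2 / q4 ^ 2) ^ n = ((t4 / q4) ^ n) ^ 2 := by ring
    simp only [Exponents.evalAt, phiMinus, eta, xi, Prod.fst_add, Pi.add_apply]
    rw [div_pow y, div_pow y, h1, h2, h3]
    generalize (t4 / q4) ^ n = R at *
    field_simp
    ring
  · simp only [Exponents.evalAt, phiMinus, eta, xi, Prod.snd_add, Pi.add_apply, Pi.zero_apply,
      zero_mul]
    rw [inv_div, div_pow, inv_pow, div_eq_mul_inv _ (y ^ n)]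
    ring

/-- The coefficient of `:Φ̃*_∅(u) ξ_lam(u):` in the intertwiner, in the basis `(P_lam)`. -/
def intertwinerCoeff (q4 t4 u v : K) (N : ℤ) (lam : YoungDiagram) : K :=
  tStar q4 t4 u v N lam * (q4 ^ 4) ^ nStat lam.transpose / cLam' (q4 ^ 4) (t4 ^ 4) lam

/-- The recursion for the prefactor when a box is added. The N-th power joins (-u)^N to the framing
ratio -a_i (q/t)^{1/2}, and the power of q comes from n(λ') and from q^{-1} v. -/
theorem IsAdd.intertwinerCoeff_mul (h : IsAdd lam i mu) (hg : Generic q4 t4) (hu : u ≠ 0) (hv : v ≠ 0) :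
    v * (intertwinerCoeff q4 t4 u v N mu * Toroidal.cLam' (q4 ^ 4) (t4 ^ 4) mu) =
      intertwinerCoeff q4 t4 u v N lam * Toroidal.cLam' (q4 ^ 4) (t4 ^ 4) lam *
        (nodeA (q4 ^ 4) (t4 ^ 4) lam i * u / (t4 ^ 2 / q4 ^ 2)) ^ N *
          (q4 ^ 4) ^ (lam.rowLen i + 1) := by
  have hq := hg.q_ne
  have ht := hg.t_ne
  have h1 := cLam'_ne_zero hg.pow_four lam
  have h2 := cLam'_ne_zero hg.pow_four mu
  have hf : framing q4 t4 mu = framing q4 t4 lam *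
      -(nodeA (q4 ^ 4) (t4 ^ 4) lam i / (t4 ^ 2 / q4 ^ 2)) := by
    rw [framing, framing, h.card, h.nStat, h.nStat_transpose, nodeA, zpow_natCast, zpow_neg,
      zpow_natCast, ← pow_mul, ← pow_mul]
    field_simp
    ring
  rw [Toroidal.intertwinerCoeff, Toroidal.intertwinerCoeff, div_mul_cancel₀ _ h1,
    div_mul_cancel₀ _ h2, tStar, tStar, hf, h.card, h.nStat_transpose,
    mul_zpow (framing q4 t4 lam), Nat.cast_succ,
    mul_add, mul_one, zpow_add₀ (neg_ne_zero.2 hu), neg_add, ← sub_eq_add_neg,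
    zpow_sub_one₀ (mul_ne_zero (inv_ne_zero hg.pow_four.q_ne) hv), mul_inv, inv_inv, pow_add]
  have h3 : (-u) ^ N * (-(nodeA (q4 ^ 4) (t4 ^ 4) lam i / (t4 ^ 2 / q4 ^ 2))) ^ N =
      (nodeA (q4 ^ 4) (t4 ^ 4) lam i * u / (t4 ^ 2 / q4 ^ 2)) ^ N := by
    rw [← mul_zpow]; congr 1; ring
  rw [← h3]
  field_simp
  ring

theorem contr_eta_phiExp_eq (hg : Generic q4 t4) {L : ℕ} (hL : mu.colLen 0 ≤ L) :
    contr (q4 ^ 4) (t4 ^ 4) (eta t4).2 (phiExp q4 t4 u mu).1 =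
      PowerSeries.rescale (t4 ^ 2 / q4 ^ 2 * u)
        (ySeries (nodeA (q4 ^ 4) (t4 ^ 4) mu) (nodeB (q4 ^ 4) (t4 ^ 4) mu) L) := by
  rw [contr_eta_phiExp mu hg, ← ySeries_scale, ← pexp_ySeries]
  simp only [boxSum_eq hL]

theorem contr_phiExp_eta_eq (hg : Generic q4 t4) {L : ℕ} (hL : mu.colLen 0 ≤ L) :
    contr (q4 ^ 4) (t4 ^ 4) (phiExp q4 t4 u mu).2 (eta t4).1 =
      PowerSeries.rescale (t4 ^ 2 / q4 ^ 2 * u)⁻¹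
        (ySeries (fun k => (nodeA (q4 ^ 4) (t4 ^ 4) mu k)⁻¹)
          (fun k => (nodeB (q4 ^ 4) (t4 ^ 4) mu k)⁻¹) L) := by
  rw [contr_phiExp_eta mu hg, ← ySeries_scale, ← pexp_ySeries]
  simp only [boxSum_eq hL, nodeA_inv, nodeB_inv]

/-- The eigenvalue Y(tx/q) / Y(x) of ψ^+ moves the contraction 1 / Y(tx/q) to 1 / Y(x), so that its
poles sit at the contents of the addable boxes. -/
theorem contr_xi_phiExp_eq (hg : Generic q4 t4) {L : ℕ} (hL : mu.colLen 0 ≤ L) :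
    PowerSeries.rescale u (BPlus (q4 ^ 4) (t4 ^ 4) mu) *
      contr (q4 ^ 4) (t4 ^ 4) (xi q4 t4).2 (phiExp q4 t4 u mu).1 =
      PowerSeries.rescale u
        (yInv (nodeA (q4 ^ 4) (t4 ^ 4) mu) (nodeB (q4 ^ 4) (t4 ^ 4) mu) L) := by
  rw [contr_xi_phiExp mu hg, BPlus_eq hg.pow_four.q_ne hg.pow_four.t_ne, rescale_pexp, ← pexp_add,
    ← yInv_scale, ← pexp_yInv]
  refine pexp_congr fun n _ => ?_
  rw [← boxSum_eq hL, mul_pow]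
  ring

theorem contr_phiExp_xi_eq (hg : Generic q4 t4) {L : ℕ} (hL : mu.colLen 0 ≤ L) :
    contr (q4 ^ 4) (t4 ^ 4) (phiExp q4 t4 u mu).2 (xi q4 t4).1 =
      PowerSeries.rescale u⁻¹
        (yInv (fun k => (nodeA (q4 ^ 4) (t4 ^ 4) mu k)⁻¹)
          (fun k => (nodeB (q4 ^ 4) (t4 ^ 4) mu k)⁻¹) L) := by
  rw [contr_phiExp_xi mu hg, ← yInv_scale, ← pexp_yInv]
  simp only [boxSum_eq hL, nodeA_inv, nodeB_inv]

variable (mu)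

/-- The eigenvalue of ψ^+ in the vertical factor is inverse to the contraction of φ^+ with Φ*_λ. -/
theorem phiPlus_normalExp (hg : Generic q4 t4) (k : ℤ) :
    convHat (q4 ^ 4) (t4 ^ 4) (phiPlus q4 t4)
      (PowerSeries.rescale (t4 / q4 * u) (BPlus (q4 ^ 4) (t4 ^ 4) mu)) k ∘ₗ
        normalExp (q4 ^ 4) (t4 ^ 4) (phiExp q4 t4 u mu) =
      normalExp (q4 ^ 4) (t4 ^ 4) (phiExp q4 t4 u mu) ∘ₗ
        modeF (q4 ^ 4) (t4 ^ 4) (phiPlus q4 t4) k := by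
  refine IsVertex.ext hg.pow_four.kap_ne (isVertex_convHat_normalExp _ _ _)
    (isVertex_normalExp_modeF _ _) (fun k => ?_) k
  rw [LinearMap.comp_apply, LinearMap.comp_apply, vev_convHat_normalExp, vev_normalExp_modeF,
    contr_phiPlus_phiExp mu hg, BPlus_eq hg.pow_four.q_ne hg.pow_four.t_ne, rescale_pexp,
    ← pexp_add]
  simp only [add_neg_cancel]
  rw [pexp_zero, show (phiPlus q4 t4).1 = 0 from rfl, contr_zero_right, coeffZ_one, coeffZ_one]
  simp only [neg_eq_zero]

theorem phiMinus_normalExp (hg : Generic q4 t4) (n : ℕ) :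
    ∑ k ∈ range (n + 1),
      PowerSeries.coeff k (PowerSeries.rescale (t4 / q4 * u⁻¹) (BMinus (q4 ^ 4) (t4 ^ 4) mu)) •
        modeHat (q4 ^ 4) (t4 ^ 4) (phiMinus q4 t4) (n - k : ℕ) ∘ₗ
          normalExp (q4 ^ 4) (t4 ^ 4) (phiExp q4 t4 u mu) =
      normalExp (q4 ^ 4) (t4 ^ 4) (phiExp q4 t4 u mu) ∘ₗ
        modeF (q4 ^ 4) (t4 ^ 4) (phiMinus q4 t4) n := by
  set b := PowerSeries.rescale (t4 / q4 * u⁻¹) (BMinus (q4 ^ 4) (t4 ^ 4) mu) with hb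
  have h1 := IsVertex.ext hg.pow_four.kap_ne
    ((isVertex_modeHat_normalExp (phiMinus q4 t4) (phiExp q4 t4 u mu)).conv (fun k hk => ?_) b)
    (isVertex_normalExp_modeF (phiMinus q4 t4) (phiExp q4 t4 u mu)) (fun k => ?_) n
  · rw [← h1, show ((n : ℤ) + 1).toNat = n + 1 by omega]
    refine sum_congr rfl fun k hk => ?_
    rw [mem_range] at hk
    rw [Nat.cast_sub (by omega)]
  · rw [phiMinus, modeHat_creating, cre_of_neg _ _ hk, LinearMap.zero_comp]
  · rw [LinearMap.sum_apply, map_sum, LinearMap.comp_apply, vev_normalExp_modeF,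
      contr_phiExp_phiMinus mu hg, ← rescale_pexp,
      ← BMinus_eq hg.pow_four.q_ne hg.pow_four.t_ne, ← hb]
    simp_rw [LinearMap.smul_apply, MvPowerSeries.constantCoeff_smul, LinearMap.comp_apply, vev_modeHat_normalExp,
      show (phiMinus q4 t4).2 = 0 from rfl, contr_zero_left, coeffZ_one]
    rcases lt_or_ge k 0 with hk | hk
    · rw [coeffZ_of_neg hk, show (k + 1).toNat = 0 by omega, sum_range_zero]
    · lift k to ℕ using hk
      rw [coeffZ_natCast, show ((k : ℤ) + 1).toNat = k + 1 by omega,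
        sum_eq_single_of_mem k (by simp)]
      · simp
      · intro l _ hl
        rw [if_neg (by omega), smul_zero]

/-- The two orders of multiplication are expansions of Y at 0 and at infinity, and the sum is the
delta part. The scalar and the shift to k + 1 reflect Y ~ -x. -/
theorem eta_normalExp (hg : Generic q4 t4) (hu : u ≠ 0) (k : ℤ) {L : ℕ} (hL : mu.colLen 0 ≤ L) :
    modeHat (q4 ^ 4) (t4 ^ 4) (eta t4) k ∘ₗ normalExp (q4 ^ 4) (t4 ^ 4) (phiExp q4 t4 u mu) -
      ∑ i ∈ range L, resB (q4 ^ 4) (t4 ^ 4) mu L i •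
        (nodeB (q4 ^ 4) (t4 ^ 4) mu i * (t4 ^ 2 / q4 ^ 2 * u)) ^ (-k) •
          normalExp (q4 ^ 4) (t4 ^ 4) ((eta t4).evalAt
            (nodeB (q4 ^ 4) (t4 ^ 4) mu i * (t4 ^ 2 / q4 ^ 2 * u)) + phiExp q4 t4 u mu) =
    -(t4 ^ 2 / q4 ^ 2 * u) • normalExp (q4 ^ 4) (t4 ^ 4) (phiExp q4 t4 u mu) ∘ₗ
      modeF (q4 ^ 4) (t4 ^ 4) (eta t4) (k + 1) := by
  have hg4 := hg.pow_four
  have hc : t4 ^ 2 / q4 ^ 2 * u ≠ 0 :=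
    mul_ne_zero (div_ne_zero (pow_ne_zero _ hg.t_ne) (pow_ne_zero _ hg.q_ne)) hu
  refine IsVertex.ext hg4.kap_ne ((isVertex_modeHat_normalExp _ _).sub (IsVertex.sum _ fun i _ =>
    (isVertex_normalExp_evalAt _ _ (mul_ne_zero (hg4.nodeB_ne mu i) hc)).smul _))
    (((isVertex_normalExp_modeF _ _).shift 1).smul _) (fun k => ?_) k
  rw [LinearMap.sub_apply, map_sub, LinearMap.sum_apply, map_sum, LinearMap.comp_apply,
    LinearMap.smul_apply, MvPowerSeries.constantCoeff_smul, LinearMap.comp_apply, vev_modeHat_normalExp,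
    vev_normalExp_modeF, contr_eta_phiExp_eq hg hL, contr_phiExp_eta_eq hg hL, coeffZ_rescale,
    coeffZ_rescale]
  simp_rw [LinearMap.smul_apply, MvPowerSeries.constantCoeff_smul, constantCoeff_normalExp,
    smul_eq_mul, mul_one]
  have h := ySeries_delta (hg4.nodeA_ne mu) (hg4.nodeB_ne mu)
    (fun _ _ _ _ h => hg4.nodeB_inj mu h) (prod_nodeA (q4 ^ 4) (t4 ^ 4) hL) (-k)
  rw [sub_neg_eq_add, add_comm 1 k] at h
  generalize t4 ^ 2 / q4 ^ 2 * u = c at *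
  simp_rw [mul_zpow, ← mul_assoc]
  rw [← sum_mul]
  unfold resB
  rw [← h, inv_zpow, zpow_neg, zpow_add_one₀ hc]
  have := zpow_ne_zero k hc
  field_simp
  ring

/-- The same comparison for 1/Y, which behaves like -1/x; hence the inverse scalar and the shift to
k - 1. -/
theorem xi_normalExp (hg : Generic q4 t4) (hu : u ≠ 0) (k : ℤ) {L : ℕ} (hL : mu.colLen 0 ≤ L) :
    convHat (q4 ^ 4) (t4 ^ 4) (xi q4 t4)
      (PowerSeries.rescale u (BPlus (q4 ^ 4) (t4 ^ 4) mu)) k ∘ₗ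
        normalExp (q4 ^ 4) (t4 ^ 4) (phiExp q4 t4 u mu) -
      ∑ i ∈ range (L + 1), resA (q4 ^ 4) (t4 ^ 4) mu L i •
        (nodeA (q4 ^ 4) (t4 ^ 4) mu i * u) ^ (-k) •
          normalExp (q4 ^ 4) (t4 ^ 4) ((xi q4 t4).evalAt
            (nodeA (q4 ^ 4) (t4 ^ 4) mu i * u) + phiExp q4 t4 u mu) =
    -u⁻¹ • normalExp (q4 ^ 4) (t4 ^ 4) (phiExp q4 t4 u mu) ∘ₗ
      modeF (q4 ^ 4) (t4 ^ 4) (xi q4 t4) (k - 1) := by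
  have hg4 := hg.pow_four
  refine IsVertex.ext hg4.kap_ne ((isVertex_convHat_normalExp _ _ _).sub (IsVertex.sum _ fun i _ =>
    (isVertex_normalExp_evalAt _ _ (mul_ne_zero (hg4.nodeA_ne mu i) hu)).smul _))
    (((isVertex_normalExp_modeF _ _).shift (-1)).smul _) (fun k => ?_) k
  rw [LinearMap.sub_apply, map_sub, LinearMap.sum_apply, map_sum, LinearMap.comp_apply,
    LinearMap.smul_apply, MvPowerSeries.constantCoeff_smul, LinearMap.comp_apply, vev_convHat_normalExp,
    vev_normalExp_modeF, contr_xi_phiExp_eq hg hL, contr_phiExp_xi_eq hg hL, coeffZ_rescale,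
    coeffZ_rescale]
  simp_rw [LinearMap.smul_apply, MvPowerSeries.constantCoeff_smul, constantCoeff_normalExp,
    smul_eq_mul, mul_one]
  have h := yInv_delta (hg4.nodeA_ne mu) (hg4.nodeB_ne mu)
    (fun _ _ _ _ h => hg4.nodeA_inj mu h) (prod_nodeA (q4 ^ 4) (t4 ^ 4) hL) (-k)
  rw [neg_neg] at h
  simp_rw [mul_zpow, ← mul_assoc]
  rw [← sum_mul]
  unfold resA
  rw [← h, inv_zpow, zpow_neg, ← sub_eq_add_neg, zpow_sub_one₀ hu]
  have := zpow_ne_zero k hu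
  field_simp
  ring

/-- The dual intertwiner. -/
def intertwiner (q4 t4 u v : K) (N : ℤ) : Fock K →ₗ[K] TensorHat K :=
  LinearMap.pi fun mu =>
    intertwinerCoeff q4 t4 u v N mu • normalExp (q4 ^ 4) (t4 ^ 4) (phiExp q4 t4 u mu)

theorem intertwiner_apply (f : Fock K) : intertwiner q4 t4 u v N f mu =
    intertwinerCoeff q4 t4 u v N mu • normalExp (q4 ^ 4) (t4 ^ 4) (phiExp q4 t4 u mu) f := rfl

theorem component_intertwiner (hg : Generic q4 t4) (lam : YoungDiagram) :
    component q4 t4 (intertwiner q4 t4 u v N) lam =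
      tStar q4 t4 u v N lam • phiStarTilde q4 t4 u lam := by
  refine LinearMap.ext fun f => ?_
  rw [component, phiStarTilde, LinearMap.smul_apply, LinearMap.comp_apply, LinearMap.proj_apply,
    intertwiner_apply, LinearMap.smul_apply, LinearMap.smul_apply, smul_smul, smul_smul, phiExp,
    intertwinerCoeff]
  congr 1
  have := cLam'_ne_zero hg.pow_four lam
  field_simp

theorem intertwiner_xp (hg : Generic q4 t4) (hu : u ≠ 0) (hv : v ≠ 0) (n : ℤ) (f : Fock K) :
    coproductAction q4 t4 N v u (Gen.xp n) (intertwiner q4 t4 u v N f) mu =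
      intertwiner q4 t4 u v N (horizontal (modeF (q4 ^ 4) (t4 ^ 4)) q4 t4 (N + 1) (-(v * u))
        (Gen.xp n) f) mu := by
  have hg4 := hg.pow_four
  have hr : t4 ^ 2 / q4 ^ 2 ≠ 0 := div_ne_zero (pow_ne_zero _ hg.t_ne) (pow_ne_zero _ hg.q_ne)
  rw [coproductAction_xp _ _ hg.q_ne hg.t_ne hu]
  have h1 : ∀ i ∈ range (mu.colLen 0), ((removeBox mu i).elim 0 fun lam =>
      ((t4 ^ 2 / q4 ^ 2) ^ N * (APlus (q4 ^ 4) (t4 ^ 4) lam i *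
        (nodeA (q4 ^ 4) (t4 ^ 4) lam i * u / (t4 ^ 2 / q4 ^ 2)) ^ n)) •
          convHat (q4 ^ 4) (t4 ^ 4) (phiMinus q4 t4)
            (PowerSeries.mk fun l => (nodeA (q4 ^ 4) (t4 ^ 4) lam i * u / (t4 / q4)) ^ l) 0
              (intertwiner q4 t4 u v N f lam)) =
      -(v * (t4 ^ 2 / q4 ^ 2) ^ N * intertwinerCoeff q4 t4 u v N mu) •
        (resB (q4 ^ 4) (t4 ^ 4) mu (mu.colLen 0) i •
        (nodeB (q4 ^ 4) (t4 ^ 4) mu i * (t4 ^ 2 / q4 ^ 2 * u)) ^ (-(N - n)) •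
          normalExp (q4 ^ 4) (t4 ^ 4) ((eta t4).evalAt
            (nodeB (q4 ^ 4) (t4 ^ 4) mu i * (t4 ^ 2 / q4 ^ 2 * u)) + phiExp q4 t4 u mu)) f := by
    intro i hi
    rw [mem_range] at hi
    -- Rows without a removable box contribute to neither side, their residue being zero.
    rcases h : removeBox mu i with _ | lam
    · rw [resB_eq_zero hg4 hi h]
      simp
    · have hadd := removeBox_eq_some.1 h
      simp only [Option.elim_some]
      rw [intertwiner_apply, map_smul, ← LinearMap.comp_apply, phiMinus,
        convHat_geometric_normalExp hg4.kap_ne, ← phiMinus, phiMinus_evalAt hg.q_ne hg.t_ne,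
        add_assoc, ← hadd.phiExp]
      have e1 : nodeA (q4 ^ 4) (t4 ^ 4) lam i * u / (t4 ^ 2 / q4 ^ 2) =
          nodeB (q4 ^ 4) (t4 ^ 4) mu i * (t4 ^ 2 / q4 ^ 2 * u) := by
        rw [← hadd.nodeB_mul hg4.q_ne hg4.t_ne]
        have := hg.q_ne
        have := hg.t_ne
        field_simp
      have h2 := hadd.APlus_mul hg4 le_rfl
      have h3 := hadd.intertwinerCoeff_mul (N := N) hg hu hv
      have h4 := cLam'_ne_zero hg4 lam
      have h5 := cLam'_ne_zero hg4 mu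
      rw [e1] at h3 ⊢
      have hy : nodeB (q4 ^ 4) (t4 ^ 4) mu i * (t4 ^ 2 / q4 ^ 2 * u) ≠ 0 :=
        mul_ne_zero (hg4.nodeB_ne mu i) (mul_ne_zero hr hu)
      rw [LinearMap.smul_apply, LinearMap.smul_apply, smul_smul, smul_smul, smul_smul]
      congr 1
      generalize nodeB (q4 ^ 4) (t4 ^ 4) mu i * (t4 ^ 2 / q4 ^ 2 * u) = y at *
      rw [neg_sub, show y ^ n = y ^ (n - N) * y ^ N by rw [← zpow_add₀ hy, sub_add_cancel],
        ← mul_right_inj' h4, ← mul_right_inj' h5]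
      linear_combination (t4 ^ 2 / q4 ^ 2) ^ N * y ^ (n - N) * cLam' (q4 ^ 4) (t4 ^ 4) lam *
        (y ^ N * Toroidal.intertwinerCoeff q4 t4 u v N lam * h2 +
          resB (q4 ^ 4) (t4 ^ 4) mu (mu.colLen 0) i * h3)
  rw [sum_congr rfl h1, ← smul_sum, ← LinearMap.sum_apply, intertwiner_apply, horizontal,
    LinearMap.smul_apply, map_smul, show N + 1 - n = N - n + 1 by ring]
  -- The delta terms cancel those of the coproduct. The scalar that is left combines with v
  -- (t/q)^{N/2} to w (t/q)^{(N+1)/2} for w = -vu.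
  have h6 := congrArg (fun T => T f) (eta_normalExp mu hg hu (N - n) le_rfl)
  simp only [LinearMap.sub_apply, LinearMap.comp_apply, LinearMap.smul_apply] at h6
  rw [sub_eq_iff_eq_add] at h6
  rw [intertwiner_apply, map_smul, h6, zpow_add_one₀ hr]
  module

theorem intertwiner_xm (hg : Generic q4 t4) (hu : u ≠ 0) (hv : v ≠ 0) (n : ℤ) (f : Fock K) :
    coproductAction q4 t4 N v u (Gen.xm n) (intertwiner q4 t4 u v N f) mu =
      intertwiner q4 t4 u v N (horizontal (modeF (q4 ^ 4) (t4 ^ 4)) q4 t4 (N + 1) (-(v * u))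
        (Gen.xm n) f) mu := by
  have hg4 := hg.pow_four
  have hr : t4 ^ 2 / q4 ^ 2 ≠ 0 := div_ne_zero (pow_ne_zero _ hg.t_ne) (pow_ne_zero _ hg.q_ne)
  rw [coproductAction_xm]
  set R := q4 ^ 2 / t4 ^ 2 with hR
  have hRr : t4 ^ 2 / q4 ^ 2 = R⁻¹ := by rw [hR, inv_div]
  have hR0 : R ≠ 0 := div_ne_zero (pow_ne_zero _ hg.q_ne) (pow_ne_zero _ hg.t_ne)
  -- Adding a box may create a new row, and the residue formula needs the number of rows of the
  -- larger partition. Hence one row more than `mu` has is used; the superfluous index contributes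
  -- zero.
  have h1 : ∀ i ∈ range (mu.colLen 0 + 1 + 1), ((addBox mu i).elim 0 fun lam =>
      (R * (AMinus (q4 ^ 4) (t4 ^ 4) lam i *
        (nodeA (q4 ^ 4) (t4 ^ 4) mu i * u) ^ n)) • intertwiner q4 t4 u v N f lam) =
      -(v⁻¹ * R ^ N * R * intertwinerCoeff q4 t4 u v N mu) •
        (resA (q4 ^ 4) (t4 ^ 4) mu (mu.colLen 0 + 1) i •
        (nodeA (q4 ^ 4) (t4 ^ 4) mu i * u) ^ (-(-N - n)) •
          normalExp (q4 ^ 4) (t4 ^ 4) ((xi q4 t4).evalAt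
            (nodeA (q4 ^ 4) (t4 ^ 4) mu i * u) + phiExp q4 t4 u mu)) f := by
    intro i hi
    rw [mem_range] at hi
    rcases h : addBox mu i with _ | lam
    · rw [resA_eq_zero hg4 (Nat.le_of_lt_succ hi) h]
      simp
    · have hadd := addBox_eq_some.1 h
      simp only [Option.elim_some]
      rw [intertwiner_apply, ← hadd.phiExp]
      have h2 := hadd.AMinus_mul hg4 hadd.colLen_le_succ
      have h3 := hadd.intertwinerCoeff_mul (N := N) hg hu hv
      have h4 := cLam'_ne_zero hg4 lam
      have h5 := cLam'_ne_zero hg4 mu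
      have hy : nodeA (q4 ^ 4) (t4 ^ 4) mu i * u ≠ 0 := mul_ne_zero (hg4.nodeA_ne mu i) hu
      rw [LinearMap.smul_apply, LinearMap.smul_apply, smul_smul, smul_smul, smul_smul]
      congr 1
      generalize nodeA (q4 ^ 4) (t4 ^ 4) mu i * u = y at *
      have hq := pow_ne_zero (mu.rowLen i + 1) hg4.q_ne
      rw [hRr, div_inv_eq_mul, mul_zpow] at h3
      rw [show -(-N - n) = N + n by ring, zpow_add₀ hy]
      generalize (q4 ^ 4) ^ (mu.rowLen i + 1) = Q at *
      rw [← mul_right_inj' h4, ← mul_right_inj' h5, ← mul_right_inj' hq, ← mul_right_inj' hv]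
      have h6 : v * v⁻¹ = 1 := mul_inv_cancel₀ hv
      linear_combination R * y ^ n * cLam' (q4 ^ 4) (t4 ^ 4) lam *
        (v * Toroidal.intertwinerCoeff q4 t4 u v N lam * h2 -
          resA (q4 ^ 4) (t4 ^ 4) mu (mu.colLen 0 + 1) i * h3) +
        R * y ^ n * cLam' (q4 ^ 4) (t4 ^ 4) lam * cLam' (q4 ^ 4) (t4 ^ 4) mu * Q *
          R ^ N * y ^ N * Toroidal.intertwinerCoeff q4 t4 u v N mu *
          resA (q4 ^ 4) (t4 ^ 4) mu (mu.colLen 0 + 1) i * h6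
  have hlast : addBox mu (mu.colLen 0 + 1) = none := by
    rw [Option.eq_none_iff_forall_not_mem]
    intro lam hlam
    have := (addBox_eq_some.1 hlam).le_colLen
    omega
  have h0 := sum_congr (rfl : range (mu.colLen 0 + 1 + 1) = _) h1
  rw [sum_range_succ, hlast, Option.elim_none, add_zero] at h0
  rw [h0, ← smul_sum, ← LinearMap.sum_apply, intertwiner_apply, horizontal,
    LinearMap.smul_apply, map_smul, show -(N + 1) - n = -N - n - 1 by ring]
  have h6 := congrArg (fun T => T f) (xi_normalExp mu hg hu (-N - n) (Nat.le_succ (mu.colLen 0)))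
  simp only [LinearMap.sub_apply, LinearMap.comp_apply, LinearMap.smul_apply] at h6
  rw [sub_eq_iff_eq_add] at h6
  rw [intertwiner_apply, map_smul, h6, ← hR, zpow_add_one₀ hR0, inv_neg, mul_inv]
  module

theorem isNormalizedDualIntertwiner_intertwiner (hg : Generic q4 t4) (hu : u ≠ 0) (hv : v ≠ 0) :
    IsNormalizedDualIntertwiner q4 t4 N u v (-(v * u)) (intertwiner q4 t4 u v N) := by
  refine ⟨isDualIntertwiner_iff.2 fun g f => funext fun mu => ?_, ?_⟩
  · cases g with
    | gamma =>
      rw [coproductAction]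
      change tens _ 1 _ mu = _
      rw [tens_one, horizontal, horizontal, LinearMap.smul_apply, LinearMap.smul_apply, map_smul]
      rfl
    | gammaInv =>
      rw [coproductAction]
      change tens _ 1 _ mu = _
      rw [tens_one, horizontal, horizontal, LinearMap.smul_apply, LinearMap.smul_apply, map_smul]
      rfl
    | xp n => exact intertwiner_xp mu hg hu hv n f
    | xm n => exact intertwiner_xm mu hg hu hv n f
    | psip n =>
      have hR0 : q4 ^ 2 / t4 ^ 2 ≠ 0 := div_ne_zero (pow_ne_zero _ hg.q_ne) (pow_ne_zero _ hg.t_ne)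
      rw [coproductAction_psip, intertwiner_apply, map_smul, ← LinearMap.comp_apply,
        phiPlus_normalExp mu hg, LinearMap.comp_apply, horizontal, LinearMap.smul_apply,
        intertwiner_apply, map_smul, zpow_add_one₀ hR0]
      module
    | psim n =>
      have hR0 : t4 ^ 2 / q4 ^ 2 ≠ 0 := div_ne_zero (pow_ne_zero _ hg.t_ne) (pow_ne_zero _ hg.q_ne)
      have h := congrArg (fun T => T f) (phiMinus_normalExp (u := u) mu hg n)
      simp only [LinearMap.sum_apply, LinearMap.comp_apply, LinearMap.smul_apply] at h
      rw [coproductAction_psim, intertwiner_apply]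
      simp_rw [map_smul, smul_comm _ (intertwinerCoeff q4 t4 u v N mu)]
      rw [← smul_sum, h, horizontal, LinearMap.smul_apply,
        intertwiner_apply, map_smul, zpow_add_one₀ hR0]
      module
  · rw [component_intertwiner hg, phiStarTilde, LinearMap.smul_apply, LinearMap.smul_apply,
      MvPowerSeries.constantCoeff_smul, MvPowerSeries.constantCoeff_smul, constantCoeff_normalExp]
    simp [tStar, framing, cLam, nStat_bot, transpose_bot, YoungDiagram.card]

end Existence

/-! ### Passing from intertwined exponentials to intertwined exponents. -/

section Logarithm

variable {K : Type*} [Field K] [CharZero K]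

theorem sum_linearMap_comp {U V W ι : Type*} [AddCommGroup U] [Module K U] [AddCommGroup V]
    [Module K V] [AddCommGroup W] [Module K W] (s : Finset ι) (A : ι → V →ₗ[K] W) (F : U →ₗ[K] V) :
    (∑ i ∈ s, A i) ∘ₗ F = ∑ i ∈ s, A i ∘ₗ F :=
  LinearMap.ext fun x => by simp

theorem linearMap_comp_sum {U V W ι : Type*} [AddCommGroup U] [Module K U] [AddCommGroup V]
    [Module K V] [AddCommGroup W] [Module K W] (s : Finset ι) (A : ι → U →ₗ[K] V) (F : V →ₗ[K] W) :
    F ∘ₗ (∑ i ∈ s, A i) = ∑ i ∈ s, F ∘ₗ A i :=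
  LinearMap.ext fun x => by simp

/-- If `F` intertwines two exponentials, then it intertwines their logarithms, given here through
their logarithmic derivatives. -/
theorem comp_log_derivative {V W : Type*} [AddCommGroup V] [Module K V] [AddCommGroup W]
    [Module K W] {F : V →ₗ[K] W} {E G : PowerSeries (Module.End K V)}
    {X H : PowerSeries (Module.End K W)} (hE : euler E = G * E) (hX : euler X = H * X)
    (hE0 : PowerSeries.coeff 0 E = 1) (hX0 : PowerSeries.coeff 0 X = 1)
    (h : ∀ n, PowerSeries.coeff n X ∘ₗ F = F ∘ₗ PowerSeries.coeff n E) (n : ℕ) :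
    PowerSeries.coeff n H ∘ₗ F = F ∘ₗ PowerSeries.coeff n G := by
  induction n using Nat.strong_induction_on with
  | _ n ih =>
    have h1 : PowerSeries.coeff n (euler X) ∘ₗ F = F ∘ₗ PowerSeries.coeff n (euler E) := by
      rw [coeff_euler, coeff_euler, LinearMap.smul_comp, LinearMap.comp_smul, h]
    rw [hE, hX, PowerSeries.coeff_mul, PowerSeries.coeff_mul,
      Nat.sum_antidiagonal_eq_sum_range_succ
        (fun i j => PowerSeries.coeff i H * PowerSeries.coeff j X),
      Nat.sum_antidiagonal_eq_sum_range_succ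
        (fun i j => PowerSeries.coeff i G * PowerSeries.coeff j E), sum_range_succ, sum_range_succ,
      Nat.sub_self, hE0, hX0, mul_one, mul_one, LinearMap.add_comp, LinearMap.comp_add,
      sum_linearMap_comp, linearMap_comp_sum] at h1
    -- The lower terms agree by induction. Since both series have constant term 1, the top terms are
    -- the two sides of the claim.
    have h2 : ∑ k ∈ range n, (PowerSeries.coeff k H * PowerSeries.coeff (n - k) X) ∘ₗ F =
        ∑ k ∈ range n, F ∘ₗ (PowerSeries.coeff k G * PowerSeries.coeff (n - k) E) := by
      refine sum_congr rfl fun k hk => ?_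
      rw [Module.End.mul_eq_comp, Module.End.mul_eq_comp, LinearMap.comp_assoc, h,
        ← LinearMap.comp_assoc, ih k (mem_range.1 hk), LinearMap.comp_assoc]
    rw [h2] at h1
    exact add_left_cancel h1

theorem euler_expSeries_smul {V : Type*} [AddCommGroup V] [Module K V] {A : ℕ → Module.End K V}
    (c : ℕ → K) (hA : ∀ m n, A m * A n = A n * A m) :
    euler (expSeries K (PowerSeries.mk fun n => if n = 0 then 0 else c n • A n)) =
      euler (PowerSeries.mk fun n => if n = 0 then 0 else c n • A n) *
        expSeries K (PowerSeries.mk fun n => if n = 0 then 0 else c n • A n) := by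
  refine euler_expSeries (by simp) ?_
  ext1 m
  rw [PowerSeries.coeff_mul, PowerSeries.coeff_mul, ← Finset.Nat.sum_antidiagonal_swap]
  refine sum_congr rfl fun p _ => ?_
  simp only [Prod.fst_swap, Prod.snd_swap, coeff_euler, PowerSeries.coeff_mk, mul_smul_comm,
    smul_mul_assoc]
  congr 1
  split_ifs
  · simp
  · simp
  · simp
  · rw [smul_mul_smul_comm, smul_mul_smul_comm, hA, mul_comm (c _)]

/-- If `F` intertwines `b(s) exp (∑ c_n A_n s^n)` and `exp (∑ c_n B_n s^n)` for a scalar series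
`b(s) = exp (∑ β_n s^n / n)`, then it intertwines `c_n A_n + β_n / n` and `c_n B_n`. -/
theorem comp_of_comp_expSeries {V W : Type*} [AddCommGroup V] [Module K V] [AddCommGroup W]
    [Module K W] {F : V →ₗ[K] W} {A : ℕ → Module.End K W} {B : ℕ → Module.End K V} {c β : ℕ → K}
    (hA : ∀ m n, A m * A n = A n * A m) (hB : ∀ m n, B m * B n = B n * B m)
    (h : ∀ n : ℕ, ∑ k ∈ range (n + 1), PowerSeries.coeff k (pexp β) •
      PowerSeries.coeff (n - k) (expSeries K (PowerSeries.mk fun n =>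
        if n = 0 then 0 else c n • A n)) ∘ₗ F =
      F ∘ₗ PowerSeries.coeff n (expSeries K (PowerSeries.mk fun n =>
        if n = 0 then 0 else c n • B n))) {n : ℕ} (hn : n ≠ 0) (x : V) :
    c n • A n (F x) + (β n / n) • F x = c n • F (B n x) := by
  -- Scalar series become central operator series, so b(s) joins the exponential on the left and
  -- adds its exponent to the logarithmic derivative.
  set ι : PowerSeries K →+* PowerSeries (Module.End K W) :=
    PowerSeries.map (algebraMap K (Module.End K W)) with hι
  have hcentral : ∀ (b : PowerSeries K) (Y : PowerSeries (Module.End K W)), ι b * Y = Y * ι b := by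
    intro b Y
    ext1 m
    rw [PowerSeries.coeff_mul, PowerSeries.coeff_mul, ← Finset.Nat.sum_antidiagonal_swap]
    refine sum_congr rfl fun p _ => ?_
    rw [hι, PowerSeries.coeff_map, PowerSeries.coeff_map, Algebra.commutes, Prod.fst_swap,
      Prod.snd_swap]
  have heuler : ∀ b : PowerSeries K, euler (ι b) = ι (euler b) := by
    intro b
    ext1 m
    rw [coeff_euler, hι, PowerSeries.coeff_map, PowerSeries.coeff_map, coeff_euler, map_nsmul]
  have hb : euler (pexp β) = euler (PowerSeries.mk fun n => if n = 0 then 0 else β n / n) *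
    pexp β := euler_expSeries (by simp) (mul_comm _ _)
  have h1 := comp_log_derivative (F := F) (euler_expSeries_smul c hB)
    (X := ι (pexp β) * expSeries K (PowerSeries.mk fun n => if n = 0 then 0 else c n • A n))
    (H := ι (euler (PowerSeries.mk fun n => if n = 0 then 0 else β n / n)) +
      euler (PowerSeries.mk fun n => if n = 0 then 0 else c n • A n)) ?_
    (expSeries_coeff_zero _) ?_ (fun n => ?_) n
  · have h2 := congrArg (fun T => T x) h1
    have hn' : (n : K) ≠ 0 := Nat.cast_ne_zero.2 hn
    simp only [hι, map_add, PowerSeries.coeff_map, coeff_euler, PowerSeries.coeff_mk, if_neg hn,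
      LinearMap.comp_apply, LinearMap.add_apply, Module.algebraMap_end_apply, LinearMap.smul_apply,
      map_smul, ← Nat.cast_smul_eq_nsmul K, smul_assoc] at h2
    rw [← smul_add] at h2
    rw [add_comm]
    exact smul_right_injective _ hn' h2
  · rw [euler_mul, heuler, hb, map_mul, euler_expSeries_smul c hA, add_mul, mul_assoc, ← mul_assoc (ι (pexp β)),
      hcentral (pexp β) (euler _), mul_assoc]
  · rw [PowerSeries.coeff_mul, HasAntidiagonal.antidiagonal_zero, sum_singleton,
      expSeries_coeff_zero, mul_one, hι, PowerSeries.coeff_map, pexp, expSeries_coeff_zero, map_one]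
  · rw [← h, PowerSeries.coeff_mul, Nat.sum_antidiagonal_eq_sum_range_succ
      (fun i j => PowerSeries.coeff i (ι (pexp β)) * PowerSeries.coeff j (expSeries K _)),
      sum_linearMap_comp]
    refine sum_congr rfl fun k _ => ?_
    rw [hι, PowerSeries.coeff_map, ← Algebra.smul_def]
    rfl

end Logarithm

/-! ### Uniqueness, and the constraint on the parameters. -/

section Uniqueness

variable {K : Type*} [Field K] [CharZero K] {q4 t4 u v w : K} {N : ℤ}
  {Phi : Fock K →ₗ[K] TensorHat K}

/-- With zero current a single operator counts as a constant family, so `IsVertex.ext` applies to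
the components of an intertwiner. -/
theorem isVertex_const_iff {q t : K} {e' : Exponents K} {F : Fock K →ₗ[K] FockHat K} :
    IsVertex q t 0 e' (fun _ => F) ↔
      (∀ (n : ℕ+) (f : Fock K), heisHat q t n (F f) = F (heis q t n f) +
        (kap q t n * e'.1 n) • F f) ∧
      ∀ (n : ℕ+) (f : Fock K), heisHat q t (-n) (F f) = F (heis q t (-n) f) +
        (-(kap q t n * e'.2 n)) • F f := by
  constructor
  · intro h
    refine ⟨fun n f => ?_, fun n f => ?_⟩
    · simpa using h.pos n 0 f
    · simpa using h.neg n 0 f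
  · intro h
    refine ⟨fun n k f => ?_, fun n k f => ?_⟩
    · simpa using h.1 n f
    · simpa using h.2 n f

/-- Needed to divide the logarithm of the ψ^+ relation by the coefficient of a_n. -/
theorem Generic.phiPlus_snd_ne (hg : Generic q4 t4) {n : ℕ} (hn : n ≠ 0) :
    (phiPlus q4 t4).2 n ≠ 0 := by
  have hn' : (n : K) ≠ 0 := Nat.cast_ne_zero.2 hn
  have h1 := hg.pow_four.one_sub_t_pow_ne hn
  have h2 : 1 - (t4 ^ 4 / q4 ^ 4) ^ n ≠ 0 := by
    have := hg.pow_four.om_ne (a := -n) (b := n) (by omega)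
    rw [om, zpow_neg, zpow_natCast, zpow_natCast] at this
    rwa [div_pow, div_eq_inv_mul]
  have h3 : (q4 / t4) ^ n ≠ 0 := pow_ne_zero _ (div_ne_zero hg.q_ne hg.t_ne)
  exact neg_ne_zero.2 (mul_ne_zero (mul_ne_zero (div_ne_zero h1 hn') h2) h3)

theorem Generic.phiMinus_fst_ne (hg : Generic q4 t4) {n : ℕ} (hn : n ≠ 0) :
    (phiMinus q4 t4).1 n ≠ 0 := by
  have hn' : (n : K) ≠ 0 := Nat.cast_ne_zero.2 hn
  have h1 : 1 - (t4 ^ 4)⁻¹ ^ n ≠ 0 := by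
    have := hg.pow_four.om_ne (a := 0) (b := -n) (by omega)
    rw [om, zpow_neg, zpow_natCast, zpow_zero, one_mul] at this
    rwa [inv_pow]
  have h2 : 1 - (t4 ^ 4 / q4 ^ 4) ^ n ≠ 0 := by
    have := hg.pow_four.om_ne (a := -n) (b := n) (by omega)
    rw [om, zpow_neg, zpow_natCast, zpow_natCast] at this
    rwa [div_pow, div_eq_inv_mul]
  have h3 : (q4 / t4) ^ n ≠ 0 := pow_ne_zero _ (div_ne_zero hg.q_ne hg.t_ne)
  exact mul_ne_zero (mul_ne_zero (div_ne_zero h1 hn') h2) h3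

theorem heis_comm {V : Type*} [AddCommGroup V] [Module K V] {q t : K} {a : ℤ → Module.End K V}
    (ha : IsHeis q t a) (h0 : a 0 = 1) (m n : ℕ) : a m * a n = a n * a m := by
  rcases Nat.eq_zero_or_pos m with rfl | hm
  · simp [h0]
  rcases Nat.eq_zero_or_pos n with rfl | hn
  · simp [h0]
  lift m to ℕ+ using hm
  lift n to ℕ+ using hn
  exact ha.pos m n

theorem heis_comm_neg {V : Type*} [AddCommGroup V] [Module K V] {q t : K}
    {a : ℤ → Module.End K V} (ha : IsHeis q t a) (h0 : a 0 = 1) (m n : ℕ) :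
    a (-m) * a (-n) = a (-n) * a (-m) := by
  rcases Nat.eq_zero_or_pos m with rfl | hm
  · simp [h0]
  rcases Nat.eq_zero_or_pos n with rfl | hn
  · simp [h0]
  lift m to ℕ+ using hm
  lift n to ℕ+ using hn
  exact ha.neg m n

/-- The logarithm of the ψ^+ relation at `mu`. The scalar comes from the eigenvalue of ψ^+ on P_μ
and is the one that the explicit vertex operator has. -/
theorem IsDualIntertwiner.heisHat_pos (h : IsDualIntertwiner q4 t4 N u v w Phi)
    (hg : Generic q4 t4) (mu : YoungDiagram) (n : ℕ+) (f : Fock K) :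
    heisHat (q4 ^ 4) (t4 ^ 4) n (Phi f mu) = Phi (heis (q4 ^ 4) (t4 ^ 4) n f) mu +
      (kap (q4 ^ 4) (t4 ^ 4) n * (phiExp q4 t4 u mu).1 n) • Phi f mu := by
  have hR : q4 ^ 2 / t4 ^ 2 ≠ 0 := div_ne_zero (pow_ne_zero _ hg.q_ne) (pow_ne_zero _ hg.t_ne)
  have hd := hg.phiPlus_snd_ne n.ne_zero
  have h1 := comp_of_comp_expSeries (F := LinearMap.proj mu ∘ₗ Phi)
    (A := fun n => heisHat (q4 ^ 4) (t4 ^ 4) n) (B := fun n => heis (q4 ^ 4) (t4 ^ 4) n)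
    (c := (phiPlus q4 t4).2)
    (β := fun n => (t4 / q4 * u) ^ n * ((1 - (t4 ^ 4 / q4 ^ 4) ^ n) *
      boxSum (q4 ^ 4) (t4 ^ 4) mu n)) (heis_comm (isHeis_heisHat _ _) rfl)
      (heis_comm (isHeis_heis _ _) rfl) (fun k => ?_) n.ne_zero f
  · have h2 := phiPlus_mul_phiExp (u := u) mu hg n.ne_zero
    rw [neg_div] at h2
    rw [← neg_eq_iff_eq_neg.2 h2] at h1
    simp only [LinearMap.comp_apply, LinearMap.proj_apply] at h1
    refine smul_right_injective _ hd ?_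
    simp only [smul_add]
    rw [← h1]
    module
  · refine LinearMap.ext fun f => ?_
    have h3 := congrFun (isDualIntertwiner_iff.1 h (Gen.psip k) f) mu
    rw [coproductAction_psip, horizontal, LinearMap.smul_apply, map_smul, Pi.smul_apply,
      zpow_add_one₀ hR, mul_smul] at h3
    have h4 := smul_right_injective _ hR (smul_right_injective _ (zpow_ne_zero N hR) h3)
    rw [phiPlus, modeF_annihilating, convHat_annihilating, neg_neg, ← phiPlus, ann_natCast] at h4
    simp only [LinearMap.comp_apply, LinearMap.proj_apply, LinearMap.sum_apply,
      LinearMap.smul_apply]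
    refine Eq.trans (sum_congr rfl fun l _ => ?_) h4
    rw [phiPlus, modeHat_annihilating, neg_neg, ann_natCast, ← rescale_pexp,
      ← BPlus_eq hg.pow_four.q_ne hg.pow_four.t_ne]
    rfl

theorem IsDualIntertwiner.heisHat_neg (h : IsDualIntertwiner q4 t4 N u v w Phi)
    (hg : Generic q4 t4) (mu : YoungDiagram) (n : ℕ+) (f : Fock K) :
    heisHat (q4 ^ 4) (t4 ^ 4) (-n) (Phi f mu) = Phi (heis (q4 ^ 4) (t4 ^ 4) (-n) f) mu +
      (-(kap (q4 ^ 4) (t4 ^ 4) n * (phiExp q4 t4 u mu).2 n)) • Phi f mu := by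
  have hR : t4 ^ 2 / q4 ^ 2 ≠ 0 := div_ne_zero (pow_ne_zero _ hg.t_ne) (pow_ne_zero _ hg.q_ne)
  have hd := hg.phiMinus_fst_ne n.ne_zero
  have h1 := comp_of_comp_expSeries (F := LinearMap.proj mu ∘ₗ Phi)
    (A := fun n => heisHat (q4 ^ 4) (t4 ^ 4) (-n)) (B := fun n => heis (q4 ^ 4) (t4 ^ 4) (-n))
    (c := (phiMinus q4 t4).1)
    (β := fun n => (t4 / q4 * u⁻¹) ^ n * ((1 - (q4 ^ 4 / t4 ^ 4) ^ n) *
      boxSum (q4 ^ 4)⁻¹ (t4 ^ 4)⁻¹ mu n)) (heis_comm_neg (isHeis_heisHat _ _) rfl)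
      (heis_comm_neg (isHeis_heis _ _) rfl) (fun k => ?_) n.ne_zero f
  · have h2 := phiExp_mul_phiMinus (u := u) mu hg n.ne_zero
    rw [← h2] at h1
    simp only [LinearMap.comp_apply, LinearMap.proj_apply] at h1
    refine smul_right_injective _ hd ?_
    simp only [smul_add]
    rw [← h1]
    module
  · refine LinearMap.ext fun f => ?_
    have h3 := congrFun (isDualIntertwiner_iff.1 h (Gen.psim k) f) mu
    rw [coproductAction_psim, horizontal, LinearMap.smul_apply, map_smul, Pi.smul_apply,
      zpow_add_one₀ hR, mul_smul] at h3
    have h4 := smul_right_injective _ hR (smul_right_injective _ (zpow_ne_zero N hR) h3)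
    rw [phiMinus, modeF_creating, ← phiMinus, cre_natCast] at h4
    simp only [LinearMap.comp_apply, LinearMap.proj_apply, LinearMap.sum_apply,
      LinearMap.smul_apply]
    refine Eq.trans (sum_congr rfl fun l _ => ?_) h4
    rw [phiMinus, modeHat_creating, cre_natCast, ← rescale_pexp,
      ← BMinus_eq hg.pow_four.q_ne hg.pow_four.t_ne]
    rfl

theorem isVertex_normalExp {q t : K} (e : Exponents K) :
    IsVertex q t 0 e fun _ => normalExp q t e :=
  isVertex_const_iff.2 ⟨pos_normalExp e, neg_normalExp e⟩

theorem cLam_bot (q t : K) : cLam q t ⊥ = 1 := by simp [cLam]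

theorem cLam'_bot (q t : K) : cLam' q t ⊥ = 1 := by simp [cLam']

/-- Both maps have the same Heisenberg commutators, and by the normalization the same vacuum
expectation value. -/
theorem IsNormalizedDualIntertwiner.apply_bot (h : IsNormalizedDualIntertwiner q4 t4 N u v w Phi)
    (hg : Generic q4 t4) (f : Fock K) :
    Phi f ⊥ = normalExp (q4 ^ 4) (t4 ^ 4) (phiExp q4 t4 u ⊥) f := by
  have h1 := IsVertex.ext hg.pow_four.kap_ne (isVertex_const_iff.2
    ⟨h.1.heisHat_pos hg ⊥, h.1.heisHat_neg hg ⊥⟩ :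
      IsVertex _ _ 0 _ fun _ => LinearMap.proj ⊥ ∘ₗ Phi) (isVertex_normalExp _) (fun _ => ?_) 0
  · exact congrArg (fun T => T f) h1
  · have h2 := h.2
    rw [component, cLam_bot, cLam'_bot, div_one, one_smul] at h2
    rw [h2, constantCoeff_normalExp]

theorem IsNormalizedDualIntertwiner.eq_neg_mul (h : IsNormalizedDualIntertwiner q4 t4 N u v w Phi)
    (hg : Generic q4 t4) (hu : u ≠ 0) : w = -(v * u) := by
  have hr : t4 ^ 2 / q4 ^ 2 ≠ 0 := div_ne_zero (pow_ne_zero _ hg.t_ne) (pow_ne_zero _ hg.q_ne)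
  have hb : (⊥ : YoungDiagram).colLen 0 = 0 := by
    rw [← transpose_bot, YoungDiagram.colLen_transpose, rowLen_bot]
  -- No box can be removed from ∅, so the coproduct has one term there. With n = N this term
  -- involves the zero mode of η, whose vacuum expectation value is 1.
  have h1 := congrFun (isDualIntertwiner_iff.1 h.1 (Gen.xp N) 1) ⊥
  rw [coproductAction_xp _ _ hg.q_ne hg.t_ne hu, hb, sum_range_zero, add_zero, horizontal,
    LinearMap.smul_apply, map_smul, Pi.smul_apply, h.apply_bot hg, h.apply_bot hg] at h1
  have h2 := congrArg (fun T => T 1) (eta_normalExp ⊥ hg hu 0 hb.le)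
  simp only [sum_range_zero, sub_zero, LinearMap.comp_apply, LinearMap.smul_apply, zero_add] at h2
  rw [sub_self, h2, show N + 1 - N = 1 by ring, smul_smul] at h1
  have h3 := congrArg MvPowerSeries.constantCoeff h2
  rw [vev_modeHat_normalExp, contr_eta_phiExp_eq hg hb.le, coeffZ_rescale] at h3
  have h4 := congrArg MvPowerSeries.constantCoeff h1
  rw [MvPowerSeries.constantCoeff_smul] at h3 h4
  rw [MvPowerSeries.constantCoeff_smul] at h4
  generalize MvPowerSeries.constantCoeff (normalExp (q4 ^ 4) (t4 ^ 4) (phiExp q4 t4 u ⊥)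
    (modeF (q4 ^ 4) (t4 ^ 4) (eta t4) 1 1)) = Z at h3 h4
  have hZ : Z ≠ 0 := by
    rintro rfl
    have h5 : coeffZ ((0 : ℕ) : ℤ) (ySeries (nodeA (q4 ^ 4) (t4 ^ 4) ⊥) (nodeB (q4 ^ 4) (t4 ^ 4) ⊥) 0)
      = 1 := by
      rw [coeffZ_natCast]
      simp [ySeries, oneSub]
    simp only [Nat.cast_zero] at h5
    rw [neg_zero, h5, smul_zero] at h3
    simp at h3
  rw [zpow_add_one₀ hr, smul_eq_mul, smul_eq_mul] at h4
  have h6 : (t4 ^ 2 / q4 ^ 2) ^ N * (t4 ^ 2 / q4 ^ 2) * Z ≠ 0 :=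
    mul_ne_zero (mul_ne_zero (zpow_ne_zero N hr) hr) hZ
  refine mul_left_cancel₀ h6 ?_
  linear_combination -h4

/-- A Vandermonde argument with coefficients in a vector space. -/
theorem eq_zero_of_sum_pow_smul {V : Type*} [AddCommGroup V] [Module K V] {s : Finset ℕ} {y : ℕ → K}
    (hy : Set.InjOn y s) {X : ℕ → V} (h : ∀ n : ℕ, ∑ i ∈ s, y i ^ n • X i = 0) {i : ℕ}
    (hi : i ∈ s) : X i = 0 := by
  have h1 : ∀ p : Polynomial K, ∑ j ∈ s, p.eval (y j) • X j = 0 := by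
    intro p
    simp_rw [Polynomial.eval_eq_sum_range, sum_smul]
    rw [sum_comm]
    refine sum_eq_zero fun n _ => ?_
    simp_rw [mul_smul]
    rw [← smul_sum, h, smul_zero]
  -- This polynomial vanishes at every point except the one indexed by i.
  have h2 := h1 (∏ k ∈ s.erase i, (Polynomial.X - Polynomial.C (y k)))
  rw [sum_eq_single_of_mem i hi, Polynomial.eval_prod] at h2
  · refine (smul_eq_zero.1 h2).resolve_left (prod_ne_zero_iff.2 fun k hk => ?_)
    rw [Polynomial.eval_sub, Polynomial.eval_X, Polynomial.eval_C, sub_ne_zero]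
    rw [mem_erase] at hk
    exact fun h' => hk.1 (hy (mem_coe.2 hi) (mem_coe.2 hk.2) h').symm
  · intro j hj hji
    rw [Polynomial.eval_prod, prod_eq_zero (mem_erase.2 ⟨hji, hj⟩), zero_smul]
    simp

/-- An intertwiner whose component at the empty partition vanishes is zero. -/
theorem eq_zero_of_apply_bot (hg : Generic q4 t4) (hu : u ≠ 0)
    (h : ∀ (n : ℤ) (f : Fock K), coproductAction q4 t4 N v u (Gen.xm n) (Phi f) =
      Phi (horizontal (modeF (q4 ^ 4) (t4 ^ 4)) q4 t4 (N + 1) w (Gen.xm n) f))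
    (hbot : ∀ f, Phi f ⊥ = 0) : Phi = 0 := by
  have hg4 := hg.pow_four
  have h1 : ∀ (d : ℕ) (mu : YoungDiagram), mu.card = d → ∀ f, Phi f mu = 0 := by
    intro d
    induction d with
    | zero =>
      intro mu hmu f
      rw [show mu = ⊥ from YoungDiagram.ext (card_eq_zero.1 hmu), hbot]
    | succ d ih =>
      intro mu hmu f
      obtain ⟨lam, i, hadd⟩ := exists_isAdd_of_ne_bot (mu := mu) (by rintro rfl; simp [YoungDiagram.card] at hmu)
      have hlam := ih lam (by have := hadd.card; omega)
      -- By induction the component at `lam` vanishes, so the relations for x^-_n at `lam` say that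
      -- the power-weighted sums of the components at the partitions with one more box are zero; the
      -- weights have distinct bases.
      have h2 := eq_zero_of_sum_pow_smul (s := range (lam.colLen 0 + 1))
        (y := fun j => nodeA (q4 ^ 4) (t4 ^ 4) lam j * u)
        (fun _ _ _ _ h => hg4.nodeA_inj lam (mul_right_cancel₀ hu h))
        (X := fun j => (addBox lam j).elim 0 fun mu =>
          (q4 ^ 2 / t4 ^ 2 * AMinus (q4 ^ 4) (t4 ^ 4) mu j) • Phi f mu) (fun n => ?_)
        (mem_range.2 (Nat.lt_succ_of_le hadd.le_colLen))
      · simp only [addBox_eq_some.2 hadd, Option.elim_some] at h2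
        exact (smul_eq_zero.1 h2).resolve_left (mul_ne_zero (div_ne_zero (pow_ne_zero _ hg.q_ne)
          (pow_ne_zero _ hg.t_ne)) (hadd.AMinus_ne_zero hg4))
      · have h3 := congrFun (h n f) lam
        rw [coproductAction_xm, hlam, hlam, map_zero, smul_zero, zero_add] at h3
        refine Eq.trans (sum_congr rfl fun j _ => ?_) h3
        rcases addBox lam j with _ | mu
        · simp
        · simp only [Option.elim_some, zpow_natCast]
          module
  exact LinearMap.ext fun f => funext fun mu => h1 _ mu rfl f

theorem IsNormalizedDualIntertwiner.eq {Psi : Fock K →ₗ[K] TensorHat K}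
    (h : IsNormalizedDualIntertwiner q4 t4 N u v w Phi)
    (h' : IsNormalizedDualIntertwiner q4 t4 N u v w Psi) (hg : Generic q4 t4) (hu : u ≠ 0) :
    Phi = Psi := by
  refine sub_eq_zero.1 (eq_zero_of_apply_bot (N := N) (v := v) (w := w) hg hu (fun n f => ?_)
    fun f => ?_)
  · rw [LinearMap.sub_apply, LinearMap.sub_apply, map_sub, isDualIntertwiner_iff.1 h.1,
      isDualIntertwiner_iff.1 h'.1]
  · rw [LinearMap.sub_apply, Pi.sub_apply, h.apply_bot hg, h'.apply_bot hg, sub_self]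

end Uniqueness

end

end Toroidal


/-! ### Assembly of existence, uniqueness and the explicit formula. -/

theorem theorem3p4 {K : Type*} [Field K] [CharZero K] (q4 t4 : K)
    (hqt : AlgebraicIndependent ℚ ![q4, t4]) (N : ℤ) (u v w : K)
    (hu : u ≠ 0) (hv : v ≠ 0) (hw : w ≠ 0) :
    ((∃ Phi, Toroidal.IsNormalizedDualIntertwiner q4 t4 N u v w Phi) → w = -(v * u)) ∧
    (w = -(v * u) →
      (∃! Phi, Toroidal.IsNormalizedDualIntertwiner q4 t4 N u v w Phi) ∧
      ∀ Phi, Toroidal.IsNormalizedDualIntertwiner q4 t4 N u v w Phi →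
        ∀ lam : YoungDiagram,
          Toroidal.component q4 t4 Phi lam =
            Toroidal.tStar q4 t4 u v N lam • Toroidal.phiStarTilde q4 t4 u lam) := by
  have hg := Toroidal.generic_of_algebraicIndependent hqt
  refine ⟨fun ⟨Phi, h⟩ => h.eq_neg_mul hg hu, ?_⟩
  rintro rfl
  have h := Toroidal.isNormalizedDualIntertwiner_intertwiner (N := N) hg hu hv
  refine ⟨⟨_, h, fun Psi hPsi => hPsi.eq h hg hu⟩, fun Phi hPhi lam => ?_⟩
  rw [hPhi.eq h hg hu, Toroidal.component_intertwiner hg]
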